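/- Let $M$ be a closed (compact, without boundary) smooth manifold of dimension $n\ge 3$ with a smooth Riemannian metric $g$. Put $c_n=\frac{n-2}{4(n-1)}$ and let $L_g=-\Delta_g+c_nR_g$ be the conformal Laplacian, where $R_g$ is the scalar curvature and $\Delta_g$ the (non-positive) Laplace–Beltrami operator. For a smooth positive function $\mu$ and $\tilde g=\mu^{\frac{4}{n-2}}g$ in the conformal class $[g]$, let $\lambda_1(L_{\tilde g})$ be the smallest element of the spectrum (the first eigenvalue) of $L_{\tilde g}$ on $L^2(M,\tilde g)$, and define $$F^1_g(\tilde g)=\lambda_1(L_{\tilde g})\int_M\mu^{\frac{4}{n-2}}\,dv_g,\qquad \Lambda_1(M,g)=\sup_{\tilde g\in[g]}F^1_g(\tilde g).$$ Suppose that the Yamabe invariant $$Y(M,[g])=\inf_{0\ne u\in W^{1,2}(M,g)}\frac{\int_M \left(|\nabla u|_g^2+c_nR_gu^2\right)dv_g}{\left(\int_M|u|^{\frac{2n}{n-2}}\,dv_g\right)^{\frac{n-2}{n}}}$$ is positive and that $R_g>0$ everywhere on $M$. Then the metric $$g_{\max}=\mu_{\max}^{\frac{4}{n-2}}g:=\left(\frac{R_g}{\int_MR_g\,dv_g}\right)g$$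 belongs to $[g]$ (with $\mu_{\max}$ smooth and positive) and maximizes $F^1_g$ on $[g]$: $$F^1_g(g_{\max})=\Lambda_1(M,g)=c_n\int_MR_g\,dv_g .$$ -/

import Mathlib

open scoped Manifold ContDiff Topology
open MeasureTheory

noncomputable section

/-! ### Metrics and conformal change -/

/-- Smooth Riemannian metrics on an `n`-dimensional manifold without boundary. -/
abbrev RMetric (n : ℕ) (M : Type*) [TopologicalSpace M]
    [ChartedSpace (EuclideanSpace ℝ (Fin n)) M] [IsManifold (𝓡 n) ∞ M] :=
  Bundle.ContMDiffRiemannianMetric (𝓡 n) ∞ (EuclideanSpace ℝ (Fin n))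
    (fun x : M => TangentSpace (𝓡 n) x)

/-- Smooth positive functions `μ` on `M`. -/
abbrev PosSmooth (n : ℕ) (M : Type*) [TopologicalSpace M]
    [ChartedSpace (EuclideanSpace ℝ (Fin n)) M] :=
  {μ : C^∞⟮𝓡 n, M; ℝ⟯ // ∀ x, 0 < μ x}

namespace ConfLap

variable {n : ℕ} {M : Type*} [TopologicalSpace M] [ChartedSpace (EuclideanSpace ℝ (Fin n)) M]

/-- The power `μ ^ (4 / (n - 2))`. -/
def factor (μ : PosSmooth n M) (x : M) : ℝ := (μ.1 x) ^ (4 / ((n : ℝ) - 2))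

theorem factor_pos (μ : PosSmooth n M) (x : M) : 0 < factor μ x :=
  Real.rpow_pos_of_pos (μ.2 x) _

theorem contMDiff_factor (μ : PosSmooth n M) : ContMDiff (𝓡 n) 𝓘(ℝ) ∞ (factor μ) := by
  intro x
  have h : ContDiffAt ℝ ∞ (fun t : ℝ => t ^ (4 / ((n : ℝ) - 2))) (μ.1 x) :=
    Real.contDiffAt_rpow_const_of_ne (μ.2 x).ne'
  exact h.contMDiffAt.comp x (μ.1.contMDiff x)

variable [IsManifold (𝓡 n) ∞ M]

/-- The conformal metric `μ ^ (4 / (n - 2)) g`. -/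
def conformal (g : RMetric n M) (μ : PosSmooth n M) : RMetric n M where
  inner x := factor μ x • g.inner x
  symm x v w := by
    change factor μ x * g.inner x v w = factor μ x * g.inner x w v
    rw [g.symm]
  pos x v hv := mul_pos (factor_pos μ x) (g.pos x v hv)
  isVonNBounded x := by
    have hc := factor_pos μ x
    have h := (g.isVonNBounded x).image
      (σ := RingHom.id ℝ)
      ((Real.sqrt (factor μ x))⁻¹ • ContinuousLinearMap.id ℝ (TangentSpace (𝓡 n) x))
    refine Bornology.IsVonNBounded.subset ?_ h
    intro v hv
    refine ⟨Real.sqrt (factor μ x) • v, ?_, ?_⟩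
    · have hv' : factor μ x * g.inner x v v < 1 := hv
      change g.inner x (Real.sqrt (factor μ x) • v) (Real.sqrt (factor μ x) • v) < 1
      simp only [map_smul, smul_apply, smul_eq_mul]
      rw [← mul_assoc, Real.mul_self_sqrt hc.le]
      exact hv'
    · change (Real.sqrt (factor μ x))⁻¹ • (Real.sqrt (factor μ x) • v) = v
      rw [smul_smul, inv_mul_cancel₀ (Real.sqrt_pos.2 hc).ne', one_smul]
  contMDiff := (contMDiff_factor μ).smul_section g.contMDiff

/-! ### Local coordinates, scalar curvature, Laplace-Beltrami operator -/

/-- The partial derivative `∂ᵢ F` on `ℝⁿ`. -/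
def pd (i : Fin n) (F : EuclideanSpace ℝ (Fin n) → ℝ) (y : EuclideanSpace ℝ (Fin n)) : ℝ :=
  fderiv ℝ F y (EuclideanSpace.single i 1)

/-- The matrix `g_ij` of the metric in the chart around `x`, as a function of the coordinates. -/
def gCoord (g : RMetric n M) (x : M) (y : EuclideanSpace ℝ (Fin n)) :
    Matrix (Fin n) (Fin n) ℝ :=
  Matrix.of fun i j =>
    g.inner ((extChartAt (𝓡 n) x).symm y)
      (mfderiv 𝓘(ℝ, EuclideanSpace ℝ (Fin n)) (𝓡 n) (extChartAt (𝓡 n) x).symm y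
        (EuclideanSpace.single i (1 : ℝ)))
      (mfderiv 𝓘(ℝ, EuclideanSpace ℝ (Fin n)) (𝓡 n) (extChartAt (𝓡 n) x).symm y
        (EuclideanSpace.single j (1 : ℝ)))

/-- The Christoffel symbol `Γ^k_ij` of a matrix-valued function `G = (g_ij)`. -/
def christoffel (G : EuclideanSpace ℝ (Fin n) → Matrix (Fin n) (Fin n) ℝ) (k i j : Fin n)
    (y : EuclideanSpace ℝ (Fin n)) : ℝ :=
  (1 / 2) * ∑ l, (G y)⁻¹ k l *
    (pd i (fun z => G z j l) y + pd j (fun z => G z i l) y - pd l (fun z => G z i j) y)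

/-- The Ricci curvature
`R_jk = ∂ᵢ Γ^i_jk - ∂ⱼ Γ^i_ik + Γ^i_il Γ^l_jk - Γ^i_jl Γ^l_ik` in coordinates. -/
def ricciCoord (G : EuclideanSpace ℝ (Fin n) → Matrix (Fin n) (Fin n) ℝ) (j k : Fin n)
    (y : EuclideanSpace ℝ (Fin n)) : ℝ :=
  ∑ i, (pd i (christoffel G i j k) y - pd j (christoffel G i i k) y +
    ∑ l, (christoffel G i i l y * christoffel G l j k y -
      christoffel G i j l y * christoffel G l i k y))

/-- The scalar curvature `R_g`, the trace `g^jk R_jk` of the Ricci curvature. -/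
def scalarCurvature (g : RMetric n M) (x : M) : ℝ :=
  ∑ j, ∑ k, (gCoord g x (extChartAt (𝓡 n) x x))⁻¹ j k *
    ricciCoord (gCoord g x) j k (extChartAt (𝓡 n) x x)

/-- The Laplace-Beltrami operator `Δ_g u = |g|^(-1/2) ∂ᵢ (|g|^(1/2) g^ij ∂ⱼ u)`. -/
def laplacian (g : RMetric n M) (u : M → ℝ) (x : M) : ℝ :=
  (Real.sqrt (gCoord g x (extChartAt (𝓡 n) x x)).det)⁻¹ *
    ∑ i, pd i (fun z => ∑ j, Real.sqrt (gCoord g x z).det * (gCoord g x z)⁻¹ i j *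
      pd j (fun w => u ((extChartAt (𝓡 n) x).symm w)) z) (extChartAt (𝓡 n) x x)

/-- The dimensional constant `c_n = (n - 2) / (4 (n - 1))`. -/
def cn (n : ℕ) : ℝ := ((n : ℝ) - 2) / (4 * ((n : ℝ) - 1))

/-- The conformal Laplacian `L_g u = - Δ_g u + c_n R_g u` on smooth functions. -/
def confLaplacian (g : RMetric n M) (u : M → ℝ) (x : M) : ℝ :=
  -laplacian g u x + cn n * scalarCurvature g x * u x

/-- The inner product `g^ij αᵢ βⱼ` of covectors at `x`. -/
def coInner (g : RMetric n M) (x : M) (α β : TangentSpace (𝓡 n) x →L[ℝ] ℝ) : ℝ :=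
  ∑ i, ∑ j,
    (Matrix.of fun k l : Fin n =>
      g.inner x (EuclideanSpace.single k (1 : ℝ) : EuclideanSpace ℝ (Fin n))
        (EuclideanSpace.single l (1 : ℝ) : EuclideanSpace ℝ (Fin n)))⁻¹ i j *
      α (EuclideanSpace.single i (1 : ℝ) : EuclideanSpace ℝ (Fin n)) *
      β (EuclideanSpace.single j (1 : ℝ) : EuclideanSpace ℝ (Fin n))

/-- The differential of a real function. -/
def diff (u : M → ℝ) (x : M) : TangentSpace (𝓡 n) x →L[ℝ] ℝ := mfderiv (𝓡 n) 𝓘(ℝ) u x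

/-! ### The Riemannian measure -/

variable [CompactSpace M] [T2Space M]

/-- A smooth partition of unity subordinate to the chart domains (independent of any metric). -/
def chartPartition (n : ℕ) (M : Type*) [TopologicalSpace M]
    [ChartedSpace (EuclideanSpace ℝ (Fin n)) M] [IsManifold (𝓡 n) ∞ M]
    [CompactSpace M] [T2Space M] : SmoothPartitionOfUnity M (𝓡 n) M Set.univ :=
  (SmoothPartitionOfUnity.exists_isSubordinate_chartAt_source (𝓡 n) M).choose

variable [MeasurableSpace M]

/-- The measure `|g|^(1/2) dy` on the domain of the chart around `x`, as a measure on `M`. -/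
def chartVol (g : RMetric n M) (x : M) : Measure M :=
  ((volume.restrict (extChartAt (𝓡 n) x).target).withDensity
    fun y => ENNReal.ofReal (Real.sqrt (gCoord g x y).det)).map (extChartAt (𝓡 n) x).symm

/-- The Riemannian measure `dv_g`: the measures `|g|^(1/2) dy` of the charts agree on the overlaps
and are glued with a partition of unity (the result does not depend on the partition). -/
def vol (g : RMetric n M) : Measure M :=
  Measure.sum fun x : M =>
    (chartVol g x).withDensity fun p => ENNReal.ofReal (chartPartition n M x p)

/-! ### The Sobolev space `W^{1,2}` and the Yamabe invariant -/

/-- `u` lies in `W^{1,2}(M, g)`, the closure of `C^∞(M)` for the norm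
`(∫ u² + |du|²)^(1/2)`, and `η` is its weak differential. Measurability of the covector field `η`
is expressed by pairing it with differentials of smooth functions, which span the cotangent
spaces. -/
def HasWeakDiff (g : RMetric n M) (u : M → ℝ) (η : ∀ x : M, TangentSpace (𝓡 n) x →L[ℝ] ℝ) :
    Prop :=
  AEMeasurable u (vol g) ∧
  (∀ φ : C^∞⟮𝓡 n, M; ℝ⟯, AEMeasurable (fun x => coInner g x (η x) (diff φ x)) (vol g)) ∧
  ∃ s : ℕ → C^∞⟮𝓡 n, M; ℝ⟯,
    Filter.Tendsto
      (fun k => (∫⁻ x, ENNReal.ofReal ((u x - s k x) ^ 2) ∂(vol g)) +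
        ∫⁻ x, ENNReal.ofReal (coInner g x (η x - diff (s k) x) (η x - diff (s k) x)) ∂(vol g))
      Filter.atTop (𝓝 0)

/-- The Yamabe invariant `Y(M, [g])`: the infimum over `u ∈ W^{1,2}(M, g)`, `u ≠ 0`, of
`∫ u L_g u dv_g / (∫ |u|^(2n/(n-2)) dv_g)^((n-2)/n)`, where `∫ u L_g u dv_g` stands for
`∫ |du|² + c_n R_g u² dv_g`. -/
def yamabe (g : RMetric n M) : ℝ :=
  sInf {q : ℝ | ∃ (u : M → ℝ) (η : ∀ x : M, TangentSpace (𝓡 n) x →L[ℝ] ℝ),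
    HasWeakDiff g u η ∧ ¬ (u =ᵐ[vol g] 0) ∧
    q = (∫ x, (coInner g x (η x) (η x) + cn n * scalarCurvature g x * u x ^ 2) ∂(vol g)) /
      (∫ x, |u x| ^ (2 * (n : ℝ) / ((n : ℝ) - 2)) ∂(vol g)) ^ (((n : ℝ) - 2) / (n : ℝ))}

/-! ### The spectrum of the conformal Laplacian and the functional `F_g^1` -/

/-- The graph of the self-adjoint realization of `L_g` in `L²(M, g)`: `u` lies in `W^{1,2}(M, g)`
and `L_g u = f` in the sense of distributions. -/
def IsConfLaplacian (g : RMetric n M) (u f : Lp ℝ 2 (vol g)) : Prop :=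
  (∃ η, HasWeakDiff g u η) ∧
    ∀ φ : C^∞⟮𝓡 n, M; ℝ⟯,
      ∫ x, u x * confLaplacian g φ x ∂(vol g) = ∫ x, f x * φ x ∂(vol g)

/-- The spectrum of `L_g`: the numbers `t` for which `L_g - t` has no bounded inverse
`T : L² → L²`, that is `L_g u - t u = f` if and only if `u = T f`. -/
def spec (g : RMetric n M) : Set ℝ :=
  {t : ℝ | ¬ ∃ T : Lp ℝ 2 (vol g) →L[ℝ] Lp ℝ 2 (vol g),
    ∀ u f : Lp ℝ 2 (vol g), IsConfLaplacian g u (f + t • u) ↔ u = T f}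

/-- The first eigenvalue `λ_1(L_g)`: the bottom of the (discrete, bounded below) spectrum. -/
def lambda1 (g : RMetric n M) : ℝ := sInf (spec g)

/-- `F_g^1(μ^(4/(n-2)) g) = λ_1(L_{μ^(4/(n-2)) g}) ∫ μ^(4/(n-2)) dv_g`. -/
def F1 (g : RMetric n M) (μ : PosSmooth n M) : ℝ :=
  lambda1 (conformal g μ) * ∫ x, factor μ x ∂(vol g)

/-- `Λ_1(M, g)`: the supremum of `F_g^1` over the conformal class of `g`. -/
def Lambda1 (g : RMetric n M) : ℝ := sSup (Set.range (F1 g))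

end ConfLap

end

/-!
The upper bound for `F_g^1` comes from a single test function. For `g̃ = μ^(4/(n-2)) g` the conformal
transformation law of the scalar curvature, applied to `g = (1/μ)^(4/(n-2)) g̃`, reads
`L_g̃ (1/μ) = c_n R_g μ^(-4/(n-2)) (1/μ)`. Since `(1/μ)² dv_g̃ = μ^(4/(n-2)) dv_g`, the Rayleigh
quotient of `1/μ` is `c_n ∫ R_g dv_g / ∫ μ^(4/(n-2)) dv_g`, so that `F_g^1(g̃) ≤ c_n ∫ R_g dv_g`
(`ConfLap.F1_le`). For `μ^(4/(n-2)) = R_g / ∫ R_g dv_g` the same identity says that `1/μ` is an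
eigenfunction of `L_g̃` for the eigenvalue `c_n ∫ R_g dv_g`. As it is positive, this eigenvalue is
the first one: writing a test function as `s = ν w` with `ν = 1/μ` one has
`∫ s L s = ∫ ν² |dw|² + ∫ w² ν L ν` (`ConfLap.le_lambda1_of_eigenfunction`). Positivity of the
Yamabe invariant is needed only to know that `M` is nonempty.

The spectrum is defined through the weak realization of `L_g` with domain in `W^{1,2}`. The identity
of its infimum with the infimum of the Rayleigh quotients of smooth functions (`ConfLap.lambda1_eq`)
is deduced from a statement on the Friedrichs extension of a symmetric operator bounded below on a
core (`FormOperator.sInf_spectrum`), which needs neither compactness of the resolvent nor elliptic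
regularity: below the infimum the equation is solved by the direct method, and at the infimum an
almost minimizing sequence contradicts the boundedness of an inverse. To apply it one identifies
`W^{1,2}` with the form domain (`ConfLap.exists_hasWeakDiff_iff`) and proves Green's formula
(`ConfLap.integral_green`) with the partition of unity that defines the measure.

The scalar curvature, the Laplacian and the measure are defined by coordinate formulas. They do not
depend on the chart, since the Levi-Civita connection, as the unique torsion-free metric connection,
transforms by the gauge law under a change of coordinates
(`ConfLap.IsPullback.jac_mul_christoffelM`). The same uniqueness yields the connection of a conformal
metric, and with it the transformation law of the scalar curvature
(`ConfLap.SmoothMetricOn.scalarCoord_conformal`).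
-/

noncomputable section

set_option linter.unusedSectionVars false

/-! ### Symmetric operators bounded below and the bottom of the spectrum -/

namespace FormOperator

open Filter

variable {H : Type*} [NormedAddCommGroup H] [InnerProductSpace ℝ H]
  {D : Type*} [AddCommGroup D] [Module ℝ D]

/-- The shifted form `⟨ι s, A φ⟩ - t ⟨ι s, ι φ⟩` of an operator `A` with core `D`, where `ι` embeds
the core into the Hilbert space. -/
def shiftedForm (ι A : D →ₗ[ℝ] H) (t : ℝ) : LinearMap.BilinForm ℝ D :=
  (innerₗ H).compl₁₂ ι A - t • (innerₗ H).compl₁₂ ι ι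

/-- The domain of the closure of the form `⟨ι s, A s⟩`. -/
def FormDomain (ι A : D →ₗ[ℝ] H) (u : H) : Prop :=
  ∃ s : ℕ → D, Tendsto (fun k => ι (s k)) atTop (𝓝 u) ∧
    Tendsto (fun p : ℕ × ℕ => shiftedForm ι A 0 (s p.1 - s p.2) (s p.1 - s p.2)) atTop (𝓝 0)

/-- The graph of the Friedrichs extension of `A`. -/
def InGraph (ι A : D →ₗ[ℝ] H) (u f : H) : Prop :=
  FormDomain ι A u ∧ ∀ φ, inner ℝ u (A φ) = inner ℝ f (ι φ)

/-- The numbers `t` for which the Friedrichs extension minus `t` has no bounded inverse. -/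
def spectrum (ι A : D →ₗ[ℝ] H) : Set ℝ :=
  {t | ¬ ∃ T : H →L[ℝ] H, ∀ u f : H, InGraph ι A u (f + t • u) ↔ u = T f}

variable {ι A : D →ₗ[ℝ] H}

theorem shiftedForm_apply (t : ℝ) (s φ : D) :
    shiftedForm ι A t s φ = inner ℝ (ι s) (A φ) - t * inner ℝ (ι s) (ι φ) := rfl

theorem shiftedForm_self (t : ℝ) (s : D) :
    shiftedForm ι A t s s = inner ℝ (ι s) (A s) - t * ‖ι s‖ ^ 2 := by
  rw [shiftedForm_apply, real_inner_self_eq_norm_sq]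

theorem shiftedForm_comm (hsymm : ∀ s φ, inner ℝ (ι s) (A φ) = inner ℝ (ι φ) (A s)) (t : ℝ)
    (s φ : D) : shiftedForm ι A t s φ = shiftedForm ι A t φ s := by
  rw [shiftedForm_apply, shiftedForm_apply, hsymm, real_inner_comm (ι s) (ι φ)]

theorem shiftedForm_sq_le (hsymm : ∀ s φ, inner ℝ (ι s) (A φ) = inner ℝ (ι φ) (A s)) {t : ℝ}
    (hpos : ∀ s, 0 ≤ shiftedForm ι A t s s) (s φ : D) :
    shiftedForm ι A t s φ ^ 2 ≤ shiftedForm ι A t s s * shiftedForm ι A t φ φ := by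
  have h := LinearMap.BilinForm.apply_mul_apply_le_of_forall_zero_le (shiftedForm ι A t) hpos s φ
  rw [shiftedForm_comm hsymm t φ s] at h
  nlinarith [h]

theorem shiftedForm_add_le (hsymm : ∀ s φ, inner ℝ (ι s) (A φ) = inner ℝ (ι φ) (A s)) {t : ℝ}
    (hpos : ∀ s, 0 ≤ shiftedForm ι A t s s) (s φ : D) :
    shiftedForm ι A t (s + φ) (s + φ) ≤
      2 * shiftedForm ι A t s s + 2 * shiftedForm ι A t φ φ := by
  have h := hpos (s - φ)
  have hc := shiftedForm_comm hsymm t s φ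
  simp only [map_add, map_sub, LinearMap.add_apply, LinearMap.sub_apply] at h ⊢
  linarith

/-- For a sequence converging in the Hilbert space, being Cauchy for the form does not depend on
the shift. -/
theorem tendsto_shiftedForm_sub {s : ℕ → D} {u : H}
    (hs : Tendsto (fun k => ι (s k)) atTop (𝓝 u)) {t : ℝ}
    (ht : Tendsto (fun p : ℕ × ℕ => shiftedForm ι A t (s p.1 - s p.2) (s p.1 - s p.2))
      atTop (𝓝 0)) (t' : ℝ) :
    Tendsto (fun p : ℕ × ℕ => shiftedForm ι A t' (s p.1 - s p.2) (s p.1 - s p.2))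
      atTop (𝓝 0) := by
  have h1 : Tendsto (fun p : ℕ × ℕ => ι (s p.1 - s p.2)) atTop (𝓝 0) := by
    have h := (hs.comp (tendsto_fst (f := atTop) (g := atTop))).sub
      (hs.comp (tendsto_snd (f := atTop) (g := atTop)))
    rw [prod_atTop_atTop_eq, sub_self] at h
    simpa [Function.comp_def] using h
  have h2 := ht.add (((h1.norm.pow 2)).const_mul (t - t'))
  simp only [norm_zero, ne_eq, OfNat.ofNat_ne_zero, not_false_eq_true, zero_pow, mul_zero,
    add_zero] at h2
  refine h2.congr fun p => ?_
  rw [shiftedForm_self, shiftedForm_self]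
  ring

/-- Along a sequence which converges to `u` for the form, the energies converge to `⟨f, u⟩` if
`A u - t u = f` weakly. -/
theorem tendsto_shiftedForm_self
    (hsymm : ∀ s φ, inner ℝ (ι s) (A φ) = inner ℝ (ι φ) (A s)) {t : ℝ}
    (hpos : ∀ s, 0 ≤ shiftedForm ι A t s s) {s : ℕ → D} {u f : H}
    (hs : Tendsto (fun k => ι (s k)) atTop (𝓝 u))
    (hc : Tendsto (fun p : ℕ × ℕ => shiftedForm ι A t (s p.1 - s p.2) (s p.1 - s p.2))
      atTop (𝓝 0))
    (hu : ∀ φ, inner ℝ u (A φ) = inner ℝ (f + t • u) (ι φ)) :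
    Tendsto (fun k => shiftedForm ι A t (s k) (s k)) atTop (𝓝 (inner ℝ f u)) := by
  have hlim : ∀ φ, Tendsto (fun i => shiftedForm ι A t (s i) φ) atTop (𝓝 (inner ℝ f (ι φ))) := by
    intro φ
    have h := (hs.inner (tendsto_const_nhds (x := A φ))).sub
      ((hs.inner (tendsto_const_nhds (x := ι φ))).const_mul t)
    rw [hu, inner_add_left, inner_smul_left] at h
    simpa [shiftedForm_apply] using h
  rw [Metric.tendsto_atTop] at hc
  have hcau : ∀ ε > 0, ∃ N, ∀ i ≥ N, ∀ j ≥ N,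
      shiftedForm ι A t (s i - s j) (s i - s j) < ε := by
    intro ε hε
    obtain ⟨⟨N, N'⟩, hN⟩ := hc ε hε
    refine ⟨max N N', fun i hi j hj => ?_⟩
    have := hN (i, j) ⟨le_trans (le_max_left _ _) hi, le_trans (le_max_right _ _) hj⟩
    rw [Real.dist_eq, sub_zero] at this
    exact (le_abs_self _).trans_lt this
  obtain ⟨N₀, hN₀⟩ := hcau 1 one_pos
  set K := 2 + 2 * shiftedForm ι A t (s N₀) (s N₀) with hK
  have hKpos : 0 < K := by have := hpos (s N₀); positivity
  have hbd : ∀ k ≥ N₀, shiftedForm ι A t (s k) (s k) ≤ K := by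
    intro k hk
    have h1 := shiftedForm_add_le hsymm hpos (s k - s N₀) (s N₀)
    rw [sub_add_cancel] at h1
    have h2 := hN₀ k hk N₀ le_rfl
    linarith
  have hdiff : Tendsto (fun k => shiftedForm ι A t (s k) (s k) - inner ℝ f (ι (s k)))
      atTop (𝓝 0) := by
    rw [Metric.tendsto_atTop]
    intro ε hε
    obtain ⟨N, hN⟩ := hcau (ε ^ 2 / (4 * K)) (by positivity)
    refine ⟨max N N₀, fun k hk => ?_⟩
    have hkN := le_trans (le_max_left _ _) hk
    have hkN₀ := le_trans (le_max_right _ _) hk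
    rw [Real.dist_eq, sub_zero]
    have hl : Tendsto (fun i => |shiftedForm ι A t (s k - s i) (s k)|) atTop
        (𝓝 |shiftedForm ι A t (s k) (s k) - inner ℝ f (ι (s k))|) := by
      simp only [map_sub, LinearMap.sub_apply]
      exact (tendsto_const_nhds.sub (hlim (s k))).abs
    have hle : |shiftedForm ι A t (s k) (s k) - inner ℝ f (ι (s k))| ≤ ε / 2 := by
      refine le_of_tendsto hl ?_
      filter_upwards [eventually_ge_atTop N] with i hi
      refine abs_le_of_sq_le_sq ?_ (by positivity)
      calc _ ≤ _ := shiftedForm_sq_le hsymm hpos _ _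
        _ ≤ ε ^ 2 / (4 * K) * K :=
          mul_le_mul (hN k hkN i hi).le (hbd k hkN₀) (hpos _) (by positivity)
        _ = (ε / 2) ^ 2 := by field_simp; norm_num
    linarith
  have h := hdiff.add ((tendsto_const_nhds (x := f)).inner hs)
  simpa using h

theorem FormDomain.add (hsymm : ∀ s φ, inner ℝ (ι s) (A φ) = inner ℝ (ι φ) (A s)) {t : ℝ}
    (hpos : ∀ s, 0 ≤ shiftedForm ι A t s s) {u v : H} (hu : FormDomain ι A u)
    (hv : FormDomain ι A v) : FormDomain ι A (u + v) := by
  obtain ⟨s, hs, hs'⟩ := hu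
  obtain ⟨r, hr, hr'⟩ := hv
  have hsr : Tendsto (fun k => ι (s k + r k)) atTop (𝓝 (u + v)) := by
    simpa using hs.add hr
  refine ⟨fun k => s k + r k, hsr, tendsto_shiftedForm_sub (t := t) hsr ?_ 0⟩
  have h := ((tendsto_shiftedForm_sub hs hs' t).const_mul 2).add
    ((tendsto_shiftedForm_sub hr hr' t).const_mul 2)
  simp only [mul_zero, add_zero] at h
  refine squeeze_zero (fun p => hpos _) (fun p => ?_) h
  have := shiftedForm_add_le hsymm hpos (s p.1 - s p.2) (r p.1 - r p.2)
  rwa [show s p.1 - s p.2 + (r p.1 - r p.2) = s p.1 + r p.1 - (s p.2 + r p.2) by abel] at this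

theorem FormDomain.smul {u : H} (hu : FormDomain ι A u) (c : ℝ) : FormDomain ι A (c • u) := by
  obtain ⟨s, hs, hs'⟩ := hu
  refine ⟨fun k => c • s k, by simpa using hs.const_smul c, ?_⟩
  have h := hs'.const_mul (c * c)
  rw [mul_zero] at h
  refine h.congr fun p => ?_
  rw [← smul_sub, map_smul, map_smul, LinearMap.smul_apply, smul_eq_mul, smul_eq_mul, mul_assoc]

/-- If `A - t` is bounded below by `δ > 0`, so is its Friedrichs extension. -/
theorem norm_le_of_inGraph (hsymm : ∀ s φ, inner ℝ (ι s) (A φ) = inner ℝ (ι φ) (A s)) {t δ : ℝ}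
    (hδ : 0 < δ) (hpos : ∀ s, δ * ‖ι s‖ ^ 2 ≤ shiftedForm ι A t s s) {u f : H}
    (hu : InGraph ι A u (f + t • u)) : δ * ‖u‖ ≤ ‖f‖ := by
  obtain ⟨⟨s, hs, hs'⟩, hw⟩ := hu
  have h0 : ∀ s, 0 ≤ shiftedForm ι A t s s := fun s => le_trans (by positivity) (hpos s)
  have h1 := tendsto_shiftedForm_self hsymm h0 hs (tendsto_shiftedForm_sub hs hs' t) hw
  have h2 := le_of_tendsto_of_tendsto' ((hs.norm.pow 2).const_mul δ) h1 fun k => hpos (s k)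
  have h3 : δ * ‖u‖ ^ 2 ≤ ‖f‖ * ‖u‖ := h2.trans (real_inner_le_norm f u)
  rcases (norm_nonneg u).eq_or_lt with h | h
  · rw [← h, mul_zero]; exact norm_nonneg f
  · nlinarith

/-- The equation `A u - t u = f` is solved by minimizing `⟨A s, s⟩ - t |s|² - 2 ⟨f, s⟩`: by the
parallelogram law a minimizing sequence is Cauchy for the form. -/
theorem exists_inGraph [CompleteSpace H]
    (hsymm : ∀ s φ, inner ℝ (ι s) (A φ) = inner ℝ (ι φ) (A s)) {t δ : ℝ}
    (hδ : 0 < δ) (hpos : ∀ s, δ * ‖ι s‖ ^ 2 ≤ shiftedForm ι A t s s) (f : H) :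
    ∃ u, InGraph ι A u (f + t • u) := by
  have h0 : ∀ s, 0 ≤ shiftedForm ι A t s s := fun s => le_trans (by positivity) (hpos s)
  set J : D → ℝ := fun s => shiftedForm ι A t s s - 2 * inner ℝ f (ι s) with hJ
  have hbdd : BddBelow (Set.range J) := by
    refine ⟨-(‖f‖ ^ 2 / δ), ?_⟩
    rintro _ ⟨s, rfl⟩
    have h1 := real_inner_le_norm f (ι s)
    have h2 := hpos s
    have h3 : 0 ≤ (δ * ‖ι s‖ - ‖f‖) ^ 2 / δ := by positivity
    have h4 : (δ * ‖ι s‖ - ‖f‖) ^ 2 / δ = δ * ‖ι s‖ ^ 2 - 2 * (‖f‖ * ‖ι s‖) + ‖f‖ ^ 2 / δ := by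
      field_simp; ring
    simp only [hJ]
    linarith
  set m := sInf (Set.range J)
  have hm : ∀ s, m ≤ J s := fun s => csInf_le hbdd ⟨s, rfl⟩
  have hex : ∀ k : ℕ, ∃ s, J s < m + 1 / ((k : ℝ) + 1) := by
    intro k
    obtain ⟨_, ⟨s, rfl⟩, hs⟩ := Real.lt_sInf_add_pos (s := Set.range J) ⟨J 0, 0, rfl⟩
      (Nat.one_div_pos_of_nat (α := ℝ) (n := k))
    exact ⟨s, hs⟩
  choose s hs using hex
  have hε : Tendsto (fun k : ℕ => 1 / ((k : ℝ) + 1)) atTop (𝓝 0) :=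
    tendsto_one_div_add_atTop_nhds_zero_nat
  have hcau : Tendsto (fun p : ℕ × ℕ => shiftedForm ι A t (s p.1 - s p.2) (s p.1 - s p.2))
      atTop (𝓝 0) := by
    have h := ((hε.comp (tendsto_fst (f := atTop) (g := atTop))).const_mul 2).add
      ((hε.comp (tendsto_snd (f := atTop) (g := atTop))).const_mul 2)
    rw [prod_atTop_atTop_eq, mul_zero, add_zero] at h
    refine squeeze_zero (fun p => h0 _) (fun p => ?_) h
    have h1 := hm ((1 / 2 : ℝ) • (s p.1 + s p.2))
    have h2 := hs p.1
    have h3 := hs p.2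
    have hcm := shiftedForm_comm hsymm t (s p.1) (s p.2)
    simp only [hJ, map_smul, map_add, map_sub, LinearMap.smul_apply, LinearMap.add_apply,
      LinearMap.sub_apply, smul_eq_mul, inner_smul_right, inner_add_right,
      Function.comp_def] at h1 h2 h3 ⊢
    linarith
  have hcauι : CauchySeq fun k => ι (s k) := by
    rw [Metric.cauchySeq_iff]
    intro ε hε'
    rw [Metric.tendsto_atTop] at hcau
    obtain ⟨⟨N, N'⟩, hN⟩ := hcau (δ * ε ^ 2) (by positivity)
    refine ⟨max N N', fun i hi j hj => ?_⟩
    have h1 := hN (i, j) ⟨le_trans (le_max_left _ _) hi, le_trans (le_max_right _ _) hj⟩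
    rw [Real.dist_eq, sub_zero] at h1
    have h2 := (hpos (s i - s j)).trans_lt ((le_abs_self _).trans_lt h1)
    have h3 := lt_of_mul_lt_mul_left h2 hδ.le
    rw [dist_eq_norm, ← map_sub]
    exact lt_of_pow_lt_pow_left₀ 2 hε'.le h3
  obtain ⟨u, hu⟩ := cauchySeq_tendsto_of_complete hcauι
  refine ⟨u, ⟨s, hu, tendsto_shiftedForm_sub hu hcau 0⟩, fun φ => ?_⟩
  -- The Euler-Lagrange equation holds up to an error controlled by the defect of minimality.
  have hel : ∀ k, (shiftedForm ι A t (s k) φ - inner ℝ f (ι φ)) ^ 2 ≤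
      shiftedForm ι A t φ φ * (1 / ((k : ℝ) + 1)) := by
    intro k
    have hd := discrim_le_zero (a := shiftedForm ι A t φ φ)
      (b := 2 * (shiftedForm ι A t (s k) φ - inner ℝ f (ι φ))) (c := 1 / ((k : ℝ) + 1)) ?_
    · rw [discrim] at hd; nlinarith
    · intro τ
      have h1 := hm (s k + τ • φ)
      have h2 := hs k
      have hcm := shiftedForm_comm hsymm t (s k) φ
      simp only [hJ, map_smul, map_add, LinearMap.smul_apply, LinearMap.add_apply,
        smul_eq_mul, inner_smul_right, inner_add_right] at h1 h2
      rw [← hcm] at h1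
      nlinarith
  have hsq := squeeze_zero (fun k => sq_nonneg _) hel
    (by simpa using hε.const_mul (shiftedForm ι A t φ φ))
  have h1 : Tendsto (fun k => (shiftedForm ι A t (s k) φ - inner ℝ f (ι φ)) ^ 2) atTop
      (𝓝 ((inner ℝ u (A φ) - t * inner ℝ u (ι φ) - inner ℝ f (ι φ)) ^ 2)) := by
    simp only [shiftedForm_apply]
    exact (((hu.inner tendsto_const_nhds).sub
      ((hu.inner tendsto_const_nhds).const_mul t)).sub tendsto_const_nhds).pow 2
  have h2 := pow_eq_zero_iff two_ne_zero |>.1 (tendsto_nhds_unique h1 hsq)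
  rw [inner_add_left, inner_smul_left]
  simp only [conj_trivial]
  linarith

/-- A number below a lower bound of the form is not in the spectrum. -/
theorem notMem_spectrum [CompleteSpace H]
    (hsymm : ∀ s φ, inner ℝ (ι s) (A φ) = inner ℝ (ι φ) (A s)) {ν t : ℝ}
    (hν : ∀ s, ν * ‖ι s‖ ^ 2 ≤ inner ℝ (ι s) (A s)) (ht : t < ν) : t ∉ spectrum ι A := by
  have hδ : 0 < ν - t := sub_pos.2 ht
  have hpos : ∀ s, (ν - t) * ‖ι s‖ ^ 2 ≤ shiftedForm ι A t s s := by
    intro s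
    rw [shiftedForm_self]
    linarith [hν s]
  have h0 : ∀ s, 0 ≤ shiftedForm ι A t s s := fun s => le_trans (by positivity) (hpos s)
  have hadd : ∀ {u v f h : H}, InGraph ι A u (f + t • u) → InGraph ι A v (h + t • v) →
      InGraph ι A (u + v) ((f + h) + t • (u + v)) := by
    intro u v f h hu hv
    refine ⟨hu.1.add hsymm h0 hv.1, fun φ => ?_⟩
    rw [show f + h + t • (u + v) = (f + t • u) + (h + t • v) by rw [smul_add]; abel,
      inner_add_left, inner_add_left, hu.2, hv.2]
  have hsmul : ∀ {u f : H} (c : ℝ), InGraph ι A u (f + t • u) →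
      InGraph ι A (c • u) (c • f + t • (c • u)) := by
    intro u f c hu
    refine ⟨hu.1.smul c, fun φ => ?_⟩
    rw [show c • f + t • (c • u) = c • (f + t • u) by rw [smul_add, smul_comm t c],
      inner_smul_left, inner_smul_left, hu.2]
  have huniq : ∀ {u v f : H}, InGraph ι A u (f + t • u) → InGraph ι A v (f + t • v) → u = v := by
    intro u v f hu hv
    have h := hadd hu (hsmul (-1) hv)
    rw [neg_one_smul, neg_one_smul, add_neg_cancel] at h
    have h' := norm_le_of_inGraph hsymm hδ hpos h
    rw [norm_zero] at h'
    have : ‖u + -v‖ ≤ 0 := by nlinarith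
    rw [← sub_eq_zero, sub_eq_add_neg]
    exact norm_le_zero_iff.1 this
  choose T hT using exists_inGraph hsymm hδ hpos
  let T₀ : H →ₗ[ℝ] H :=
    { toFun := T
      map_add' := fun f h => huniq (hT _) (hadd (hT f) (hT h))
      map_smul' := fun c f => huniq (hT _) (hsmul c (hT f)) }
  have hbound : ∀ f, ‖T₀ f‖ ≤ (ν - t)⁻¹ * ‖f‖ := by
    intro f
    rw [inv_mul_eq_div, le_div_iff₀ hδ, mul_comm]
    exact norm_le_of_inGraph hsymm hδ hpos (hT f)
  simp only [spectrum, Set.mem_ofPred_eq, not_not]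
  refine ⟨T₀.mkContinuous _ hbound, fun u f => ⟨fun h => huniq h (hT f), ?_⟩⟩
  rintro rfl
  exact hT f

/-- The infimum of the Rayleigh quotient is in the spectrum: if `T` inverts `A - ν` and `s` is an
almost minimizer, then `‖ι s‖² = ⟨(A - ν) T (ι s), ι s⟩` is small by the Cauchy-Schwarz inequality
for the form of `A - ν`. -/
theorem mem_spectrum (hsymm : ∀ s φ, inner ℝ (ι s) (A φ) = inner ℝ (ι φ) (A s)) {ν : ℝ}
    (hν : ∀ s, ν * ‖ι s‖ ^ 2 ≤ inner ℝ (ι s) (A s))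
    (hinf : ∀ ε > 0, ∃ s, inner ℝ (ι s) (A s) < (ν + ε) * ‖ι s‖ ^ 2) : ν ∈ spectrum ι A := by
  rintro ⟨T, hT⟩
  have h0 : ∀ s, 0 ≤ shiftedForm ι A ν s s := by
    intro s
    rw [shiftedForm_self]
    linarith [hν s]
  have key : ∀ r, ‖ι r‖ ^ 2 ≤ ‖T‖ * shiftedForm ι A ν r r := by
    intro r
    obtain ⟨⟨s, hs, hs'⟩, hw⟩ := (hT (T (ι r)) (ι r)).2 rfl
    have h1 := tendsto_shiftedForm_self hsymm h0 hs (tendsto_shiftedForm_sub hs hs' ν) hw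
    have h2 : Tendsto (fun k => shiftedForm ι A ν (s k) r) atTop (𝓝 (‖ι r‖ ^ 2)) := by
      have h := (hs.inner (tendsto_const_nhds (x := A r))).sub
        ((hs.inner (tendsto_const_nhds (x := ι r))).const_mul ν)
      rw [hw, inner_add_left, inner_smul_left, real_inner_self_eq_norm_sq] at h
      simpa [shiftedForm_apply] using h
    have h3 := le_of_tendsto_of_tendsto' (h2.pow 2) (h1.mul_const (shiftedForm ι A ν r r))
      fun k => shiftedForm_sq_le hsymm h0 (s k) r
    have h4 : inner ℝ (ι r) (T (ι r)) ≤ ‖T‖ * ‖ι r‖ ^ 2 := by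
      calc _ ≤ ‖ι r‖ * ‖T (ι r)‖ := real_inner_le_norm _ _
        _ ≤ ‖ι r‖ * (‖T‖ * ‖ι r‖) := by gcongr; exact T.le_opNorm _
        _ = _ := by ring
    have h5 := h3.trans (mul_le_mul_of_nonneg_right h4 (h0 r))
    rcases (sq_nonneg ‖ι r‖).eq_or_lt with h | h
    · rw [← h]; exact mul_nonneg (norm_nonneg _) (h0 r)
    · nlinarith
  obtain ⟨s, hs⟩ := hinf ((‖T‖ + 1)⁻¹) (by positivity)
  have h1 := key s
  rw [shiftedForm_self] at h1
  have hlt : inner ℝ (ι s) (A s) - ν * ‖ι s‖ ^ 2 < (‖T‖ + 1)⁻¹ * ‖ι s‖ ^ 2 := by linarith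
  have h2 : ‖ι s‖ ^ 2 ≤ ‖T‖ * ((‖T‖ + 1)⁻¹ * ‖ι s‖ ^ 2) :=
    h1.trans (mul_le_mul_of_nonneg_left hlt.le (norm_nonneg _))
  have h3 : 0 < ‖ι s‖ ^ 2 := by
    rcases (sq_nonneg ‖ι s‖).eq_or_lt with h | h
    · have := hν s
      rw [← h] at hs this
      simp at hs this
      linarith
    · exact h
  have h4 : ‖T‖ * (‖T‖ + 1)⁻¹ < 1 := by
    rw [← div_eq_mul_inv, div_lt_one (by positivity)]
    linarith
  nlinarith

/-- The bottom of the spectrum is the infimum of the Rayleigh quotient over the core. -/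
theorem sInf_spectrum [CompleteSpace H]
    (hsymm : ∀ s φ, inner ℝ (ι s) (A φ) = inner ℝ (ι φ) (A s)) {C : ℝ}
    (hC : ∀ s, C * ‖ι s‖ ^ 2 ≤ inner ℝ (ι s) (A s)) (hne : ∃ s, ι s ≠ 0) :
    sInf (spectrum ι A) = sInf {q | ∃ s, ι s ≠ 0 ∧ q = inner ℝ (ι s) (A s) / ‖ι s‖ ^ 2} := by
  set Q := {q | ∃ s, ι s ≠ 0 ∧ q = inner ℝ (ι s) (A s) / ‖ι s‖ ^ 2} with hQ
  have hQne : Q.Nonempty := by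
    obtain ⟨s, hs⟩ := hne
    exact ⟨_, s, hs, rfl⟩
  have hQbdd : BddBelow Q := by
    refine ⟨C, ?_⟩
    rintro _ ⟨s, hs, rfl⟩
    rw [le_div_iff₀ (by positivity)]
    exact hC s
  have hν : ∀ s, sInf Q * ‖ι s‖ ^ 2 ≤ inner ℝ (ι s) (A s) := by
    intro s
    by_cases hs : ι s = 0
    · simp [hs]
    · rw [← le_div_iff₀ (by positivity)]
      exact csInf_le hQbdd ⟨s, hs, rfl⟩
  refine IsLeast.csInf_eq ⟨mem_spectrum hsymm hν fun ε hε => ?_, fun t ht => ?_⟩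
  · obtain ⟨_, ⟨s, hs, rfl⟩, h⟩ := Real.lt_sInf_add_pos hQne hε
    exact ⟨s, (div_lt_iff₀ (by positivity)).1 h⟩
  · by_contra hlt
    exact notMem_spectrum hsymm hν (not_le.1 hlt) ht

end FormOperator

namespace ConfLap

/-! ### Partial derivatives of functions and matrices -/

section Calculus

variable {n : ℕ} {F K : EuclideanSpace ℝ (Fin n) → ℝ} {y : EuclideanSpace ℝ (Fin n)}

theorem pd_congr {i : Fin n} (h : F =ᶠ[𝓝 y] K) : pd i F y = pd i K y := by
  rw [pd, pd, h.fderiv_eq]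

theorem pd_const (i : Fin n) (c : ℝ) (y : EuclideanSpace ℝ (Fin n)) :
    pd i (fun _ => c) y = 0 := by
  simp [pd]

theorem pd_add (i : Fin n) (hF : DifferentiableAt ℝ F y) (hK : DifferentiableAt ℝ K y) :
    pd i (fun z => F z + K z) y = pd i F y + pd i K y := by
  simp [pd, fderiv_fun_add hF hK]

theorem pd_sub (i : Fin n) (hF : DifferentiableAt ℝ F y) (hK : DifferentiableAt ℝ K y) :
    pd i (fun z => F z - K z) y = pd i F y - pd i K y := by
  simp [pd, fderiv_fun_sub hF hK]

theorem pd_mul (i : Fin n) (hF : DifferentiableAt ℝ F y) (hK : DifferentiableAt ℝ K y) :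
    pd i (fun z => F z * K z) y = pd i F y * K y + F y * pd i K y := by
  simp [pd, fderiv_fun_mul hF hK]
  ring

theorem pd_const_mul (i : Fin n) (c : ℝ) (hF : DifferentiableAt ℝ F y) :
    pd i (fun z => c * F z) y = c * pd i F y := by
  simp [pd, fderiv_const_mul hF]

theorem pd_sum {ι : Type*} (i : Fin n) (s : Finset ι) {f : ι → EuclideanSpace ℝ (Fin n) → ℝ}
    (hf : ∀ a ∈ s, DifferentiableAt ℝ (f a) y) :
    pd i (fun z => ∑ a ∈ s, f a z) y = ∑ a ∈ s, pd i (f a) y := by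
  simp [pd, fderiv_fun_sum hf]

theorem pd_scomp (i : Fin n) {h : ℝ → ℝ} (hh : DifferentiableAt ℝ h (F y))
    (hF : DifferentiableAt ℝ F y) :
    pd i (fun z => h (F z)) y = deriv h (F y) * pd i F y := by
  have := (hh.hasDerivAt.comp_hasFDerivAt y hF.hasFDerivAt).fderiv
  simp only [pd]
  rw [show (fun z => h (F z)) = h ∘ F from rfl, this]
  simp

theorem fderiv_apply_eq_sum (v : EuclideanSpace ℝ (Fin n)) :
    fderiv ℝ F y v = ∑ a, v a * pd a F y := by
  conv_lhs => rw [← (EuclideanSpace.basisFun (Fin n) ℝ).sum_repr v]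
  simp [pd]

theorem pd_coord {ψ : EuclideanSpace ℝ (Fin n) → EuclideanSpace ℝ (Fin n)}
    (hψ : DifferentiableAt ℝ ψ y) (c j : Fin n) :
    pd j (fun w => ψ w c) y = fderiv ℝ ψ y (EuclideanSpace.single j 1) c := by
  have h : HasFDerivAt (fun w => ψ w c) ((EuclideanSpace.proj (𝕜 := ℝ) c).comp (fderiv ℝ ψ y)) y :=
    (EuclideanSpace.proj (𝕜 := ℝ) c).hasFDerivAt.comp y hψ.hasFDerivAt
  rw [pd, h.fderiv]
  rfl

theorem pd_comp {ψ : EuclideanSpace ℝ (Fin n) → EuclideanSpace ℝ (Fin n)}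
    (hψ : DifferentiableAt ℝ ψ y) (hF : DifferentiableAt ℝ F (ψ y)) (j : Fin n) :
    pd j (fun w => F (ψ w)) y = ∑ c, pd j (fun w => ψ w c) y * pd c F (ψ y) := by
  have h := (hF.hasFDerivAt.comp y hψ.hasFDerivAt).fderiv
  rw [pd, show (fun w => F (ψ w)) = F ∘ ψ from rfl, h, ContinuousLinearMap.comp_apply,
    fderiv_apply_eq_sum]
  exact Finset.sum_congr rfl fun c _ => by rw [pd_coord hψ]

theorem contDiffAt_pd (hF : ContDiffAt ℝ ∞ F y) (i : Fin n) : ContDiffAt ℝ ∞ (pd i F) y := by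
  have h : ContDiffAt ℝ ∞ (fderiv ℝ F) y := hF.fderiv_right (m := ∞) (by simp)
  exact h.clm_apply contDiffAt_const

theorem pd_comm (hF : ContDiffAt ℝ ∞ F y) (i j : Fin n) : pd i (pd j F) y = pd j (pd i F) y := by
  have hd : DifferentiableAt ℝ (fderiv ℝ F) y :=
    (hF.fderiv_right (m := ∞) (by simp)).differentiableAt (by simp)
  have h : ∀ a b : Fin n, pd a (pd b F) y =
      fderiv ℝ (fderiv ℝ F) y (EuclideanSpace.single a 1) (EuclideanSpace.single b 1) := by
    intro a b
    have h1 := (hd.hasFDerivAt.clm_apply (hasFDerivAt_const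
      (EuclideanSpace.single b (1 : ℝ) : EuclideanSpace ℝ (Fin n)) y)).fderiv
    change fderiv ℝ (fun z => fderiv ℝ F z (EuclideanSpace.single b 1)) y _ = _
    rw [h1]
    simp
  rw [h, h]
  exact (hF.isSymmSndFDerivAt (by
    rw [minSmoothness_of_isRCLikeNormedField]; exact ENat.LEInfty.out)) _ _

/-- The entrywise partial derivative of a matrix-valued function. -/
def pdM (i : Fin n) (A : EuclideanSpace ℝ (Fin n) → Matrix (Fin n) (Fin n) ℝ)
    (y : EuclideanSpace ℝ (Fin n)) : Matrix (Fin n) (Fin n) ℝ :=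
  Matrix.of fun a b => pd i (fun z => A z a b) y

/-- Smoothness at a point of a matrix-valued function, entry by entry. -/
def SmoothMAt (A : EuclideanSpace ℝ (Fin n) → Matrix (Fin n) (Fin n) ℝ)
    (y : EuclideanSpace ℝ (Fin n)) : Prop :=
  ∀ a b, ContDiffAt ℝ ∞ (fun z => A z a b) y

variable {A B : EuclideanSpace ℝ (Fin n) → Matrix (Fin n) (Fin n) ℝ}

theorem SmoothMAt.diff (hA : SmoothMAt A y) (a b : Fin n) :
    DifferentiableAt ℝ (fun z => A z a b) y := (hA a b).differentiableAt (by simp)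

theorem pdM_congr {i : Fin n} (h : A =ᶠ[𝓝 y] B) : pdM i A y = pdM i B y := by
  ext a b
  exact pd_congr (h.mono fun z hz => by simp only [hz])

theorem SmoothMAt.mul (hA : SmoothMAt A y) (hB : SmoothMAt B y) :
    SmoothMAt (fun z => A z * B z) y := by
  intro a b
  simp only [Matrix.mul_apply]
  exact ContDiffAt.sum fun c _ => (hA a c).mul (hB c b)

theorem SmoothMAt.transpose (hA : SmoothMAt A y) : SmoothMAt (fun z => (A z).transpose) y :=
  fun a b => hA b a

theorem SmoothMAt.smul (hF : ContDiffAt ℝ ∞ F y) (hA : SmoothMAt A y) :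
    SmoothMAt (fun z => F z • A z) y := fun a b => hF.mul (hA a b)

theorem SmoothMAt.sum {ι : Type*} {s : Finset ι}
    {f : ι → EuclideanSpace ℝ (Fin n) → Matrix (Fin n) (Fin n) ℝ}
    (hf : ∀ c ∈ s, SmoothMAt (f c) y) : SmoothMAt (fun z => ∑ c ∈ s, f c z) y := by
  intro a b
  simp only [Matrix.sum_apply]
  exact ContDiffAt.sum fun c hc => hf c hc a b

theorem SmoothMAt.pdM (hA : SmoothMAt A y) (i : Fin n) : SmoothMAt (ConfLap.pdM i A) y :=
  fun a b => contDiffAt_pd (hA a b) i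

theorem SmoothMAt.comp {ψ : EuclideanSpace ℝ (Fin n) → EuclideanSpace ℝ (Fin n)}
    (hA : SmoothMAt A (ψ y)) (hψ : ContDiffAt ℝ ∞ ψ y) : SmoothMAt (fun z => A (ψ z)) y :=
  fun a b => (hA a b).comp y hψ

theorem pdM_mul (i : Fin n) (hA : SmoothMAt A y) (hB : SmoothMAt B y) :
    pdM i (fun z => A z * B z) y = pdM i A y * B y + A y * pdM i B y := by
  ext a b
  simp only [pdM, Matrix.mul_apply, Matrix.of_apply, Matrix.add_apply]
  rw [pd_sum _ _ fun c _ => (hA.diff a c).fun_mul (hB.diff c b), ← Finset.sum_add_distrib]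
  exact Finset.sum_congr rfl fun c _ => pd_mul i (hA.diff a c) (hB.diff c b)

theorem pdM_add (i : Fin n) (hA : SmoothMAt A y) (hB : SmoothMAt B y) :
    pdM i (fun z => A z + B z) y = pdM i A y + pdM i B y := by
  ext a b
  exact pd_add i (hA.diff a b) (hB.diff a b)

theorem pdM_smul (i : Fin n) (hF : ContDiffAt ℝ ∞ F y) (hA : SmoothMAt A y) :
    pdM i (fun z => F z • A z) y = pd i F y • A y + F y • pdM i A y := by
  ext a b
  exact pd_mul i (hF.differentiableAt (by simp)) (hA.diff a b)

theorem pdM_sum {ι : Type*} (i : Fin n) (s : Finset ι)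
    {f : ι → EuclideanSpace ℝ (Fin n) → Matrix (Fin n) (Fin n) ℝ}
    (hf : ∀ c ∈ s, SmoothMAt (f c) y) :
    pdM i (fun z => ∑ c ∈ s, f c z) y = ∑ c ∈ s, pdM i (f c) y := by
  ext a b
  simp only [pdM, Matrix.of_apply, Matrix.sum_apply]
  exact pd_sum i s fun c hc => (hf c hc).diff a b

theorem pdM_transpose (i : Fin n) :
    pdM i (fun z => (A z).transpose) y = (pdM i A y).transpose := rfl

theorem pdM_comp {ψ : EuclideanSpace ℝ (Fin n) → EuclideanSpace ℝ (Fin n)}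
    (hψ : ContDiffAt ℝ ∞ ψ y) (hA : SmoothMAt A (ψ y)) (j : Fin n) :
    pdM j (fun w => A (ψ w)) y = ∑ c, pd j (fun w => ψ w c) y • pdM c A (ψ y) := by
  ext a b
  simp only [pdM, Matrix.of_apply, Matrix.sum_apply, Matrix.smul_apply, smul_eq_mul]
  exact pd_comp (hψ.differentiableAt (by simp)) (hA.diff a b) j

theorem SmoothMAt.det (hA : SmoothMAt A y) : ContDiffAt ℝ ∞ (fun z => (A z).det) y := by
  simp only [Matrix.det_apply']
  exact ContDiffAt.sum fun σ _ => contDiffAt_const.mul (contDiffAt_prod fun i _ => hA _ _)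

theorem SmoothMAt.adjugate (hA : SmoothMAt A y) : SmoothMAt (fun z => (A z).adjugate) y := by
  intro a b
  simp only [Matrix.adjugate_apply]
  refine SmoothMAt.det fun c d => ?_
  by_cases h : c = b
  · subst h
    simpa using contDiffAt_const
  · simpa [Matrix.updateRow_ne h] using hA c d

theorem SmoothMAt.inv (hA : SmoothMAt A y) (h : (A y).det ≠ 0) :
    SmoothMAt (fun z => (A z)⁻¹) y := by
  intro a b
  simp only [Matrix.inv_def, Ring.inverse_eq_inv', Matrix.smul_apply, smul_eq_mul]
  exact (hA.det.inv h).mul (hA.adjugate a b)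

/-- Jacobi's formula for the derivative of a determinant. -/
theorem pd_det (i : Fin n) (hA : SmoothMAt A y) :
    pd i (fun z => (A z).det) y = ((A y).adjugate * pdM i A y).trace := by
  have hd : ∀ (σ : Equiv.Perm (Fin n)) (c : Fin n), DifferentiableAt ℝ (fun z => A z (σ c) c) y :=
    fun σ c => hA.diff _ _
  have hprod : ∀ σ : Equiv.Perm (Fin n), pd i (fun z => ∏ c, A z (σ c) c) y =
      ∑ c, ∏ d, (A y).updateCol c (fun b => pdM i A y b c) (σ d) d := by
    intro σ
    rw [pd, (HasFDerivAt.finsetProd fun c _ => (hd σ c).hasFDerivAt).fderiv]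
    rw [sum_apply]
    refine Finset.sum_congr rfl fun c _ => ?_
    rw [← Finset.mul_prod_erase _ _ (Finset.mem_univ c), smul_apply, smul_eq_mul,
      mul_comm]
    congr 1
    · simp [pdM, pd]
    · refine Finset.prod_congr rfl fun d hd' => ?_
      rw [Matrix.updateCol_ne (Finset.ne_of_mem_erase hd')]
  have hdp : ∀ σ : Equiv.Perm (Fin n), DifferentiableAt ℝ (fun z => ∏ c, A z (σ c) c) y :=
    fun σ => (HasFDerivAt.finsetProd fun c _ => (hd σ c).hasFDerivAt).differentiableAt
  have hdet : pd i (fun z => (A z).det) y =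
      ∑ c, ((A y).updateCol c (fun b => pdM i A y b c)).det := by
    simp only [Matrix.det_apply']
    rw [pd_sum _ _ fun σ _ => (hdp σ).const_mul _,
      Finset.sum_comm]
    refine Finset.sum_congr rfl fun σ _ => ?_
    rw [pd_const_mul _ _ (hdp σ), hprod,
      Finset.mul_sum]
  rw [hdet, Matrix.trace]
  refine Finset.sum_congr rfl fun c _ => ?_
  rw [← Matrix.cramer_apply, Matrix.cramer_eq_adjugate_mulVec]
  rfl

theorem pdM_inv (i : Fin n) (hA : SmoothMAt A y) (h : (A y).det ≠ 0) :
    pdM i (fun z => (A z)⁻¹) y = -((A y)⁻¹ * pdM i A y * (A y)⁻¹) := by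
  have hu : IsUnit (A y).det := isUnit_iff_ne_zero.2 h
  have hev : (fun z => (A z)⁻¹ * A z) =ᶠ[𝓝 y] fun _ => 1 := by
    filter_upwards [hA.det.continuousAt.eventually_ne h] with z hz
    exact Matrix.nonsing_inv_mul _ (isUnit_iff_ne_zero.2 hz)
  have h1 := pdM_mul i (hA.inv h) hA
  rw [pdM_congr hev] at h1
  have h2 : pdM i (fun _ => (1 : Matrix (Fin n) (Fin n) ℝ)) y = 0 := by
    ext a b
    exact pd_const i _ y
  rw [h2] at h1
  have h3 := congrArg (· * (A y)⁻¹) h1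
  simp only [zero_mul, add_mul, mul_assoc, Matrix.mul_nonsing_inv _ hu, mul_one] at h3
  rw [mul_assoc]
  exact eq_neg_of_add_eq_zero_left h3.symm

end Calculus

/-! ### Christoffel symbols and curvature in coordinates -/

section LocalGeometry

variable {n : ℕ}

/-- `G` is a smooth field of symmetric positive definite matrices on the open set `U`. -/
structure SmoothMetricOn (U : Set (EuclideanSpace ℝ (Fin n)))
    (G : EuclideanSpace ℝ (Fin n) → Matrix (Fin n) (Fin n) ℝ) : Prop where
  isOpen : IsOpen U
  smooth : ∀ y ∈ U, SmoothMAt G y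
  posDef : ∀ y ∈ U, (G y).PosDef

/-- The matrix `(Γ^k_ij)_kj` of the connection in the direction `∂ᵢ`. -/
def christoffelM (G : EuclideanSpace ℝ (Fin n) → Matrix (Fin n) (Fin n) ℝ) (i : Fin n)
    (y : EuclideanSpace ℝ (Fin n)) : Matrix (Fin n) (Fin n) ℝ :=
  Matrix.of fun k j => christoffel G k i j y

/-- The curvature matrix `∂ᵢ Γⱼ - ∂ⱼ Γᵢ + [Γᵢ, Γⱼ]` of a matrix-valued connection form `Γ`. -/
def curvatureM (Γ : Fin n → EuclideanSpace ℝ (Fin n) → Matrix (Fin n) (Fin n) ℝ) (i j : Fin n)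
    (y : EuclideanSpace ℝ (Fin n)) : Matrix (Fin n) (Fin n) ℝ :=
  pdM i (Γ j) y - pdM j (Γ i) y + Γ i y * Γ j y - Γ j y * Γ i y

/-- The scalar curvature `g^jk R_jk` of a matrix-valued function. -/
def scalarCoord (G : EuclideanSpace ℝ (Fin n) → Matrix (Fin n) (Fin n) ℝ)
    (y : EuclideanSpace ℝ (Fin n)) : ℝ :=
  ∑ j, ∑ k, (G y)⁻¹ j k * ricciCoord G j k y

/-- The Hessian `∂ᵢ ∂ⱼ u - Γ^k_ij ∂ₖ u`. -/
def hessianM (G : EuclideanSpace ℝ (Fin n) → Matrix (Fin n) (Fin n) ℝ)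
    (u : EuclideanSpace ℝ (Fin n) → ℝ) (y : EuclideanSpace ℝ (Fin n)) :
    Matrix (Fin n) (Fin n) ℝ :=
  Matrix.of fun i j => pd i (pd j u) y - ∑ k, christoffel G k i j y * pd k u y

/-- The Laplace-Beltrami operator in divergence form. -/
def laplaceCoord (G : EuclideanSpace ℝ (Fin n) → Matrix (Fin n) (Fin n) ℝ)
    (u : EuclideanSpace ℝ (Fin n) → ℝ) (y : EuclideanSpace ℝ (Fin n)) : ℝ :=
  (Real.sqrt (G y).det)⁻¹ *
    ∑ i, pd i (fun z => ∑ j, Real.sqrt (G z).det * (G z)⁻¹ i j * pd j u z) y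

/-- The inner product `g^ij ∂ᵢ u ∂ⱼ v` of differentials. -/
def gradCoord (G : EuclideanSpace ℝ (Fin n) → Matrix (Fin n) (Fin n) ℝ)
    (u v : EuclideanSpace ℝ (Fin n) → ℝ) (y : EuclideanSpace ℝ (Fin n)) : ℝ :=
  ∑ i, ∑ j, (G y)⁻¹ i j * pd i u y * pd j v y

variable {U V : Set (EuclideanSpace ℝ (Fin n))}
  {G G' : EuclideanSpace ℝ (Fin n) → Matrix (Fin n) (Fin n) ℝ}
  {y z : EuclideanSpace ℝ (Fin n)}

theorem SmoothMetricOn.transpose_eq (h : SmoothMetricOn U G) (hy : y ∈ U) :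
    (G y).transpose = G y := by
  have := (h.posDef y hy).isHermitian.eq
  rwa [Matrix.conjTranspose_eq_transpose_of_trivial] at this

theorem SmoothMetricOn.symm_apply (h : SmoothMetricOn U G) (hy : y ∈ U) (i j : Fin n) :
    G y i j = G y j i := congrFun (congrFun (h.transpose_eq hy) j) i

theorem SmoothMetricOn.det_pos (h : SmoothMetricOn U G) (hy : y ∈ U) : 0 < (G y).det :=
  (h.posDef y hy).det_pos

theorem SmoothMetricOn.isUnit (h : SmoothMetricOn U G) (hy : y ∈ U) : IsUnit (G y).det :=
  isUnit_iff_ne_zero.2 (h.det_pos hy).ne'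

theorem SmoothMetricOn.pd_symm (h : SmoothMetricOn U G) (hy : y ∈ U) (k i j : Fin n) :
    pd k (fun z => G z i j) y = pd k (fun z => G z j i) y :=
  pd_congr (Filter.eventuallyEq_of_mem (h.isOpen.mem_nhds hy) fun _ hz => h.symm_apply hz i j)

theorem SmoothMetricOn.smoothInv (h : SmoothMetricOn U G) (hy : y ∈ U) :
    SmoothMAt (fun z => (G z)⁻¹) y := (h.smooth y hy).inv (h.det_pos hy).ne'

theorem SmoothMetricOn.smoothChristoffel (h : SmoothMetricOn U G) (hy : y ∈ U) (i : Fin n) :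
    SmoothMAt (christoffelM G i) y := by
  intro k j
  change ContDiffAt ℝ ∞ (christoffel G k i j) y
  exact contDiffAt_const.mul (ContDiffAt.sum fun l _ => (h.smoothInv hy k l).mul
    (((contDiffAt_pd (h.smooth y hy j l) i).add (contDiffAt_pd (h.smooth y hy i l) j)).sub
      (contDiffAt_pd (h.smooth y hy i j) l)))

theorem SmoothMetricOn.christoffel_symm (h : SmoothMetricOn U G) (hy : y ∈ U) (k i j : Fin n) :
    christoffel G k i j y = christoffel G k j i y := by
  simp only [christoffel]
  congr 1
  refine Finset.sum_congr rfl fun l _ => ?_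
  rw [h.pd_symm hy l i j]
  ring

theorem SmoothMetricOn.mul_christoffelM (h : SmoothMetricOn U G) (hy : y ∈ U) (i l j : Fin n) :
    (G y * christoffelM G i y) l j = (1 / 2) *
      (pd i (fun z => G z j l) y + pd j (fun z => G z i l) y - pd l (fun z => G z i j) y) := by
  have h1 : christoffelM G i y = (G y)⁻¹ * Matrix.of fun l j => (1 / 2) *
      (pd i (fun z => G z j l) y + pd j (fun z => G z i l) y - pd l (fun z => G z i j) y) := by
    ext k j
    simp only [christoffelM, christoffel, Matrix.of_apply, Matrix.mul_apply, Finset.mul_sum]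
    exact Finset.sum_congr rfl fun _ _ => by ring
  rw [h1, ← mul_assoc, Matrix.mul_nonsing_inv _ (h.isUnit hy), one_mul]
  rfl

/-- The Levi-Civita connection is compatible with the metric. -/
theorem SmoothMetricOn.pdM_eq (h : SmoothMetricOn U G) (hy : y ∈ U) (k : Fin n) :
    pdM k G y = (christoffelM G k y).transpose * G y + G y * christoffelM G k y := by
  have h1 : (christoffelM G k y).transpose * G y = (G y * christoffelM G k y).transpose := by
    rw [Matrix.transpose_mul, h.transpose_eq hy]
  rw [h1]
  ext i j
  rw [Matrix.add_apply, Matrix.transpose_apply, h.mul_christoffelM hy, h.mul_christoffelM hy]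
  simp only [pdM, Matrix.of_apply]
  rw [h.pd_symm hy k j i, h.pd_symm hy j k i, h.pd_symm hy i k j]
  ring

/-- A torsion-free connection compatible with the metric is the Levi-Civita connection. -/
theorem christoffelM_eq_of_compatible (hG : (G y).transpose = G y) (hu : IsUnit (G y).det)
    {A : Fin n → Matrix (Fin n) (Fin n) ℝ} (hsymm : ∀ i j k, A i k j = A j k i)
    (hcomp : ∀ k, pdM k G y = (A k).transpose * G y + G y * A k) (i : Fin n) :
    christoffelM G i y = A i := by
  have hGs : ∀ a b, G y a b = G y b a := fun a b => congrFun (congrFun hG b) a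
  have hpd : ∀ k a b, pd k (fun z => G z a b) y =
      (∑ m, A k m a * G y m b) + ∑ m, G y a m * A k m b := by
    intro k a b
    have := congrFun (congrFun (hcomp k) a) b
    simpa only [pdM, Matrix.of_apply, Matrix.add_apply, Matrix.mul_apply,
      Matrix.transpose_apply] using this
  have h1 : christoffelM G i y = (G y)⁻¹ * (G y * A i) := by
    ext k j
    simp only [christoffelM, christoffel, Matrix.of_apply]
    rw [Matrix.mul_apply, Finset.mul_sum]
    refine Finset.sum_congr rfl fun l _ => ?_
    have h2 : pd i (fun z => G z j l) y + pd j (fun z => G z i l) y - pd l (fun z => G z i j) y =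
        2 * (G y * A i) l j := by
      rw [hpd, hpd, hpd, Matrix.mul_apply, Finset.mul_sum]
      simp only [← Finset.sum_add_distrib, ← Finset.sum_sub_distrib]
      refine Finset.sum_congr rfl fun m _ => ?_
      rw [hsymm l i m, hsymm l j m, hsymm j i m, hGs m l, hGs m j]
      ring
    rw [h2]
    ring
  rw [h1, ← mul_assoc, Matrix.nonsing_inv_mul _ hu, one_mul]

theorem ricciCoord_eq (j k : Fin n) :
    ricciCoord G j k y = ∑ i, curvatureM (christoffelM G) i j y i k := by
  simp only [ricciCoord, curvatureM, Matrix.sub_apply, Matrix.add_apply, Matrix.mul_apply,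
    christoffelM, pdM, Matrix.of_apply]
  refine Finset.sum_congr rfl fun i _ => ?_
  rw [Finset.sum_sub_distrib]
  ring

theorem SmoothMetricOn.contDiffAt_scalarCoord (h : SmoothMetricOn U G) (hy : y ∈ U) :
    ContDiffAt ℝ ∞ (scalarCoord G) y := by
  refine ContDiffAt.sum fun j _ => ContDiffAt.sum fun k _ => (h.smoothInv hy j k).mul ?_
  have h1 : ∀ a b c, ContDiffAt ℝ ∞ (christoffel G a b c) y :=
    fun a b c => h.smoothChristoffel hy b a c
  exact ContDiffAt.sum fun i _ => ((contDiffAt_pd (h1 i j k) i).sub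
    (contDiffAt_pd (h1 i i k) j)).add (ContDiffAt.sum fun l _ =>
      ((h1 i i l).mul (h1 l j k)).sub ((h1 i j l).mul (h1 l i k)))

/-! ### Change of coordinates -/

/-- The Jacobian matrix of a map of `ℝⁿ`. -/
def jacobianM (ψ : EuclideanSpace ℝ (Fin n) → EuclideanSpace ℝ (Fin n))
    (z : EuclideanSpace ℝ (Fin n)) : Matrix (Fin n) (Fin n) ℝ :=
  Matrix.of fun c j => pd j (fun w => ψ w c) z

/-- The metric `G'` on `V` is the pull-back of the metric `G` on `U` by a local diffeomorphism. -/
structure IsPullback (ψ : EuclideanSpace ℝ (Fin n) → EuclideanSpace ℝ (Fin n))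
    (U V : Set (EuclideanSpace ℝ (Fin n)))
    (G G' : EuclideanSpace ℝ (Fin n) → Matrix (Fin n) (Fin n) ℝ) : Prop where
  metric : SmoothMetricOn U G
  metric' : SmoothMetricOn V G'
  mapsTo : ∀ z ∈ V, ψ z ∈ U
  smooth : ∀ z ∈ V, ContDiffAt ℝ ∞ ψ z
  eq : ∀ z ∈ V, G' z = (jacobianM ψ z).transpose * G (ψ z) * jacobianM ψ z

variable {ψ : EuclideanSpace ℝ (Fin n) → EuclideanSpace ℝ (Fin n)}

theorem contDiffAt_coord (hψ : ContDiffAt ℝ ∞ ψ z) (c : Fin n) :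
    ContDiffAt ℝ ∞ (fun w => ψ w c) z :=
  (EuclideanSpace.proj (𝕜 := ℝ) c).contDiff.contDiffAt.comp z hψ

theorem smoothMAt_jacobianM (hψ : ContDiffAt ℝ ∞ ψ z) : SmoothMAt (jacobianM ψ) z :=
  fun c j => contDiffAt_pd (contDiffAt_coord hψ c) j

theorem pd_jacobianM_symm (hψ : ContDiffAt ℝ ∞ ψ z) (c i j : Fin n) :
    pdM i (jacobianM ψ) z c j = pdM j (jacobianM ψ) z c i :=
  pd_comm (contDiffAt_coord hψ c) i j

namespace IsPullback

theorem jac_det_ne (h : IsPullback ψ U V G G') (hz : z ∈ V) : (jacobianM ψ z).det ≠ 0 := by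
  intro h0
  have h1 := (h.metric'.det_pos hz).ne'
  rw [h.eq z hz, Matrix.det_mul, h0, mul_zero] at h1
  exact h1 rfl

theorem jac_isUnit (h : IsPullback ψ U V G G') (hz : z ∈ V) : IsUnit (jacobianM ψ z).det :=
  isUnit_iff_ne_zero.2 (h.jac_det_ne hz)

/-- The gauge transformation law of the Levi-Civita connection. -/
theorem jac_mul_christoffelM (h : IsPullback ψ U V G G') (hz : z ∈ V) (i : Fin n) :
    jacobianM ψ z * christoffelM G' i z =
      (∑ a, jacobianM ψ z a i • christoffelM G a (ψ z)) * jacobianM ψ z +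
        pdM i (jacobianM ψ) z := by
  have hψ := h.smooth z hz
  have hU := h.mapsTo z hz
  have hJ := smoothMAt_jacobianM hψ
  have huJ := h.jac_isUnit hz
  set J := jacobianM ψ z with hJdef
  set B : Fin n → Matrix (Fin n) (Fin n) ℝ := fun i => ∑ a, J a i • christoffelM G a (ψ z) with hB
  have hev : G' =ᶠ[𝓝 z] fun w => (jacobianM ψ w).transpose * G (ψ w) * jacobianM ψ w :=
    Filter.eventuallyEq_of_mem (h.metric'.isOpen.mem_nhds hz) fun w hw => h.eq w hw
  have hGψ : SmoothMAt (fun w => G (ψ w)) z := (h.metric.smooth _ hU).comp hψ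
  have hdG : ∀ k, pdM k (fun w => G (ψ w)) z = (B k).transpose * G (ψ z) + G (ψ z) * B k := by
    intro k
    rw [pdM_comp hψ (h.metric.smooth _ hU)]
    simp only [h.metric.pdM_eq hU, hB, Matrix.transpose_sum, Matrix.transpose_smul,
      Matrix.sum_mul, Matrix.mul_sum, Matrix.smul_mul, Matrix.mul_smul, smul_add,
      Finset.sum_add_distrib]
    rfl
  have hcomp : ∀ k, pdM k G' z = (J⁻¹ * (B k * J + pdM k (jacobianM ψ) z)).transpose * G' z +
      G' z * (J⁻¹ * (B k * J + pdM k (jacobianM ψ) z)) := by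
    intro k
    rw [pdM_congr hev, pdM_mul k (hJ.transpose.mul hGψ) hJ, pdM_mul k hJ.transpose hGψ, hdG,
      pdM_transpose, h.eq z hz, ← hJdef]
    have e1 : J.transpose * G (ψ z) * J * (J⁻¹ * (B k * J + pdM k (jacobianM ψ) z)) =
        J.transpose * G (ψ z) * (B k * J + pdM k (jacobianM ψ) z) := by
      rw [mul_assoc _ J, ← mul_assoc J, Matrix.mul_nonsing_inv _ huJ, one_mul]
    have e2 : (J⁻¹ * (B k * J + pdM k (jacobianM ψ) z)).transpose * (J.transpose * G (ψ z) * J) =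
        (B k * J + pdM k (jacobianM ψ) z).transpose * G (ψ z) * J := by
      rw [Matrix.transpose_mul, mul_assoc J.transpose, mul_assoc _ _ (J.transpose * _),
        ← mul_assoc _ J.transpose, ← Matrix.transpose_mul, Matrix.mul_nonsing_inv _ huJ,
        Matrix.transpose_one, one_mul, mul_assoc]
    rw [e1, e2, Matrix.transpose_add, Matrix.transpose_mul]
    noncomm_ring
  have hsymm0 : ∀ i j k, (B i * J + pdM i (jacobianM ψ) z) k j =
      (B j * J + pdM j (jacobianM ψ) z) k i := by
    intro i j k
    rw [Matrix.add_apply, Matrix.add_apply, pd_jacobianM_symm hψ k i j]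
    congr 1
    simp only [hB, Matrix.mul_apply, Matrix.sum_apply, Matrix.smul_apply, smul_eq_mul,
      Finset.sum_mul]
    rw [Finset.sum_comm]
    refine Finset.sum_congr rfl fun a _ => Finset.sum_congr rfl fun b _ => ?_
    simp only [christoffelM, Matrix.of_apply]
    rw [h.metric.christoffel_symm hU k b a]
    ring
  have hsymm : ∀ i j k, (J⁻¹ * (B i * J + pdM i (jacobianM ψ) z)) k j =
      (J⁻¹ * (B j * J + pdM j (jacobianM ψ) z)) k i := by
    intro i j k
    rw [Matrix.mul_apply, Matrix.mul_apply]
    exact Finset.sum_congr rfl fun c _ => by rw [hsymm0]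
  rw [christoffelM_eq_of_compatible (h.metric'.transpose_eq hz) (h.metric'.isUnit hz) hsymm hcomp,
    ← mul_assoc, Matrix.mul_nonsing_inv _ huJ, one_mul]

/-- The curvature is a two-form with values in the endomorphisms of the tangent space. -/
theorem jac_mul_curvatureM (h : IsPullback ψ U V G G') (hz : z ∈ V) (i j : Fin n) :
    jacobianM ψ z * curvatureM (christoffelM G') i j z =
      (∑ a, ∑ b, (jacobianM ψ z a i * jacobianM ψ z b j) •
        curvatureM (christoffelM G) a b (ψ z)) * jacobianM ψ z := by
  have hψ := h.smooth z hz
  have hU := h.mapsTo z hz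
  have hJ := smoothMAt_jacobianM hψ
  have hΓ : ∀ a, SmoothMAt (fun w => christoffelM G a (ψ w)) z :=
    fun a => (h.metric.smoothChristoffel hU a).comp hψ
  have hΓ' := h.metric'.smoothChristoffel hz
  set B : Fin n → EuclideanSpace ℝ (Fin n) → Matrix (Fin n) (Fin n) ℝ :=
    fun i w => ∑ a, jacobianM ψ w a i • christoffelM G a (ψ w) with hB
  have hBs : ∀ i, SmoothMAt (B i) z := fun i => SmoothMAt.sum fun a _ => (hΓ a).smul (hJ a i)
  have gauge : ∀ i, pdM i (jacobianM ψ) z =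
      jacobianM ψ z * christoffelM G' i z - B i z * jacobianM ψ z :=
    fun i => eq_sub_of_add_eq' (h.jac_mul_christoffelM hz i).symm
  -- Differentiate the gauge transformation law.
  have hder : ∀ i j, pdM j (jacobianM ψ) z * christoffelM G' i z +
      jacobianM ψ z * pdM j (christoffelM G' i) z =
      pdM j (B i) z * jacobianM ψ z + B i z * pdM j (jacobianM ψ) z +
        pdM j (pdM i (jacobianM ψ)) z := by
    intro i j
    have hev : (fun w => jacobianM ψ w * christoffelM G' i w) =ᶠ[𝓝 z]
        fun w => B i w * jacobianM ψ w + pdM i (jacobianM ψ) w :=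
      Filter.eventuallyEq_of_mem (h.metric'.isOpen.mem_nhds hz)
        fun w hw => h.jac_mul_christoffelM hw i
    have := pdM_congr (i := j) hev
    rwa [pdM_mul j hJ (hΓ' i), pdM_add j ((hBs i).mul hJ) (hJ.pdM i), pdM_mul j (hBs i) hJ] at this
  have hcomm : pdM j (pdM i (jacobianM ψ)) z = pdM i (pdM j (jacobianM ψ)) z := by
    ext c d
    exact pd_comm (hJ c d) j i
  have hpdB : ∀ i j, pdM i (B j) z = ∑ b, (pdM i (jacobianM ψ) z b j • christoffelM G b (ψ z) +
      jacobianM ψ z b j • ∑ a, jacobianM ψ z a i • pdM a (christoffelM G b) (ψ z)) := by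
    intro i j
    rw [hB, pdM_sum i _ fun b _ => (hΓ b).smul (hJ b j)]
    refine Finset.sum_congr rfl fun b _ => ?_
    rw [pdM_smul i (hJ b j) (hΓ b), pdM_comp hψ (h.metric.smoothChristoffel hU b)]
    rfl
  have hcurvB : pdM i (B j) z - pdM j (B i) z + B i z * B j z - B j z * B i z =
      ∑ a, ∑ b, (jacobianM ψ z a i * jacobianM ψ z b j) •
        curvatureM (christoffelM G) a b (ψ z) := by
    have e1 : pdM i (B j) z - pdM j (B i) z = ∑ a, ∑ b, (jacobianM ψ z a i * jacobianM ψ z b j) •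
        (pdM a (christoffelM G b) (ψ z) - pdM b (christoffelM G a) (ψ z)) := by
      rw [hpdB, hpdB, Finset.sum_add_distrib, Finset.sum_add_distrib]
      have e0 : ∑ b, pdM i (jacobianM ψ) z b j • christoffelM G b (ψ z) =
          ∑ b, pdM j (jacobianM ψ) z b i • christoffelM G b (ψ z) :=
        Finset.sum_congr rfl fun b _ => by rw [pd_jacobianM_symm hψ b i j]
      rw [e0, add_sub_add_left_eq_sub]
      simp only [smul_sub, Finset.sum_sub_distrib, Finset.smul_sum, smul_smul]
      congr 1
      rw [Finset.sum_comm]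
      exact Finset.sum_congr rfl fun a _ => Finset.sum_congr rfl fun b _ => by rw [mul_comm]
    have e2 : ∀ i j, B i z * B j z = ∑ a, ∑ b, (jacobianM ψ z a i * jacobianM ψ z b j) •
        (christoffelM G a (ψ z) * christoffelM G b (ψ z)) := by
      intro i j
      simp only [hB, Matrix.sum_mul, Matrix.mul_sum, Matrix.smul_mul, Matrix.mul_smul, Finset.smul_sum,
        smul_smul]
      rw [Finset.sum_comm]
      exact Finset.sum_congr rfl fun a _ => Finset.sum_congr rfl fun b _ => by rw [mul_comm]
    rw [add_sub_assoc, e1, e2 i j, e2 j i, Finset.sum_comm (f := fun a b =>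
      (jacobianM ψ z a j * jacobianM ψ z b i) •
        (christoffelM G a (ψ z) * christoffelM G b (ψ z)))]
    simp only [← Finset.sum_sub_distrib, ← Finset.sum_add_distrib]
    refine Finset.sum_congr rfl fun a _ => Finset.sum_congr rfl fun b _ => ?_
    rw [mul_comm (jacobianM ψ z b j), ← smul_sub, ← smul_add, curvatureM, add_sub_assoc]
  have d1 := hder i j
  have d2 := hder j i
  rw [hcomm] at d1
  rw [← hcurvB, curvatureM]
  have d3 := congrArg₂ (· - ·) d2 d1
  simp only [gauge] at d3
  have d4 : jacobianM ψ z * pdM i (christoffelM G' j) z -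
      jacobianM ψ z * pdM j (christoffelM G' i) z =
      pdM i (B j) z * jacobianM ψ z - pdM j (B i) z * jacobianM ψ z +
        (B j z * (jacobianM ψ z * christoffelM G' i z - B i z * jacobianM ψ z) -
        B i z * (jacobianM ψ z * christoffelM G' j z - B j z * jacobianM ψ z)) -
        ((jacobianM ψ z * christoffelM G' i z - B i z * jacobianM ψ z) * christoffelM G' j z -
        (jacobianM ψ z * christoffelM G' j z - B j z * jacobianM ψ z) * christoffelM G' i z) := by
    rw [← sub_eq_zero] at d3 ⊢
    rw [← d3]
    noncomm_ring
  simp only [mul_sub, mul_add, d4]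
  noncomm_ring

/-- The Ricci curvature is a covariant two-tensor. -/
theorem ricci_eq (h : IsPullback ψ U V G G') (hz : z ∈ V) :
    Matrix.of (fun j k => ricciCoord G' j k z) = (jacobianM ψ z).transpose *
      Matrix.of (fun j k => ricciCoord G j k (ψ z)) * jacobianM ψ z := by
  have hu := h.jac_isUnit hz
  have hc : ∀ i j, curvatureM (christoffelM G') i j z = ∑ a, ∑ b,
      (jacobianM ψ z a i * jacobianM ψ z b j) • ((jacobianM ψ z)⁻¹ *
        (curvatureM (christoffelM G) a b (ψ z) * jacobianM ψ z)) := by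
    intro i j
    have h1 := congrArg ((jacobianM ψ z)⁻¹ * ·) (h.jac_mul_curvatureM hz i j)
    simp only [← mul_assoc, Matrix.nonsing_inv_mul _ hu, one_mul] at h1
    rw [h1]
    simp only [Matrix.sum_mul, Matrix.mul_sum, Matrix.smul_mul, Matrix.mul_smul, mul_assoc]
  ext j k
  rw [Matrix.of_apply, ricciCoord_eq]
  simp only [hc, Matrix.sum_apply, Matrix.smul_apply, smul_eq_mul]
  rw [Finset.sum_comm]
  have h2 : ∀ a b, ∑ i, jacobianM ψ z a i * jacobianM ψ z b j * ((jacobianM ψ z)⁻¹ *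
      (curvatureM (christoffelM G) a b (ψ z) * jacobianM ψ z)) i k =
      jacobianM ψ z b j * (curvatureM (christoffelM G) a b (ψ z) * jacobianM ψ z) a k := by
    intro a b
    have h3 : (jacobianM ψ z * ((jacobianM ψ z)⁻¹ *
        (curvatureM (christoffelM G) a b (ψ z) * jacobianM ψ z))) a k =
        (curvatureM (christoffelM G) a b (ψ z) * jacobianM ψ z) a k := by
      rw [← mul_assoc, Matrix.mul_nonsing_inv _ hu, one_mul]
    rw [← h3, Matrix.mul_apply, Finset.mul_sum]
    exact Finset.sum_congr rfl fun _ _ => by ring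
  have h4 : ∀ a, ∑ i, ∑ b, jacobianM ψ z a i * jacobianM ψ z b j * ((jacobianM ψ z)⁻¹ *
      (curvatureM (christoffelM G) a b (ψ z) * jacobianM ψ z)) i k =
      ∑ b, jacobianM ψ z b j * (curvatureM (christoffelM G) a b (ψ z) * jacobianM ψ z) a k := by
    intro a
    rw [Finset.sum_comm]
    exact Finset.sum_congr rfl fun b _ => h2 a b
  simp only [h4]
  rw [Finset.sum_comm, mul_assoc, Matrix.mul_apply]
  refine Finset.sum_congr rfl fun b _ => ?_
  rw [← Finset.mul_sum, Matrix.transpose_apply]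
  congr 1
  simp only [Matrix.mul_apply, Matrix.of_apply, ricciCoord_eq, Finset.sum_mul]
  rw [Finset.sum_comm]

theorem inv_eq (h : IsPullback ψ U V G G') (hz : z ∈ V) :
    (G (ψ z))⁻¹ = jacobianM ψ z * (G' z)⁻¹ * (jacobianM ψ z).transpose := by
  have hu := h.jac_isUnit hz
  rw [h.eq z hz, Matrix.mul_inv_rev, Matrix.mul_inv_rev, ← mul_assoc,
    Matrix.mul_nonsing_inv _ hu, one_mul, mul_assoc,
    Matrix.nonsing_inv_mul _ (by rwa [Matrix.det_transpose]), mul_one]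

/-- The trace `g^jk S_jk` of a covariant two-tensor does not depend on the coordinates. -/
theorem trace_eq (h : IsPullback ψ U V G G') (hz : z ∈ V) (S : Matrix (Fin n) (Fin n) ℝ) :
    ((G' z)⁻¹ * ((jacobianM ψ z).transpose * S * jacobianM ψ z).transpose).trace =
      ((G (ψ z))⁻¹ * S.transpose).trace := by
  rw [h.inv_eq hz, Matrix.transpose_mul, Matrix.transpose_mul, Matrix.transpose_transpose,
    ← mul_assoc, Matrix.trace_mul_comm, Matrix.trace_mul_comm _ S.transpose]
  simp only [mul_assoc]

theorem sum_inv_mul {A S : Matrix (Fin n) (Fin n) ℝ} :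
    ∑ i, ∑ j, A i j * S i j = (A * S.transpose).trace := by
  simp [Matrix.trace, Matrix.mul_apply]

theorem scalarCoord_eq (h : IsPullback ψ U V G G') (hz : z ∈ V) :
    scalarCoord G' z = scalarCoord G (ψ z) := by
  have e : ∀ (K : EuclideanSpace ℝ (Fin n) → Matrix (Fin n) (Fin n) ℝ) w, scalarCoord K w =
      ((K w)⁻¹ * (Matrix.of fun j k => ricciCoord K j k w).transpose).trace := by
    intro K w
    rw [← sum_inv_mul]
    rfl
  rw [e, e, h.ricci_eq hz, h.trace_eq hz]

theorem gradCoord_eq (h : IsPullback ψ U V G G') (hz : z ∈ V)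
    {u v : EuclideanSpace ℝ (Fin n) → ℝ} (hu : DifferentiableAt ℝ u (ψ z))
    (hv : DifferentiableAt ℝ v (ψ z)) :
    gradCoord G' (fun w => u (ψ w)) (fun w => v (ψ w)) z = gradCoord G u v (ψ z) := by
  have hψ := (h.smooth z hz).differentiableAt (by simp)
  have e : ∀ (K : Matrix (Fin n) (Fin n) ℝ) (a b : Fin n → ℝ), ∑ i, ∑ j, K i j * a i * b j =
      (K * (Matrix.of fun i j => a i * b j).transpose).trace := by
    intro K a b
    rw [← sum_inv_mul]
    exact Finset.sum_congr rfl fun i _ => Finset.sum_congr rfl fun j _ => by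
      rw [Matrix.of_apply, mul_assoc]
  rw [gradCoord, gradCoord, e, e, ← h.trace_eq hz]
  congr 3
  ext i j
  simp only [Matrix.of_apply, pd_comp hψ hu, pd_comp hψ hv, Matrix.mul_apply,
    Matrix.transpose_apply, Finset.sum_mul, Finset.mul_sum, jacobianM]
  refine Finset.sum_congr rfl fun a _ => Finset.sum_congr rfl fun b _ => ?_
  ring

/-- The Hessian is a covariant two-tensor. -/
theorem hessianM_eq (h : IsPullback ψ U V G G') (hz : z ∈ V)
    {u : EuclideanSpace ℝ (Fin n) → ℝ} (hu : ∀ y ∈ U, ContDiffAt ℝ ∞ u y) :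
    hessianM G' (fun w => u (ψ w)) z =
      (jacobianM ψ z).transpose * hessianM G u (ψ z) * jacobianM ψ z := by
  have hψ := h.smooth z hz
  have hψd := hψ.differentiableAt (by simp)
  have hU := h.mapsTo z hz
  have hud : DifferentiableAt ℝ u (ψ z) := (hu _ hU).differentiableAt (by simp)
  have hJ := smoothMAt_jacobianM hψ
  have hpu : ∀ c, ContDiffAt ℝ ∞ (pd c u) (ψ z) := fun c => contDiffAt_pd (hu _ hU) c
  ext i j
  have hev : pd j (fun w => u (ψ w)) =ᶠ[𝓝 z] fun w => ∑ c, jacobianM ψ w c j * pd c u (ψ w) :=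
    Filter.eventuallyEq_of_mem (h.metric'.isOpen.mem_nhds hz) fun w hw =>
      pd_comp ((h.smooth w hw).differentiableAt (by simp))
        ((hu _ (h.mapsTo w hw)).differentiableAt (by simp)) j
  have h1 : pd i (pd j (fun w => u (ψ w))) z = ∑ c, (pdM i (jacobianM ψ) z c j * pd c u (ψ z) +
      jacobianM ψ z c j * ∑ a, jacobianM ψ z a i * pd a (pd c u) (ψ z)) := by
    have hpd : ∀ c, DifferentiableAt ℝ (fun w => pd c u (ψ w)) z := fun c =>
      ((hpu c).differentiableAt (by simp)).comp z hψd
    rw [pd_congr hev, pd_sum i _ fun c _ => (hJ.diff c j).fun_mul (hpd c)]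
    refine Finset.sum_congr rfl fun c _ => ?_
    rw [pd_mul i (hJ.diff c j) (hpd c), pd_comp hψd ((hpu c).differentiableAt (by simp))]
    rfl
  have h2 : ∑ k, christoffel G' k i j z * pd k (fun w => u (ψ w)) z =
      ∑ c, (jacobianM ψ z * christoffelM G' i z) c j * pd c u (ψ z) := by
    simp only [pd_comp hψd hud, Matrix.mul_apply, Finset.mul_sum, Finset.sum_mul]
    rw [Finset.sum_comm]
    refine Finset.sum_congr rfl fun a _ => Finset.sum_congr rfl fun b _ => ?_
    simp only [jacobianM, christoffelM, Matrix.of_apply]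
    ring
  simp only [hessianM, Matrix.of_apply]
  rw [h1, h2, h.jac_mul_christoffelM hz]
  simp only [Matrix.add_apply, Matrix.mul_apply, Matrix.transpose_apply, Matrix.sum_apply,
    Matrix.smul_apply, smul_eq_mul, Matrix.of_apply, Finset.sum_mul, Finset.mul_sum, add_mul,
    Finset.sum_add_distrib, mul_sub, sub_mul, Finset.sum_sub_distrib, sub_add_eq_sub_sub]
  have h3 : ∑ c, ∑ a, jacobianM ψ z c j * (jacobianM ψ z a i * pd a (pd c u) (ψ z)) =
      ∑ c, ∑ a, jacobianM ψ z a i * pd a (pd c u) (ψ z) * jacobianM ψ z c j :=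
    Finset.sum_congr rfl fun c _ => Finset.sum_congr rfl fun a _ => by ring
  have h4 : ∑ c, ∑ a, ∑ b, jacobianM ψ z a i * christoffelM G a (ψ z) c b * jacobianM ψ z b j *
      pd c u (ψ z) = ∑ b, ∑ a, ∑ c, jacobianM ψ z a i *
        (christoffel G c a b (ψ z) * pd c u (ψ z)) * jacobianM ψ z b j := by
    rw [Finset.sum_comm, Finset.sum_comm (f := fun b a => ∑ c, jacobianM ψ z a i *
        (christoffel G c a b (ψ z) * pd c u (ψ z)) * jacobianM ψ z b j)]
    refine Finset.sum_congr rfl fun a _ => ?_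
    rw [Finset.sum_comm]
    refine Finset.sum_congr rfl fun b _ => Finset.sum_congr rfl fun c _ => ?_
    simp only [christoffelM, Matrix.of_apply]
    ring
  rw [h3, h4]
  ring

end IsPullback

/-! ### The Laplace-Beltrami operator in coordinates -/

theorem SmoothMetricOn.pd_sqrt_det (h : SmoothMetricOn U G) (hy : y ∈ U) (k : Fin n) :
    pd k (fun z => Real.sqrt (G z).det) y =
      Real.sqrt (G y).det * (christoffelM G k y).trace := by
  have hd := h.det_pos hy
  have hs := h.smooth y hy
  rw [pd_scomp k (Real.hasDerivAt_sqrt hd.ne').differentiableAt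
    (hs.det.differentiableAt (by simp)), (Real.hasDerivAt_sqrt hd.ne').deriv, pd_det k hs,
    h.pdM_eq hy, mul_add, Matrix.trace_add, ← mul_assoc, ← mul_assoc, Matrix.adjugate_mul,
    Matrix.trace_mul_comm, ← mul_assoc, Matrix.mul_adjugate]
  simp only [Matrix.smul_mul, one_mul, Matrix.trace_smul, Matrix.trace_transpose, smul_eq_mul]
  have h1 : Real.sqrt (G y).det ≠ 0 := (Real.sqrt_pos.2 hd).ne'
  field_simp
  rw [Real.sq_sqrt hd.le]
  ring

theorem SmoothMetricOn.contDiffAt_sqrt_det (h : SmoothMetricOn U G) (hy : y ∈ U) :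
    ContDiffAt ℝ ∞ (fun z => Real.sqrt (G z).det) y :=
  (h.smooth y hy).det.sqrt (h.det_pos hy).ne'

theorem SmoothMetricOn.pdM_inv (h : SmoothMetricOn U G) (hy : y ∈ U) (k : Fin n) :
    pdM k (fun z => (G z)⁻¹) y =
      -((G y)⁻¹ * (christoffelM G k y).transpose + christoffelM G k y * (G y)⁻¹) := by
  have hu := h.isUnit hy
  rw [ConfLap.pdM_inv k (h.smooth y hy) (h.det_pos hy).ne', h.pdM_eq hy, mul_add, add_mul,
    mul_assoc, mul_assoc, Matrix.mul_nonsing_inv _ hu, mul_one, ← mul_assoc (G y)⁻¹ (G y),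
    Matrix.nonsing_inv_mul _ hu, one_mul]

/-- The divergence `|g|^(-1/2) ∂ᵢ (|g|^(1/2) g^ij pⱼ)` of a one-form is the trace of its covariant
derivative. -/
theorem SmoothMetricOn.divergence_eq (h : SmoothMetricOn U G) (hy : y ∈ U)
    {p : Fin n → EuclideanSpace ℝ (Fin n) → ℝ} (hp : ∀ j, DifferentiableAt ℝ (p j) y) :
    (Real.sqrt (G y).det)⁻¹ *
      ∑ i, pd i (fun z => ∑ j, Real.sqrt (G z).det * (G z)⁻¹ i j * p j z) y =
      ∑ i, ∑ j, (G y)⁻¹ i j * (pd i (p j) y - ∑ k, christoffel G k i j y * p k y) := by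
  have hs : DifferentiableAt ℝ (fun z => Real.sqrt (G z).det) y :=
    (h.contDiffAt_sqrt_det hy).differentiableAt (by simp)
  have hi := h.smoothInv hy
  have hpos : Real.sqrt (G y).det ≠ 0 := (Real.sqrt_pos.2 (h.det_pos hy)).ne'
  have h1 : ∀ i j, pd i (fun z => Real.sqrt (G z).det * (G z)⁻¹ i j * p j z) y =
      Real.sqrt (G y).det * ((christoffelM G i y).trace * (G y)⁻¹ i j * p j y -
        (((G y)⁻¹ * (christoffelM G i y).transpose) i j + (christoffelM G i y * (G y)⁻¹) i j) *
          p j y + (G y)⁻¹ i j * pd i (p j) y) := by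
    intro i j
    have h2 : pd i (fun z => (G z)⁻¹ i j) y = -(((G y)⁻¹ * (christoffelM G i y).transpose) i j +
        (christoffelM G i y * (G y)⁻¹) i j) := congrFun (congrFun (h.pdM_inv hy i) i) j
    rw [pd_mul i (hs.fun_mul (hi.diff i j)) (hp j), pd_mul i hs (hi.diff i j), h.pd_sqrt_det hy, h2]
    ring
  have h3 : ∀ i, pd i (fun z => ∑ j, Real.sqrt (G z).det * (G z)⁻¹ i j * p j z) y =
      ∑ j, Real.sqrt (G y).det * ((christoffelM G i y).trace * (G y)⁻¹ i j * p j y -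
        (((G y)⁻¹ * (christoffelM G i y).transpose) i j + (christoffelM G i y * (G y)⁻¹) i j) *
          p j y + (G y)⁻¹ i j * pd i (p j) y) := by
    intro i
    rw [pd_sum i _ fun j _ => (hs.fun_mul (hi.diff i j)).fun_mul (hp j)]
    exact Finset.sum_congr rfl fun j _ => h1 i j
  simp only [h3, ← Finset.mul_sum]
  rw [← mul_assoc, inv_mul_cancel₀ hpos, one_mul]
  simp only [Finset.sum_add_distrib, Finset.sum_sub_distrib, mul_sub, add_mul]
  -- The derivative of the volume density cancels the term `Γ^i_ik g^kj`.
  have h4 : ∑ i, ∑ j, (christoffelM G i y).trace * (G y)⁻¹ i j * p j y =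
      ∑ i, ∑ j, (christoffelM G i y * (G y)⁻¹) i j * p j y := by
    simp only [Matrix.trace, Matrix.diag, Matrix.mul_apply, Finset.sum_mul]
    rw [Finset.sum_comm, Finset.sum_comm (γ := Fin n) (f := fun i j => ∑ k, _ * _ * p j y)]
    refine Finset.sum_congr rfl fun j _ => ?_
    rw [Finset.sum_comm]
    refine Finset.sum_congr rfl fun a _ => Finset.sum_congr rfl fun b _ => ?_
    simp only [christoffelM, Matrix.of_apply]
    rw [h.christoffel_symm hy]
  have h5 : ∑ i, ∑ j, ((G y)⁻¹ * (christoffelM G i y).transpose) i j * p j y =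
      ∑ i, ∑ j, (G y)⁻¹ i j * ∑ k, christoffel G k i j y * p k y := by
    refine Finset.sum_congr rfl fun i _ => ?_
    simp only [Matrix.mul_apply, Finset.sum_mul, Finset.mul_sum]
    rw [Finset.sum_comm]
    refine Finset.sum_congr rfl fun a _ => Finset.sum_congr rfl fun b _ => ?_
    simp only [christoffelM, Matrix.of_apply, Matrix.transpose_apply]
    ring
  rw [h4, h5]
  ring

theorem SmoothMetricOn.laplaceCoord_eq (h : SmoothMetricOn U G) (hy : y ∈ U)
    {u : EuclideanSpace ℝ (Fin n) → ℝ} (hu : ContDiffAt ℝ ∞ u y) :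
    laplaceCoord G u y = ∑ i, ∑ j, (G y)⁻¹ i j * hessianM G u y i j :=
  h.divergence_eq hy fun j => (contDiffAt_pd hu j).differentiableAt (by simp)

theorem IsPullback.laplaceCoord_eq (h : IsPullback ψ U V G G') (hz : z ∈ V)
    {u : EuclideanSpace ℝ (Fin n) → ℝ} (hu : ∀ y ∈ U, ContDiffAt ℝ ∞ u y) :
    laplaceCoord G' (fun w => u (ψ w)) z = laplaceCoord G u (ψ z) := by
  have hU := h.mapsTo z hz
  rw [h.metric'.laplaceCoord_eq hz (u := fun w => u (ψ w)) ((hu _ hU).comp z (h.smooth z hz)),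
    h.metric.laplaceCoord_eq hU (hu _ hU), IsPullback.sum_inv_mul, IsPullback.sum_inv_mul,
    h.hessianM_eq hz hu, h.trace_eq hz]

end LocalGeometry

/-! ### Conformal change of the scalar curvature -/

section ConformalCoord

variable {n : ℕ}

/-- The difference `δ^k_i pⱼ + δ^k_j pᵢ - g_ij p^k` of the Levi-Civita connections of the metrics
`e^(2f) g` and `g`, where `p = df` and `q` is the gradient of `f`. -/
def confDiff (g : Matrix (Fin n) (Fin n) ℝ) (p q : Fin n → ℝ) (k i j : Fin n) : ℝ :=
  (if k = i then p j else 0) + (if k = j then p i else 0) - g i j * q k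

section Algebra

variable {g : Matrix (Fin n) (Fin n) ℝ} {p q : Fin n → ℝ}

theorem confDiff_symm (hg : ∀ i j, g i j = g j i) (k i j : Fin n) :
    confDiff g p q k i j = confDiff g p q k j i := by
  rw [confDiff, confDiff, hg i j]
  ring

theorem sum_mul_confDiff (t : Fin n → ℝ) (j k : Fin n) :
    ∑ l, t l * confDiff g p q l j k = t j * p k + t k * p j - g j k * ∑ l, t l * q l := by
  simp only [confDiff, mul_sub, mul_add, Finset.sum_sub_distrib, Finset.sum_add_distrib, mul_ite,
    mul_zero, Finset.sum_ite_eq', Finset.mem_univ, if_true, Finset.mul_sum]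
  congr 1
  exact Finset.sum_congr rfl fun l _ => by ring

theorem sum_confDiff_diag (hg : ∀ i j, g i j = g j i) (hq : ∀ i, ∑ m, g i m * q m = p i)
    (j : Fin n) : ∑ i, confDiff g p q i i j = n * p j := by
  have h1 : ∑ i, g i j * q i = p j := by
    rw [← hq j]
    exact Finset.sum_congr rfl fun i _ => by rw [hg]
  simp only [confDiff, Finset.sum_sub_distrib, Finset.sum_add_distrib, if_true,
    Finset.sum_ite_eq', Finset.mem_univ, Finset.sum_const, Finset.card_univ, Fintype.card_fin,
    nsmul_eq_mul, h1]
  ring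

theorem sum_sum_mul_confDiff (hg : ∀ i j, g i j = g j i) (Γ : Fin n → Fin n → Fin n → ℝ)
    (j k : Fin n) :
    ∑ i, ∑ l, Γ i j l * confDiff g p q l i k =
      (∑ i, Γ i j i) * p k + ∑ i, Γ i j k * p i - ∑ i, g k i * ∑ l, Γ i j l * q l := by
  simp only [sum_mul_confDiff, Finset.sum_sub_distrib, Finset.sum_add_distrib, Finset.sum_mul]
  congr 1
  exact Finset.sum_congr rfl fun i _ => by rw [hg]

theorem sum_sum_confDiff_mul (Γ : Fin n → Fin n → Fin n → ℝ) (j k : Fin n) :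
    ∑ i, ∑ l, confDiff g p q i j l * Γ l i k =
      (∑ l, p l * Γ l j k) + p j * ∑ i, Γ i i k - ∑ l, g j l * ∑ i, Γ l i k * q i := by
  rw [Finset.sum_comm]
  have h : ∀ l, ∑ i, confDiff g p q i j l * Γ l i k =
      p l * Γ l j k + p j * Γ l l k - g j l * ∑ i, Γ l i k * q i := by
    intro l
    have := sum_mul_confDiff (g := g) (p := p) (q := q) (fun i => Γ l i k) j l
    simp only [mul_comm _ (Γ l _ k)]
    rw [this]
  simp only [h, Finset.sum_sub_distrib, Finset.sum_add_distrib, Finset.mul_sum]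

theorem sum_sum_confDiff_confDiff (hg : ∀ i j, g i j = g j i)
    (hq : ∀ i, ∑ m, g i m * q m = p i) (j k : Fin n) :
    ∑ i, ∑ l, confDiff g p q i j l * confDiff g p q l i k =
      (n + 2) * (p j * p k) - 2 * (g j k * ∑ l, p l * q l) := by
  rw [sum_sum_mul_confDiff hg]
  have h1 : ∑ i, confDiff g p q i j i = n * p j := by
    rw [← sum_confDiff_diag hg hq]
    exact Finset.sum_congr rfl fun i _ => confDiff_symm hg i j i
  have h2 : ∑ i, confDiff g p q i j k * p i = 2 * (p j * p k) - g j k * ∑ l, p l * q l := by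
    have := sum_mul_confDiff (g := g) (p := p) (q := q) p j k
    simp only [mul_comm (confDiff g p q _ j k)]
    rw [this]
    ring
  have h3 : ∑ i, g k i * ∑ l, confDiff g p q i j l * q l = g j k * ∑ l, p l * q l := by
    simp only [Finset.mul_sum]
    rw [Finset.sum_comm]
    have h4 : ∀ l, ∑ i, g k i * (confDiff g p q i j l * q l) =
        g j k * (p l * q l) + p j * (g k l * q l) - p k * (g j l * q l) := by
      intro l
      have h5 := sum_mul_confDiff (g := g) (p := p) (q := q) (fun i => g k i) j l
      rw [hq] at h5
      simp only [← mul_assoc, ← Finset.sum_mul]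
      rw [h5, hg k j]
      ring
    simp only [h4, Finset.sum_sub_distrib, Finset.sum_add_distrib, ← Finset.mul_sum, hq]
    ring
  rw [h1, h2, h3]
  ring

end Algebra

variable {U : Set (EuclideanSpace ℝ (Fin n))}
  {G : EuclideanSpace ℝ (Fin n) → Matrix (Fin n) (Fin n) ℝ}
  {c : EuclideanSpace ℝ (Fin n) → ℝ} {p q : Fin n → EuclideanSpace ℝ (Fin n) → ℝ}
  {y : EuclideanSpace ℝ (Fin n)}

theorem SmoothMetricOn.smul (h : SmoothMetricOn U G) (hc : ∀ y ∈ U, ContDiffAt ℝ ∞ c y)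
    (hpos : ∀ y ∈ U, 0 < c y) : SmoothMetricOn U (fun z => c z • G z) where
  isOpen := h.isOpen
  smooth y hy := (h.smooth y hy).smul (hc y hy)
  posDef y hy := (h.posDef y hy).smul (hpos y hy)

/-- The Levi-Civita connection of a conformal metric. -/
theorem SmoothMetricOn.christoffel_smul (h : SmoothMetricOn U G)
    (hc : ∀ y ∈ U, ContDiffAt ℝ ∞ c y) (hpos : ∀ y ∈ U, 0 < c y) (hy : y ∈ U)
    (hp : ∀ k, pd k c y = 2 * c y * p k y) (hq : ∀ i, ∑ m, G y i m * q m y = p i y)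
    (k i j : Fin n) :
    christoffel (fun z => c z • G z) k i j y =
      christoffel G k i j y + confDiff (G y) (fun a => p a y) (fun a => q a y) k i j := by
  have h' := h.smul hc hpos
  have hg := fun a b => h.symm_apply hy a b
  set D : Fin n → Matrix (Fin n) (Fin n) ℝ := fun i => Matrix.of fun k j =>
    confDiff (G y) (fun a => p a y) (fun a => q a y) k i j with hD
  have hGD : ∀ k a b, (G y * D k) a b = G y a k * p b y + G y a b * p k y - G y k b * p a y := by
    intro k a b
    rw [Matrix.mul_apply]
    simp only [hD, Matrix.of_apply]
    rw [sum_mul_confDiff, hq]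
  have hDG : ∀ k, (D k).transpose * G y + G y * D k = (2 * p k y) • G y := by
    intro k
    have e : (D k).transpose * G y = (G y * D k).transpose := by
      rw [Matrix.transpose_mul, h.transpose_eq hy]
    ext a b
    rw [e, Matrix.add_apply, Matrix.transpose_apply, hGD, hGD, Matrix.smul_apply, smul_eq_mul,
      hg b a, hg b k, hg a k]
    ring
  have key := christoffelM_eq_of_compatible (G := fun z => c z • G z) (y := y)
    (h'.transpose_eq hy) (h'.isUnit hy)
    (A := fun i => christoffelM G i y + D i) ?_ ?_ i
  · exact congrFun (congrFun key k) j
  · intro i j k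
    simp only [Matrix.add_apply, christoffelM, hD, Matrix.of_apply]
    rw [h.christoffel_symm hy, confDiff_symm hg]
  · intro k
    rw [pdM_smul k (hc y hy) (h.smooth y hy), hp, h.pdM_eq hy, mul_assoc, mul_comm (c y), ← mul_assoc,
      mul_comm _ (c y), mul_smul (c y), ← hDG]
    rw [← smul_add, Matrix.smul_mul, Matrix.mul_smul, ← smul_add, Matrix.transpose_add]
    congr 1
    noncomm_ring

/-- The Ricci curvature of a conformal metric. -/
theorem SmoothMetricOn.ricciCoord_smul (h : SmoothMetricOn U G)
    (hc : ∀ y ∈ U, ContDiffAt ℝ ∞ c y) (hpos : ∀ y ∈ U, 0 < c y) (hy : y ∈ U)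
    (hps : ∀ k, ∀ y ∈ U, ContDiffAt ℝ ∞ (p k) y)
    (hp : ∀ k, ∀ y ∈ U, pd k c y = 2 * c y * p k y) (hcl : ∀ j k, pd j (p k) y = pd k (p j) y)
    (j k : Fin n) :
    ricciCoord (fun z => c z • G z) j k y = ricciCoord G j k y
      - (n - 2) * (pd j (p k) y - ∑ l, christoffel G l j k y * p l y - p j y * p k y)
      - (∑ a, ∑ b, (G y)⁻¹ a b * (pd a (p b) y - ∑ l, christoffel G l a b y * p l y) +
          (n - 2) * ∑ a, ∑ b, (G y)⁻¹ a b * p a y * p b y) * G y j k := by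
  set q : Fin n → EuclideanSpace ℝ (Fin n) → ℝ := fun i z => ∑ m, (G z)⁻¹ i m * p m z with hqdef
  have hq : ∀ y ∈ U, ∀ i, ∑ m, G y i m * q m y = p i y := by
    intro y hy i
    have : ∑ m, G y i m * q m y = ((G y * (G y)⁻¹).mulVec fun m => p m y) i := by
      rw [← Matrix.mulVec_mulVec]
      rfl
    rw [this, Matrix.mul_nonsing_inv _ (h.isUnit hy), Matrix.one_mulVec]
  have hg := fun a b => h.symm_apply hy a b
  have hΓs := fun a b c => h.christoffel_symm hy a b c
  have hqs : ∀ i, DifferentiableAt ℝ (q i) y := fun i =>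
    (ContDiffAt.sum fun m _ => (h.smoothInv hy i m).mul (hps m y hy)).differentiableAt (by simp)
  have hpd : ∀ i, DifferentiableAt ℝ (p i) y := fun i => (hps i y hy).differentiableAt (by simp)
  have hΓd : ∀ a b c, DifferentiableAt ℝ (christoffel G a b c) y := fun a b c =>
    (h.smoothChristoffel hy b).diff a c
  have hGd := (h.smooth y hy).diff
  have hΓ := fun (z) (hz : z ∈ U) => h.christoffel_smul hc hpos hz (fun k => hp k z hz) (hq z hz)
  have hΓy := hΓ y hy
  set t : Fin n → ℝ := fun l => ∑ i, christoffel G i i l y with ht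
  set D := confDiff (G y) (fun a => p a y) (fun a => q a y) with hD
  -- the derivatives of the connection
  have hder : ∀ i a b e, pd e (christoffel (fun z => c z • G z) i a b) y =
      pd e (christoffel G i a b) y + ((if i = a then pd e (p b) y else 0) +
        (if i = b then pd e (p a) y else 0) -
        (pd e (fun z => G z a b) y * q i y + G y a b * pd e (q i) y)) := by
    intro i a b e
    have hev : christoffel (fun z => c z • G z) i a b =ᶠ[𝓝 y] fun z => christoffel G i a b z +
        (((if i = a then (1 : ℝ) else 0) * p b z + (if i = b then (1 : ℝ) else 0) * p a z) -
          G z a b * q i z) := by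
      filter_upwards [h.isOpen.mem_nhds hy] with z hz
      rw [hΓ z hz, confDiff]
      split_ifs <;> ring
    have d1 := (hpd b).const_mul (if i = a then (1 : ℝ) else 0)
    have d2 := (hpd a).const_mul (if i = b then (1 : ℝ) else 0)
    have d3 := (hGd a b).fun_mul (hqs i)
    rw [pd_congr hev, pd_add e (hΓd i a b) ((d1.fun_add d2).fun_sub d3),
      pd_sub e (d1.fun_add d2) d3, pd_add e d1 d2, pd_const_mul e _ (hpd b),
      pd_const_mul e _ (hpd a), pd_mul e (hGd a b) (hqs i)]
    simp only [ite_mul, one_mul, zero_mul]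
  have hdiv : ∑ i, (pd i (christoffel (fun z => c z • G z) i j k) y - pd i (christoffel G i j k) y) =
      pd j (p k) y + pd k (p j) y - ((∑ i, pd i (fun z => G z j k) y * q i y) +
        G y j k * ∑ i, pd i (q i) y) := by
    simp only [hder, add_sub_cancel_left, Finset.sum_sub_distrib, Finset.sum_add_distrib,
      Finset.sum_ite_eq', Finset.mem_univ, if_true, Finset.mul_sum]
  have htr : ∑ i, (pd j (christoffel (fun z => c z • G z) i i k) y - pd j (christoffel G i i k) y) =
      n * pd j (p k) y := by
    have hev : ∀ i, pd j (christoffel (fun z => c z • G z) i i k) y -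
        pd j (christoffel G i i k) y =
        pd j (fun z => confDiff (G z) (fun a => p a z) (fun a => q a z) i i k) y := by
      intro i
      have hev : christoffel (fun z => c z • G z) i i k =ᶠ[𝓝 y] fun z => christoffel G i i k z +
          confDiff (G z) (fun a => p a z) (fun a => q a z) i i k := by
        filter_upwards [h.isOpen.mem_nhds hy] with z hz using hΓ z hz i i k
      have hdd : DifferentiableAt ℝ
          (fun z => confDiff (G z) (fun a => p a z) (fun a => q a z) i i k) y := by
        simp only [confDiff, if_true]
        refine ((hpd k).fun_add ?_).fun_sub ((hGd i k).fun_mul (hqs i))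
        split_ifs
        · exact hpd i
        · exact differentiableAt_const _
      rw [pd_congr hev, pd_add j (hΓd i i k) hdd, add_sub_cancel_left]
    have hdd : ∀ i, DifferentiableAt ℝ
        (fun z => confDiff (G z) (fun a => p a z) (fun a => q a z) i i k) y := by
      intro i
      simp only [confDiff, if_true]
      refine ((hpd k).fun_add ?_).fun_sub ((hGd i k).fun_mul (hqs i))
      split_ifs
      · exact hpd i
      · exact differentiableAt_const _
    simp only [hev]
    rw [← pd_sum j _ fun i _ => hdd i, ← pd_const_mul j _ (hpd k)]
    refine pd_congr ?_
    filter_upwards [h.isOpen.mem_nhds hy] with z hz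
    exact sum_confDiff_diag (h.symm_apply hz) (hq z hz) k
  -- the quadratic terms
  have htD : ∀ l, ∑ i, D i i l = n * p l y := sum_confDiff_diag hg (hq y hy)
  have hquad : ∑ i, ∑ l, (christoffel (fun z => c z • G z) i i l y *
        christoffel (fun z => c z • G z) l j k y -
      christoffel (fun z => c z • G z) i j l y * christoffel (fun z => c z • G z) l i k y) =
      ∑ i, ∑ l, (christoffel G i i l y * christoffel G l j k y -
        christoffel G i j l y * christoffel G l i k y) +
      ((∑ l, t l * D l j k + n * ∑ l, p l y * christoffel G l j k y) -
        (∑ i, ∑ l, christoffel G i j l y * D l i k) - (∑ i, ∑ l, D i j l * christoffel G l i k y) +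
        (n * (∑ l, p l y * D l j k) - ∑ i, ∑ l, D i j l * D l i k)) := by
    have e1 : ∀ X Y : Fin n → Fin n → Fin n → ℝ,
        ∑ i, ∑ l, X i i l * Y l j k = ∑ l, (∑ i, X i i l) * Y l j k := by
      intro X Y
      rw [Finset.sum_comm]
      simp only [Finset.sum_mul]
    have e2 : ∑ i, ∑ l, D i i l * D l j k = n * ∑ l, p l y * D l j k := by
      rw [e1 D D, Finset.mul_sum]
      exact Finset.sum_congr rfl fun l _ => by rw [htD, mul_assoc]
    have e3 : ∑ i, ∑ l, D i i l * christoffel G l j k y =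
        n * ∑ l, p l y * christoffel G l j k y := by
      rw [e1 D fun l j k => christoffel G l j k y, Finset.mul_sum]
      exact Finset.sum_congr rfl fun l _ => by rw [htD, mul_assoc]
    have e4 : ∑ i, ∑ l, christoffel G i i l y * D l j k = ∑ l, t l * D l j k :=
      e1 (fun l j k => christoffel G l j k y) D
    rw [← e2, ← e3, ← e4]
    simp only [hΓy, ← Finset.sum_add_distrib, ← Finset.sum_sub_distrib]
    refine Finset.sum_congr rfl fun i _ => Finset.sum_congr rfl fun l _ => ?_
    ring
  have hsplit : ricciCoord (fun z => c z • G z) j k y - ricciCoord G j k y =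
      ∑ i, (pd i (christoffel (fun z => c z • G z) i j k) y - pd i (christoffel G i j k) y) -
      ∑ i, (pd j (christoffel (fun z => c z • G z) i i k) y - pd j (christoffel G i i k) y) +
      (∑ i, ∑ l, (christoffel (fun z => c z • G z) i i l y *
        christoffel (fun z => c z • G z) l j k y -
      christoffel (fun z => c z • G z) i j l y * christoffel (fun z => c z • G z) l i k y) -
      ∑ i, ∑ l, (christoffel G i i l y * christoffel G l j k y -
        christoffel G i j l y * christoffel G l i k y)) := by
    simp only [ricciCoord, Finset.sum_add_distrib, Finset.sum_sub_distrib]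
    ring
  -- the divergence of `q` is the trace of the covariant derivative of `p`
  have hdivq : ∑ a, ∑ b, (G y)⁻¹ a b * (pd a (p b) y - ∑ l, christoffel G l a b y * p l y) =
      ∑ i, pd i (q i) y + ∑ l, t l * q l y := by
    rw [← h.divergence_eq hy hpd]
    have hs : DifferentiableAt ℝ (fun z => Real.sqrt (G z).det) y :=
      (h.contDiffAt_sqrt_det hy).differentiableAt (by simp)
    have e : ∀ i, pd i (fun z => ∑ j, Real.sqrt (G z).det * (G z)⁻¹ i j * p j z) y =
        Real.sqrt (G y).det * (t i * q i y + pd i (q i) y) := by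
      intro i
      have e1 : (fun z => ∑ j, Real.sqrt (G z).det * (G z)⁻¹ i j * p j z) =
          fun z => Real.sqrt (G z).det * q i z := by
        funext z
        simp only [hqdef, Finset.mul_sum, mul_assoc]
      have e2 : (christoffelM G i y).trace = t i := by
        simp only [Matrix.trace, Matrix.diag, christoffelM, Matrix.of_apply, ht]
        exact Finset.sum_congr rfl fun m _ => hΓs m i m
      rw [e1, pd_mul i hs (hqs i), h.pd_sqrt_det hy, e2]
      ring
    simp only [e, ← Finset.mul_sum]
    rw [← mul_assoc, inv_mul_cancel₀ (Real.sqrt_pos.2 (h.det_pos hy)).ne', one_mul,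
      Finset.sum_add_distrib, add_comm]
  have hnorm : ∑ a, ∑ b, (G y)⁻¹ a b * p a y * p b y = ∑ l, p l y * q l y := by
    refine Finset.sum_congr rfl fun a _ => ?_
    simp only [hqdef, Finset.mul_sum]
    exact Finset.sum_congr rfl fun b _ => by ring
  have hdG : ∑ i, pd i (fun z => G z j k) y * q i y =
      (∑ i, G y k i * ∑ l, christoffel G i j l y * q l y) +
        ∑ l, G y j l * ∑ i, christoffel G l i k y * q i y := by
    have e : ∀ i, pd i (fun z => G z j k) y = (∑ m, christoffel G m i j y * G y m k) +
        ∑ m, G y j m * christoffel G m i k y := by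
      intro i
      have := congrFun (congrFun (h.pdM_eq hy i) j) k
      simpa only [pdM, Matrix.of_apply, Matrix.add_apply, Matrix.mul_apply,
        Matrix.transpose_apply, christoffelM] using this
    simp only [e, add_mul, Finset.sum_add_distrib, Finset.sum_mul, Finset.mul_sum]
    congr 1
    · rw [Finset.sum_comm]
      refine Finset.sum_congr rfl fun a _ => Finset.sum_congr rfl fun b _ => ?_
      rw [hg k a, hΓs a j b]
      ring
    · rw [Finset.sum_comm]
      exact Finset.sum_congr rfl fun a _ => Finset.sum_congr rfl fun b _ => by ring
  have hb := sum_sum_mul_confDiff (g := G y) (p := fun a => p a y) (q := fun a => q a y) hg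
    (fun a b c => christoffel G a b c y) j k
  have hc' := sum_sum_confDiff_mul (g := G y) (p := fun a => p a y) (q := fun a => q a y)
    (fun a b c => christoffel G a b c y) j k
  have hdd := sum_sum_confDiff_confDiff (g := G y) (p := fun a => p a y) (q := fun a => q a y) hg
    (hq y hy) j k
  have ha := sum_mul_confDiff (g := G y) (p := fun a => p a y) (q := fun a => q a y) t j k
  have hpD := sum_mul_confDiff (g := G y) (p := fun a => p a y) (q := fun a => q a y)
    (fun a => p a y) j k
  have htj : ∑ i, christoffel G i j i y = t j := Finset.sum_congr rfl fun i _ => hΓs i j i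
  have hpΓ : ∑ i, christoffel G i j k y * p i y = ∑ l, p l y * christoffel G l j k y :=
    Finset.sum_congr rfl fun i _ => mul_comm _ _
  rw [← hD] at hb hc' hdd ha hpD
  rw [hquad, hdiv, htr, hdG, ha, hb, hc', hdd, hpD] at hsplit
  rw [hdivq, hnorm, hpΓ]
  simp only [htj, hpΓ] at hsplit
  rw [hcl k j] at hsplit
  have htk : ∑ i, christoffel G i i k y = t k := rfl
  rw [htk] at hsplit
  linear_combination hsplit

/-- The scalar curvature of the metric `ν^(4/(n-2)) g`. -/
theorem SmoothMetricOn.scalarCoord_conformal (hn : 3 ≤ n) (h : SmoothMetricOn U G)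
    {ν : EuclideanSpace ℝ (Fin n) → ℝ} (hν : ∀ y ∈ U, ContDiffAt ℝ ∞ ν y)
    (hpos : ∀ y ∈ U, 0 < ν y) (hy : y ∈ U) :
    cn n * scalarCoord (fun z => (ν z ^ (4 / ((n : ℝ) - 2))) • G z) y *
        (ν y ^ (4 / ((n : ℝ) - 2)) * ν y) =
      -laplaceCoord G ν y + cn n * scalarCoord G y * ν y := by
  have hn2 : (0 : ℝ) < (n : ℝ) - 2 := by
    have : (3 : ℝ) ≤ n := by exact_mod_cast hn
    linarith
  have hn1 : (0 : ℝ) < (n : ℝ) - 1 := by linarith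
  set c : EuclideanSpace ℝ (Fin n) → ℝ := fun z => ν z ^ (4 / ((n : ℝ) - 2)) with hcdef
  have hc : ∀ y ∈ U, ContDiffAt ℝ ∞ c y := fun y hy =>
    (hν y hy).rpow_const_of_ne (hpos y hy).ne'
  have hcpos : ∀ y ∈ U, 0 < c y := fun y hy => Real.rpow_pos_of_pos (hpos y hy) _
  set p : Fin n → EuclideanSpace ℝ (Fin n) → ℝ := fun k z => 2 / ((n : ℝ) - 2) * (pd k ν z * (ν z)⁻¹)
    with hpdef
  have hinv : ∀ y ∈ U, ContDiffAt ℝ ∞ (fun z => (ν z)⁻¹) y := fun y hy =>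
    (hν y hy).inv (hpos y hy).ne'
  have hps : ∀ k, ∀ y ∈ U, ContDiffAt ℝ ∞ (p k) y := fun k y hy =>
    contDiffAt_const.mul ((contDiffAt_pd (hν y hy) k).mul (hinv y hy))
  have hp : ∀ k, ∀ y ∈ U, pd k c y = 2 * c y * p k y := by
    intro k y hy
    have hd := Real.hasDerivAt_rpow_const (x := ν y) (p := 4 / ((n : ℝ) - 2)) (Or.inl (hpos y hy).ne')
    rw [hcdef, pd_scomp k hd.differentiableAt ((hν y hy).differentiableAt (by simp)), hd.deriv,
      Real.rpow_sub_one (hpos y hy).ne']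
    simp only [hpdef]
    field_simp
    ring
  have hpp : ∀ j k, pd j (p k) y = 2 / ((n : ℝ) - 2) *
      (pd j (pd k ν) y * (ν y)⁻¹ - pd j ν y * pd k ν y * ((ν y)⁻¹) ^ 2) := by
    intro j k
    have d1 : DifferentiableAt ℝ (pd k ν) y :=
      (contDiffAt_pd (hν y hy) k).differentiableAt (by simp)
    have d2 : DifferentiableAt ℝ (fun z => (ν z)⁻¹) y := (hinv y hy).differentiableAt (by simp)
    have hd := hasDerivAt_inv (hpos y hy).ne'
    have d3 : pd j (fun z => (ν z)⁻¹) y = -(ν y ^ 2)⁻¹ * pd j ν y := by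
      have := pd_scomp (F := ν) (y := y) j (h := fun x => x⁻¹) hd.differentiableAt
        ((hν y hy).differentiableAt (by simp))
      rw [this, hd.deriv]
    rw [hpdef, pd_const_mul j _ (d1.fun_mul d2), pd_mul j d1 d2, d3, inv_pow]
    ring
  have hcl : ∀ j k, pd j (p k) y = pd k (p j) y := by
    intro j k
    rw [hpp, hpp, pd_comm (hν y hy)]
    ring
  have hric := fun j k => h.ricciCoord_smul hc hcpos hy hps hp hcl j k
  set P := ∑ a, ∑ b, (G y)⁻¹ a b * p a y * p b y with hP
  set S := ∑ a, ∑ b, (G y)⁻¹ a b * (pd a (p b) y - ∑ l, christoffel G l a b y * p l y) with hS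
  have hcy := (hcpos y hy).ne'
  have htrace : ∑ j, ∑ k, (G y)⁻¹ j k * G y j k = n := by
    rw [IsPullback.sum_inv_mul, h.transpose_eq hy, Matrix.nonsing_inv_mul _ (h.isUnit hy),
      Matrix.trace_one, Fintype.card_fin]
  have hscal : c y * scalarCoord (fun z => c z • G z) y =
      scalarCoord G y - 2 * (n - 1) * S - (n - 1) * (n - 2) * P := by
    have hi : (c y • G y)⁻¹ = (c y)⁻¹ • (G y)⁻¹ := by
      refine Matrix.inv_eq_right_inv ?_
      rw [Matrix.smul_mul, Matrix.mul_smul, smul_smul, mul_inv_cancel₀ hcy, one_smul,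
        Matrix.mul_nonsing_inv _ (h.isUnit hy)]
    have e1 : c y * scalarCoord (fun z => c z • G z) y =
        ∑ j, ∑ k, (G y)⁻¹ j k * ricciCoord (fun z => c z • G z) j k y := by
      simp only [scalarCoord, hi, Matrix.smul_apply, smul_eq_mul, Finset.mul_sum]
      refine Finset.sum_congr rfl fun j _ => Finset.sum_congr rfl fun k _ => ?_
      rw [← mul_assoc, ← mul_assoc, mul_inv_cancel₀ hcy, one_mul]
    rw [e1]
    have e2 : ∀ j k, (G y)⁻¹ j k * ricciCoord (fun z => c z • G z) j k y =
        (G y)⁻¹ j k * ricciCoord G j k y - (n - 2) * ((G y)⁻¹ j k *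
          (pd j (p k) y - ∑ l, christoffel G l j k y * p l y)) +
        (n - 2) * ((G y)⁻¹ j k * p j y * p k y) -
        (S + (n - 2) * P) * ((G y)⁻¹ j k * G y j k) := by
      intro j k
      rw [hric]
      ring
    simp only [e2, Finset.sum_add_distrib, Finset.sum_sub_distrib, ← Finset.mul_sum]
    rw [htrace, ← hP, ← hS, scalarCoord]
    ring
  set Q := ∑ a, ∑ b, (G y)⁻¹ a b * pd a ν y * pd b ν y with hQ
  have hPQ : P = (2 / ((n : ℝ) - 2)) ^ 2 * ((ν y)⁻¹) ^ 2 * Q := by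
    simp only [hP, hQ, hpdef, Finset.mul_sum]
    exact Finset.sum_congr rfl fun j _ => Finset.sum_congr rfl fun k _ => by ring
  have hSL : S = 2 / ((n : ℝ) - 2) * (laplaceCoord G ν y * (ν y)⁻¹ - ((ν y)⁻¹) ^ 2 * Q) := by
    rw [h.laplaceCoord_eq hy (hν y hy)]
    have e : ∀ a b, (G y)⁻¹ a b * (pd a (p b) y - ∑ l, christoffel G l a b y * p l y) =
        2 / ((n : ℝ) - 2) * ((G y)⁻¹ a b * hessianM G ν y a b * (ν y)⁻¹ -
          ((ν y)⁻¹) ^ 2 * ((G y)⁻¹ a b * pd a ν y * pd b ν y)) := by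
      intro a b
      have e1 : ∑ l, christoffel G l a b y * p l y =
          2 / ((n : ℝ) - 2) * ((∑ l, christoffel G l a b y * pd l ν y) * (ν y)⁻¹) := by
        simp only [hpdef, Finset.sum_mul, Finset.mul_sum]
        exact Finset.sum_congr rfl fun l _ => by ring
      rw [hpp, e1]
      simp only [hessianM, Matrix.of_apply]
      ring
    simp only [hS, hQ, e, ← Finset.mul_sum, Finset.sum_sub_distrib, ← Finset.sum_mul]
  have hνy := (hpos y hy).ne'
  change cn n * scalarCoord (fun z => c z • G z) y * (c y * ν y) = _
  rw [show cn n * scalarCoord (fun z => c z • G z) y * (c y * ν y) =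
    cn n * (c y * scalarCoord (fun z => c z • G z) y) * ν y by ring, hscal, hPQ, hSL, cn]
  field_simp
  ring

end ConformalCoord

/-! ### The metric in charts -/

section Charts

variable {n : ℕ} {M : Type*} [TopologicalSpace M] [ChartedSpace (EuclideanSpace ℝ (Fin n)) M]
  [IsManifold (𝓡 n) ∞ M]

theorem inner_congr_base (g : RMetric n M) {p p' : M} (h : p = p')
    (v w : EuclideanSpace ℝ (Fin n)) :
    g.inner p (v : TangentSpace (𝓡 n) p) (w : TangentSpace (𝓡 n) p) =
      g.inner p' (v : TangentSpace (𝓡 n) p') (w : TangentSpace (𝓡 n) p') := by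
  subst h; rfl

/-- The metric along a parametrization `f`, applied to the images of two vectors. -/
def metricAlong (g : RMetric n M) (f : EuclideanSpace ℝ (Fin n) → M)
    (y v w : EuclideanSpace ℝ (Fin n)) : ℝ :=
  g.inner (f y) (mfderiv 𝓘(ℝ, EuclideanSpace ℝ (Fin n)) (𝓡 n) f y v)
    (mfderiv 𝓘(ℝ, EuclideanSpace ℝ (Fin n)) (𝓡 n) f y w)

theorem gCoord_apply (g : RMetric n M) (x : M) (y : EuclideanSpace ℝ (Fin n)) (i j : Fin n) :
    gCoord g x y i j = metricAlong g (extChartAt (𝓡 n) x).symm y (EuclideanSpace.single i 1)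
      (EuclideanSpace.single j 1) := rfl

theorem mdifferentiableAt_chart_symm {x : M} {y : EuclideanSpace ℝ (Fin n)}
    (hy : y ∈ (extChartAt (𝓡 n) x).target) :
    MDifferentiableAt 𝓘(ℝ, EuclideanSpace ℝ (Fin n)) (𝓡 n) (extChartAt (𝓡 n) x).symm y :=
  ((contMDiffOn_extChartAt_symm (I := 𝓡 n) (n := ∞) x).contMDiffAt
    ((isOpen_extChartAt_target x).mem_nhds hy)).mdifferentiableAt (by simp)

theorem mfderiv_chart_symm_injective {x : M} {y : EuclideanSpace ℝ (Fin n)}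
    (hy : y ∈ (extChartAt (𝓡 n) x).target) {v : EuclideanSpace ℝ (Fin n)}
    (hv : mfderiv 𝓘(ℝ, EuclideanSpace ℝ (Fin n)) (𝓡 n) (extChartAt (𝓡 n) x).symm y v = 0) :
    v = 0 := by
  have h := mfderiv_extChartAt_comp_mfderivWithin_extChartAt_symm (I := 𝓡 n) hy
  rw [ModelWithCorners.range_eq_univ, mfderivWithin_univ] at h
  have h1 : mfderiv (𝓡 n) 𝓘(ℝ, EuclideanSpace ℝ (Fin n)) (extChartAt (𝓡 n) x)
      ((extChartAt (𝓡 n) x).symm y) (mfderiv 𝓘(ℝ, EuclideanSpace ℝ (Fin n)) (𝓡 n)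
        (extChartAt (𝓡 n) x).symm y v) = v := DFunLike.congr_fun h v
  rw [hv, map_zero] at h1
  exact h1.symm

theorem metricAlong_eq_sum (g : RMetric n M) (f : EuclideanSpace ℝ (Fin n) → M)
    (y v w : EuclideanSpace ℝ (Fin n)) :
    metricAlong g f y v w = ∑ i, ∑ j, v i * w j *
      metricAlong g f y (EuclideanSpace.single i 1) (EuclideanSpace.single j 1) := by
  let T : EuclideanSpace ℝ (Fin n) →L[ℝ] TangentSpace (𝓡 n) (f y) :=
    mfderiv 𝓘(ℝ, EuclideanSpace ℝ (Fin n)) (𝓡 n) f y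
  have e : ∀ v : EuclideanSpace ℝ (Fin n), T v = ∑ i, v i • T (EuclideanSpace.single i 1) := by
    intro v
    conv_lhs => rw [← (EuclideanSpace.basisFun (Fin n) ℝ).sum_repr v]
    simp only [map_sum, map_smul, EuclideanSpace.basisFun_repr, EuclideanSpace.basisFun_apply]
  change g.inner (f y) (T v) (T w) = ∑ i, ∑ j, v i * w j *
    g.inner (f y) (T (EuclideanSpace.single i 1)) (T (EuclideanSpace.single j 1))
  rw [e v, e w]
  simp only [map_sum, map_smul, sum_apply, smul_apply, smul_eq_mul,
    Finset.mul_sum]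
  rw [Finset.sum_comm]
  refine Finset.sum_congr rfl fun i _ => Finset.sum_congr rfl fun j _ => ?_
  ring

theorem contDiffAt_gCoord (g : RMetric n M) (x : M) {y : EuclideanSpace ℝ (Fin n)}
    (hy : y ∈ (extChartAt (𝓡 n) x).target) (i j : Fin n) :
    ContDiffAt ℝ ∞ (fun z => gCoord g x z i j) y := by
  have ho := isOpen_extChartAt_target (I := 𝓡 n) x
  have hs := contMDiffOn_extChartAt_symm (I := 𝓡 n) (n := ∞) x
  have hT := hs.contMDiffOn_tangentMapWithin (m := ∞) (by simp) ho.uniqueMDiffOn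
  have hv : ∀ i : Fin n, ContMDiffOn 𝓘(ℝ, EuclideanSpace ℝ (Fin n)) (𝓡 n).tangent ∞
      (fun z => Bundle.TotalSpace.mk' (EuclideanSpace ℝ (Fin n))
        (E := fun p : M => TangentSpace (𝓡 n) p) ((extChartAt (𝓡 n) x).symm z)
        (mfderiv 𝓘(ℝ, EuclideanSpace ℝ (Fin n)) (𝓡 n) (extChartAt (𝓡 n) x).symm z
          (EuclideanSpace.single i (1 : ℝ)))) (extChartAt (𝓡 n) x).target := by
    intro i
    have hc : ContMDiff 𝓘(ℝ, EuclideanSpace ℝ (Fin n)) 𝓘(ℝ, EuclideanSpace ℝ (Fin n)).tangent ∞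
        (fun z : EuclideanSpace ℝ (Fin n) => (⟨z, EuclideanSpace.single i (1 : ℝ)⟩ :
          TangentBundle 𝓘(ℝ, EuclideanSpace ℝ (Fin n)) (EuclideanSpace ℝ (Fin n)))) :=
      contMDiff_vectorSpace_iff_contDiff.2 contDiff_const
    refine (hT.comp (hc.contMDiffOn (s := (extChartAt (𝓡 n) x).target)) fun z hz => hz).congr ?_
    intro z hz
    simp only [Function.comp_def, tangentMapWithin]
    rw [mfderivWithin_of_isOpen ho hz]
  have hg : ContMDiffOn 𝓘(ℝ, EuclideanSpace ℝ (Fin n)) _ ∞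
      (fun z => Bundle.TotalSpace.mk' (EuclideanSpace ℝ (Fin n) →L[ℝ] EuclideanSpace ℝ (Fin n) →L[ℝ] ℝ)
        (E := fun p : M => TangentSpace (𝓡 n) p →L[ℝ] TangentSpace (𝓡 n) p →L[ℝ] ℝ)
        ((extChartAt (𝓡 n) x).symm z) (g.inner ((extChartAt (𝓡 n) x).symm z)))
      (extChartAt (𝓡 n) x).target := g.contMDiff.comp_contMDiffOn hs
  have h : ContMDiffOn 𝓘(ℝ, EuclideanSpace ℝ (Fin n)) _ ∞
      (fun z => Bundle.TotalSpace.mk' ℝ (E := Bundle.Trivial M ℝ) ((extChartAt (𝓡 n) x).symm z)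
        (gCoord g x z i j)) (extChartAt (𝓡 n) x).target :=
    ContMDiffOn.clm_bundle_apply₂ (F₁ := EuclideanSpace ℝ (Fin n))
      (F₂ := EuclideanSpace ℝ (Fin n)) hg (hv i) (hv j)
  have h2 := h y hy
  simp only [Bundle.contMDiffWithinAt_totalSpace] at h2
  exact (h2.2.contMDiffAt (ho.mem_nhds hy)).contDiffAt

/-- The metric in a chart is a smooth field of positive definite matrices. -/
theorem smoothMetricOn_gCoord (g : RMetric n M) (x : M) :
    SmoothMetricOn (extChartAt (𝓡 n) x).target (gCoord g x) where
  isOpen := isOpen_extChartAt_target x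
  smooth y hy i j := contDiffAt_gCoord g x hy i j
  posDef y hy := by
    refine Matrix.PosDef.of_dotProduct_mulVec_pos ?_ ?_
    · ext i j
      exact g.symm _ _ _
    · intro v hv
      have h1 : star v ⬝ᵥ (gCoord g x y).mulVec v = metricAlong g (extChartAt (𝓡 n) x).symm y
          (WithLp.toLp 2 v) (WithLp.toLp 2 v) := by
        rw [metricAlong_eq_sum]
        simp only [dotProduct, Matrix.mulVec, gCoord_apply, Finset.mul_sum, star_trivial]
        refine Finset.sum_congr rfl fun i _ => Finset.sum_congr rfl fun j _ => ?_
        ring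
      rw [h1]
      refine g.pos _ _ fun h0 => hv ?_
      have := mfderiv_chart_symm_injective hy h0
      simpa using congrArg WithLp.ofLp this

/-- The part of the chart around `x'` that lies in the domain of the chart around `x`. -/
def overlap (n : ℕ) {M : Type*} [TopologicalSpace M] [ChartedSpace (EuclideanSpace ℝ (Fin n)) M]
    (x x' : M) : Set (EuclideanSpace ℝ (Fin n)) :=
  (extChartAt (𝓡 n) x').target ∩ (extChartAt (𝓡 n) x').symm ⁻¹' (extChartAt (𝓡 n) x).source

theorem isOpen_overlap (x x' : M) : IsOpen (overlap n x x') :=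
  (continuousOn_extChartAt_symm x').isOpen_inter_preimage (isOpen_extChartAt_target x')
    (isOpen_extChartAt_source x)

/-- The transition map between two charts. -/
def transition (n : ℕ) {M : Type*} [TopologicalSpace M]
    [ChartedSpace (EuclideanSpace ℝ (Fin n)) M] (x x' : M) (z : EuclideanSpace ℝ (Fin n)) :
    EuclideanSpace ℝ (Fin n) :=
  extChartAt (𝓡 n) x ((extChartAt (𝓡 n) x').symm z)

theorem contDiffAt_transition (x x' : M) {z : EuclideanSpace ℝ (Fin n)}
    (hz : z ∈ overlap n x x') : ContDiffAt ℝ ∞ (transition n x x') z := by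
  have h1 : ContMDiffAt 𝓘(ℝ, EuclideanSpace ℝ (Fin n)) (𝓡 n) ∞ (extChartAt (𝓡 n) x').symm z :=
    (contMDiffOn_extChartAt_symm x').contMDiffAt ((isOpen_extChartAt_target x').mem_nhds hz.1)
  have h2 : ContMDiffAt (𝓡 n) 𝓘(ℝ, EuclideanSpace ℝ (Fin n)) ∞ (extChartAt (𝓡 n) x)
      ((extChartAt (𝓡 n) x').symm z) :=
    contMDiffAt_extChartAt' (by simpa [extChartAt_source] using hz.2)
  exact (h2.comp z h1).contDiffAt

theorem chart_symm_transition {x x' : M} {z : EuclideanSpace ℝ (Fin n)}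
    (hz : z ∈ overlap n x x') :
    (extChartAt (𝓡 n) x).symm (transition n x x' z) = (extChartAt (𝓡 n) x').symm z :=
  (extChartAt (𝓡 n) x).left_inv hz.2

/-- The coordinate expressions of the metric in two charts are related by the transition map. -/
theorem isPullback_transition (g : RMetric n M) (x x' : M) :
    IsPullback (transition n x x') (extChartAt (𝓡 n) x).target (overlap n x x')
      (gCoord g x) (gCoord g x') where
  metric := smoothMetricOn_gCoord g x
  metric' :=
    { isOpen := isOpen_overlap x x'
      smooth := fun y hy => (smoothMetricOn_gCoord g x').smooth y hy.1
      posDef := fun y hy => (smoothMetricOn_gCoord g x').posDef y hy.1 }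
  mapsTo z hz := (extChartAt (𝓡 n) x).map_source hz.2
  smooth z hz := contDiffAt_transition x x' hz
  eq z hz := by
    have hψ := (contDiffAt_transition x x' hz).differentiableAt (by simp)
    have hev : (extChartAt (𝓡 n) x').symm =ᶠ[𝓝 z]
        (extChartAt (𝓡 n) x).symm ∘ transition n x x' :=
      Filter.eventuallyEq_of_mem ((isOpen_overlap x x').mem_nhds hz)
        fun w hw => (chart_symm_transition hw).symm
    have hmem : transition n x x' z ∈ (extChartAt (𝓡 n) x).target :=
      (extChartAt (𝓡 n) x).map_source hz.2
    have hd : ∀ v : EuclideanSpace ℝ (Fin n),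
        (mfderiv 𝓘(ℝ, EuclideanSpace ℝ (Fin n)) (𝓡 n) (extChartAt (𝓡 n) x').symm z v :
          EuclideanSpace ℝ (Fin n)) =
        (mfderiv 𝓘(ℝ, EuclideanSpace ℝ (Fin n)) (𝓡 n) (extChartAt (𝓡 n) x).symm
          (transition n x x' z) (fderiv ℝ (transition n x x') z v) :
          EuclideanSpace ℝ (Fin n)) := by
      intro v
      rw [hev.mfderiv_eq, mfderiv_comp z (mdifferentiableAt_chart_symm hmem)
        hψ.mdifferentiableAt, mfderiv_eq_fderiv]
      rfl
    ext i j
    rw [gCoord_apply, metricAlong]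
    have h1 := inner_congr_base g (chart_symm_transition hz).symm
      (mfderiv 𝓘(ℝ, EuclideanSpace ℝ (Fin n)) (𝓡 n) (extChartAt (𝓡 n) x').symm z
        (EuclideanSpace.single i 1))
      (mfderiv 𝓘(ℝ, EuclideanSpace ℝ (Fin n)) (𝓡 n) (extChartAt (𝓡 n) x').symm z
        (EuclideanSpace.single j 1))
    refine h1.trans ?_
    have h2 : metricAlong g (extChartAt (𝓡 n) x).symm (transition n x x' z)
        (fderiv ℝ (transition n x x') z (EuclideanSpace.single i 1))
        (fderiv ℝ (transition n x x') z (EuclideanSpace.single j 1)) =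
        ((jacobianM (transition n x x') z).transpose * gCoord g x (transition n x x' z) *
          jacobianM (transition n x x') z) i j := by
      rw [metricAlong_eq_sum]
      simp only [Matrix.mul_apply, Matrix.transpose_apply, jacobianM, Matrix.of_apply,
        pd_coord hψ, Finset.sum_mul, gCoord_apply]
      rw [Finset.sum_comm]
      refine Finset.sum_congr rfl fun a _ => Finset.sum_congr rfl fun b _ => ?_
      ring
    rw [← h2, metricAlong]
    rw [hd, hd]

end Charts

/-! ### Independence of the chart -/

section ChartIndependence

variable {n : ℕ}

theorem laplaceCoord_congr {G : EuclideanSpace ℝ (Fin n) → Matrix (Fin n) (Fin n) ℝ}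
    {u v : EuclideanSpace ℝ (Fin n) → ℝ} {y : EuclideanSpace ℝ (Fin n)} (h : u =ᶠ[𝓝 y] v) :
    laplaceCoord G u y = laplaceCoord G v y := by
  have h1 : ∀ i, pd i (fun z => ∑ j, Real.sqrt (G z).det * (G z)⁻¹ i j * pd j u z) y =
      pd i (fun z => ∑ j, Real.sqrt (G z).det * (G z)⁻¹ i j * pd j v z) y := by
    intro i
    refine pd_congr ?_
    filter_upwards [h.eventuallyEq_nhds] with z hz
    exact Finset.sum_congr rfl fun j _ => by rw [pd_congr hz]
  rw [laplaceCoord, laplaceCoord]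
  simp only [h1]

theorem gradCoord_congr {G : EuclideanSpace ℝ (Fin n) → Matrix (Fin n) (Fin n) ℝ}
    {u v u' v' : EuclideanSpace ℝ (Fin n) → ℝ} {y : EuclideanSpace ℝ (Fin n)} (h : u =ᶠ[𝓝 y] u')
    (h' : v =ᶠ[𝓝 y] v') : gradCoord G u v y = gradCoord G u' v' y := by
  simp only [gradCoord, fun i => pd_congr (i := i) h, fun i => pd_congr (i := i) h']

variable {M : Type*} [TopologicalSpace M] [ChartedSpace (EuclideanSpace ℝ (Fin n)) M]
  [IsManifold (𝓡 n) ∞ M]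

/-- A smooth function on `M` in the chart around `x`. -/
theorem contDiffAt_comp_chart_symm {u : M → ℝ} (hu : ContMDiff (𝓡 n) 𝓘(ℝ) ∞ u) (x : M)
    {y : EuclideanSpace ℝ (Fin n)} (hy : y ∈ (extChartAt (𝓡 n) x).target) :
    ContDiffAt ℝ ∞ (fun z => u ((extChartAt (𝓡 n) x).symm z)) y :=
  (hu.contMDiffAt.comp y ((contMDiffOn_extChartAt_symm x).contMDiffAt
    ((isOpen_extChartAt_target x).mem_nhds hy))).contDiffAt

theorem mem_overlap_self {x p : M} (hp : p ∈ (extChartAt (𝓡 n) x).source) :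
    extChartAt (𝓡 n) p p ∈ overlap n x p := by
  refine ⟨mem_extChartAt_target p, ?_⟩
  rw [Set.mem_preimage, extChartAt_to_inv]
  exact hp

theorem transition_self (x p : M) :
    transition n x p (extChartAt (𝓡 n) p p) = extChartAt (𝓡 n) x p := by
  rw [transition, extChartAt_to_inv]

/-- The scalar curvature may be computed in any chart. -/
theorem scalarCurvature_eq (g : RMetric n M) {x p : M} (hp : p ∈ (extChartAt (𝓡 n) x).source) :
    scalarCurvature g p = scalarCoord (gCoord g x) (extChartAt (𝓡 n) x p) := by
  have h := (isPullback_transition g x p).scalarCoord_eq (mem_overlap_self hp)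
  rw [transition_self] at h
  exact h

theorem comp_transition_eventuallyEq {x p : M} (hp : p ∈ (extChartAt (𝓡 n) x).source)
    (u : M → ℝ) : (fun z => u ((extChartAt (𝓡 n) p).symm z)) =ᶠ[𝓝 (extChartAt (𝓡 n) p p)]
      fun z => u ((extChartAt (𝓡 n) x).symm (transition n x p z)) :=
  Filter.eventuallyEq_of_mem ((isOpen_overlap x p).mem_nhds (mem_overlap_self hp))
    fun w hw => by simp only [chart_symm_transition hw]

/-- The Laplace-Beltrami operator may be computed in any chart. -/
theorem laplacian_eq (g : RMetric n M) {u : M → ℝ} (hu : ContMDiff (𝓡 n) 𝓘(ℝ) ∞ u) {x p : M}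
    (hp : p ∈ (extChartAt (𝓡 n) x).source) :
    laplacian g u p = laplaceCoord (gCoord g x) (fun z => u ((extChartAt (𝓡 n) x).symm z))
      (extChartAt (𝓡 n) x p) := by
  have h := (isPullback_transition g x p).laplaceCoord_eq (mem_overlap_self hp)
    (u := fun z => u ((extChartAt (𝓡 n) x).symm z))
    fun y hy => contDiffAt_comp_chart_symm hu x hy
  rw [transition_self, ← laplaceCoord_congr (comp_transition_eventuallyEq hp u)] at h
  exact h

/-- At its centre, the differential of the chart is the identity. -/
theorem mfderiv_chart_symm_self (p : M) (w : EuclideanSpace ℝ (Fin n)) :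
    (mfderiv 𝓘(ℝ, EuclideanSpace ℝ (Fin n)) (𝓡 n) (extChartAt (𝓡 n) p).symm
      (extChartAt (𝓡 n) p p) w : EuclideanSpace ℝ (Fin n)) = w := by
  have hid := mfderivWithin_range_extChartAt_symm (I := 𝓡 n) (x := p)
  rw [ModelWithCorners.range_eq_univ, mfderivWithin_univ] at hid
  exact DFunLike.congr_fun hid w

/-- The Gram matrix of the standard frame of the tangent space at `p`. -/
def frameMatrix (g : RMetric n M) (p : M) : Matrix (Fin n) (Fin n) ℝ :=
  Matrix.of fun k l : Fin n =>
    g.inner p (EuclideanSpace.single k (1 : ℝ) : EuclideanSpace ℝ (Fin n))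
      (EuclideanSpace.single l (1 : ℝ) : EuclideanSpace ℝ (Fin n))

theorem frameMatrix_eq_gCoord (g : RMetric n M) (p : M) :
    frameMatrix g p = gCoord g p (extChartAt (𝓡 n) p p) := by
  ext k l
  rw [gCoord_apply, metricAlong]
  refine Eq.trans ?_ (inner_congr_base g (extChartAt_to_inv (I := 𝓡 n) p).symm
    (mfderiv 𝓘(ℝ, EuclideanSpace ℝ (Fin n)) (𝓡 n) (extChartAt (𝓡 n) p).symm
      (extChartAt (𝓡 n) p p) (EuclideanSpace.single k 1))
    (mfderiv 𝓘(ℝ, EuclideanSpace ℝ (Fin n)) (𝓡 n) (extChartAt (𝓡 n) p).symm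
      (extChartAt (𝓡 n) p p) (EuclideanSpace.single l 1)))
  rw [mfderiv_chart_symm_self, mfderiv_chart_symm_self]
  rfl

theorem coInner_diff_eq (g : RMetric n M) {u v : M → ℝ} (hu : ContMDiff (𝓡 n) 𝓘(ℝ) ∞ u)
    (hv : ContMDiff (𝓡 n) 𝓘(ℝ) ∞ v) {x p : M} (hp : p ∈ (extChartAt (𝓡 n) x).source) :
    coInner g p (diff u p) (diff v p) = gradCoord (gCoord g x)
      (fun z => u ((extChartAt (𝓡 n) x).symm z)) (fun z => v ((extChartAt (𝓡 n) x).symm z))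
      (extChartAt (𝓡 n) x p) := by
  have hx : transition n x p (extChartAt (𝓡 n) p p) ∈ (extChartAt (𝓡 n) x).target :=
    (isPullback_transition g x p).mapsTo _ (mem_overlap_self hp)
  have h := (isPullback_transition g x p).gradCoord_eq (mem_overlap_self hp)
    ((contDiffAt_comp_chart_symm hu x hx).differentiableAt (by simp))
    ((contDiffAt_comp_chart_symm hv x hx).differentiableAt (by simp))
  rw [← gradCoord_congr (comp_transition_eventuallyEq hp u) (comp_transition_eventuallyEq hp v),
    transition_self] at h
  rw [← h]
  have hd : ∀ {u : M → ℝ}, ContMDiff (𝓡 n) 𝓘(ℝ) ∞ u → ∀ i,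
      diff (n := n) u p (EuclideanSpace.single i (1 : ℝ) : EuclideanSpace ℝ (Fin n)) =
        pd i (fun z => u ((extChartAt (𝓡 n) p).symm z)) (extChartAt (𝓡 n) p p) := by
    intro u hu i
    have hud : MDifferentiableAt (𝓡 n) 𝓘(ℝ) u
        ((extChartAt (𝓡 n) p).symm (extChartAt (𝓡 n) p p)) :=
      hu.contMDiffAt.mdifferentiableAt (by simp)
    have h1 := mfderiv_comp (extChartAt (𝓡 n) p p) hud
      (mdifferentiableAt_chart_symm (mem_extChartAt_target (I := 𝓡 n) p))
    rw [mfderiv_eq_fderiv] at h1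
    have h2 := DFunLike.congr_fun h1 (EuclideanSpace.single i (1 : ℝ))
    have h3 : ∀ p' : M, p' = p → ∀ w : EuclideanSpace ℝ (Fin n),
        (mfderiv (𝓡 n) 𝓘(ℝ) u p' (w : EuclideanSpace ℝ (Fin n)) : ℝ) =
          mfderiv (𝓡 n) 𝓘(ℝ) u p (w : EuclideanSpace ℝ (Fin n)) := by
      rintro _ rfl w
      rfl
    refine Eq.trans ?_ h2.symm
    refine Eq.trans ?_ (h3 _ (extChartAt_to_inv (I := 𝓡 n) p)
      (mfderiv 𝓘(ℝ, EuclideanSpace ℝ (Fin n)) (𝓡 n) (extChartAt (𝓡 n) p).symm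
        (extChartAt (𝓡 n) p p) (EuclideanSpace.single i 1))).symm
    rw [mfderiv_chart_symm_self]
    rfl
  have hG := frameMatrix_eq_gCoord g p
  rw [frameMatrix] at hG
  rw [coInner, gradCoord, hG]
  refine Finset.sum_congr rfl fun i _ => Finset.sum_congr rfl fun j _ => ?_
  rw [hd hu, hd hv]

/-! ### Smoothness of the geometric quantities -/

/-- A function which is smooth in the coordinates of every chart is smooth. -/
theorem contMDiff_of_chart {F : M → ℝ} {f : M → EuclideanSpace ℝ (Fin n) → ℝ}
    (hf : ∀ x, ∀ y ∈ (extChartAt (𝓡 n) x).target, ContDiffAt ℝ ∞ (f x) y)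
    (hF : ∀ x, ∀ p ∈ (extChartAt (𝓡 n) x).source, F p = f x (extChartAt (𝓡 n) x p)) :
    ContMDiff (𝓡 n) 𝓘(ℝ) ∞ F := by
  intro x
  have h1 : ContMDiffAt (𝓡 n) 𝓘(ℝ) ∞ (fun p => f x (extChartAt (𝓡 n) x p)) x :=
    (hf x _ (mem_extChartAt_target x)).contMDiffAt.comp x contMDiffAt_extChartAt
  refine h1.congr_of_eventuallyEq ?_
  filter_upwards [extChartAt_source_mem_nhds (I := 𝓡 n) x] with p hp using hF x p hp

theorem contMDiff_scalarCurvature (g : RMetric n M) :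
    ContMDiff (𝓡 n) 𝓘(ℝ) ∞ (scalarCurvature g) :=
  contMDiff_of_chart (fun x _ hy => (smoothMetricOn_gCoord g x).contDiffAt_scalarCoord hy)
    fun _ _ hp => scalarCurvature_eq g hp

theorem SmoothMetricOn.contDiffAt_laplaceCoord {U : Set (EuclideanSpace ℝ (Fin n))}
    {G : EuclideanSpace ℝ (Fin n) → Matrix (Fin n) (Fin n) ℝ} (h : SmoothMetricOn U G)
    {y : EuclideanSpace ℝ (Fin n)} (hy : y ∈ U) {u : EuclideanSpace ℝ (Fin n) → ℝ}
    (hu : ContDiffAt ℝ ∞ u y) : ContDiffAt ℝ ∞ (laplaceCoord G u) y := by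
  have hs := h.contDiffAt_sqrt_det hy
  exact (hs.inv (Real.sqrt_pos.2 (h.det_pos hy)).ne').mul (ContDiffAt.sum fun i _ =>
    contDiffAt_pd (ContDiffAt.sum fun j _ =>
      (hs.mul (h.smoothInv hy i j)).mul (contDiffAt_pd hu j)) i)

theorem SmoothMetricOn.contDiffAt_gradCoord {U : Set (EuclideanSpace ℝ (Fin n))}
    {G : EuclideanSpace ℝ (Fin n) → Matrix (Fin n) (Fin n) ℝ} (h : SmoothMetricOn U G)
    {y : EuclideanSpace ℝ (Fin n)} (hy : y ∈ U) {u v : EuclideanSpace ℝ (Fin n) → ℝ}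
    (hu : ContDiffAt ℝ ∞ u y) (hv : ContDiffAt ℝ ∞ v y) :
    ContDiffAt ℝ ∞ (gradCoord G u v) y :=
  ContDiffAt.sum fun i _ => ContDiffAt.sum fun j _ =>
    ((h.smoothInv hy i j).mul (contDiffAt_pd hu i)).mul (contDiffAt_pd hv j)

theorem contMDiff_laplacian (g : RMetric n M) {u : M → ℝ} (hu : ContMDiff (𝓡 n) 𝓘(ℝ) ∞ u) :
    ContMDiff (𝓡 n) 𝓘(ℝ) ∞ (laplacian g u) :=
  contMDiff_of_chart (fun x _ hy => (smoothMetricOn_gCoord g x).contDiffAt_laplaceCoord hy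
    (contDiffAt_comp_chart_symm hu x hy)) fun _ _ hp => laplacian_eq g hu hp

theorem contMDiff_coInner_diff (g : RMetric n M) {u v : M → ℝ}
    (hu : ContMDiff (𝓡 n) 𝓘(ℝ) ∞ u) (hv : ContMDiff (𝓡 n) 𝓘(ℝ) ∞ v) :
    ContMDiff (𝓡 n) 𝓘(ℝ) ∞ (fun p => coInner g p (diff u p) (diff v p)) :=
  contMDiff_of_chart (fun x _ hy => (smoothMetricOn_gCoord g x).contDiffAt_gradCoord hy
    (contDiffAt_comp_chart_symm hu x hy) (contDiffAt_comp_chart_symm hv x hy))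
    fun _ _ hp => coInner_diff_eq g hu hv hp

theorem contMDiff_confLaplacian (g : RMetric n M) {u : M → ℝ}
    (hu : ContMDiff (𝓡 n) 𝓘(ℝ) ∞ u) : ContMDiff (𝓡 n) 𝓘(ℝ) ∞ (confLaplacian g u) :=
  (contMDiff_laplacian g hu).neg.add
    ((contMDiff_const.mul (contMDiff_scalarCurvature g)).mul hu)

/-! ### The conformal Laplacian of a conformal metric -/

theorem gCoord_conformal (g : RMetric n M) (μ : PosSmooth n M) (x : M) :
    gCoord (conformal g μ) x =
      fun y => factor μ ((extChartAt (𝓡 n) x).symm y) • gCoord g x y := rfl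

/-- The conformal factor of a conformal metric solves `L_g ν = c_n R ν^((n+2)/(n-2))`. -/
theorem confLaplacian_factor (hn : 3 ≤ n) (g : RMetric n M) (ν : PosSmooth n M) (p : M) :
    confLaplacian g ν.1 p =
      cn n * scalarCurvature (conformal g ν) p * (factor ν p * ν.1 p) := by
  have hp := mem_extChartAt_source (I := 𝓡 n) p
  have h := (smoothMetricOn_gCoord g p).scalarCoord_conformal hn
    (ν := fun y => ν.1 ((extChartAt (𝓡 n) p).symm y))
    (fun y hy => contDiffAt_comp_chart_symm ν.1.contMDiff p hy) (fun y _ => ν.2 _)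
    (mem_extChartAt_target p)
  rw [confLaplacian, laplacian_eq g ν.1.contMDiff hp, scalarCurvature_eq g hp,
    scalarCurvature_eq (conformal g ν) hp, gCoord_conformal, factor]
  rw [extChartAt_to_inv] at h
  exact h.symm

/-- The inverse `1 / μ` of a positive smooth function. -/
def posInv (μ : PosSmooth n M) : PosSmooth n M :=
  ⟨⟨fun x => (μ.1 x)⁻¹, fun x => μ.1.contMDiff.contMDiffAt.inv₀ (μ.2 x).ne'⟩,
    fun x => inv_pos.2 (μ.2 x)⟩

theorem posInv_apply (μ : PosSmooth n M) (x : M) : (posInv μ).1 x = (μ.1 x)⁻¹ := rfl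

theorem factor_inv (μ : PosSmooth n M) (x : M) : factor (posInv μ) x = (factor μ x)⁻¹ := by
  rw [factor, factor, posInv_apply, Real.inv_rpow (μ.2 x).le]

theorem scalarCurvature_conformal_inv (g : RMetric n M) (μ : PosSmooth n M) (p : M) :
    scalarCurvature (conformal (conformal g μ) (posInv μ)) p = scalarCurvature g p := by
  have h : gCoord (conformal (conformal g μ) (posInv μ)) p = gCoord g p := by
    funext y
    rw [gCoord_conformal, gCoord_conformal]
    simp only [smul_smul, factor_inv]
    rw [inv_mul_cancel₀ (factor_pos μ _).ne', one_smul]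
  rw [scalarCurvature, scalarCurvature, h]

/-- In the metric `μ^(4/(n-2)) g` one has `L (1/μ) = c_n R_g μ^(-4/(n-2)) (1/μ)`. -/
theorem confLaplacian_conformal_inv (hn : 3 ≤ n) (g : RMetric n M) (μ : PosSmooth n M) (p : M) :
    confLaplacian (conformal g μ) (posInv μ).1 p =
      cn n * scalarCurvature g p * ((factor μ p)⁻¹ * (posInv μ).1 p) := by
  rw [confLaplacian_factor hn, scalarCurvature_conformal_inv, factor_inv]

end ChartIndependence

/-! ### The Riemannian measure in charts -/

section RiemannianMeasure

variable {n : ℕ} {M : Type*} [TopologicalSpace M] [ChartedSpace (EuclideanSpace ℝ (Fin n)) M]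
  [IsManifold (𝓡 n) ∞ M] [CompactSpace M] [T2Space M]

theorem chartPartition_tsupport (x : M) :
    tsupport (chartPartition n M x) ⊆ (extChartAt (𝓡 n) x).source := by
  rw [extChartAt_source]
  exact (SmoothPartitionOfUnity.exists_isSubordinate_chartAt_source (𝓡 n) M).choose_spec x

theorem chartPartition_eq_zero {x p : M} (hp : p ∉ (extChartAt (𝓡 n) x).source) :
    chartPartition n M x p = 0 := by
  by_contra h
  exact hp (chartPartition_tsupport x (subset_tsupport _ h))

theorem finite_chartPartition :
    {x : M | (Function.support (chartPartition n M x)).Nonempty}.Finite :=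
  (chartPartition n M).locallyFinite.finite_nonempty_of_compact

/-- The finitely many indices at which the partition of unity does not vanish. -/
def partitionIndex (n : ℕ) (M : Type*) [TopologicalSpace M]
    [ChartedSpace (EuclideanSpace ℝ (Fin n)) M] [IsManifold (𝓡 n) ∞ M]
    [CompactSpace M] [T2Space M] : Finset M :=
  (finite_chartPartition (n := n) (M := M)).toFinset

theorem chartPartition_of_notMem {x : M} (hx : x ∉ partitionIndex n M) (p : M) :
    chartPartition n M x p = 0 := by
  by_contra h
  exact hx ((Set.Finite.mem_toFinset _).2
    (show (Function.support (chartPartition n M x)).Nonempty from ⟨p, h⟩))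

theorem sum_chartPartition (p : M) :
    ∑ x ∈ partitionIndex n M, chartPartition n M x p = 1 := by
  rw [← (chartPartition n M).sum_eq_one (Set.mem_univ p)]
  refine (finsum_eq_sum_of_support_subset _ fun x hx => ?_).symm
  by_contra h
  exact hx (chartPartition_of_notMem h p)

variable [MeasurableSpace M] [BorelSpace M]

/-- The volume density `|g|^(1/2)` in the chart around `x`. -/
def density (g : RMetric n M) (x : M) (y : EuclideanSpace ℝ (Fin n)) : ℝ :=
  Real.sqrt (gCoord g x y).det

theorem density_nonneg (g : RMetric n M) (x : M) (y : EuclideanSpace ℝ (Fin n)) :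
    0 ≤ density g x y := Real.sqrt_nonneg _

theorem continuousOn_density (g : RMetric n M) (x : M) :
    ContinuousOn (density g x) (extChartAt (𝓡 n) x).target := fun _ hy =>
  ((smoothMetricOn_gCoord g x).contDiffAt_sqrt_det hy).continuousAt.continuousWithinAt

theorem measurableSet_target (x : M) : MeasurableSet (extChartAt (𝓡 n) x).target :=
  (isOpen_extChartAt_target x).measurableSet

theorem measurableSet_source (x : M) : MeasurableSet (extChartAt (𝓡 n) x).source :=
  (isOpen_extChartAt_source x).measurableSet

theorem aemeasurable_chart_symm (x : M) :
    AEMeasurable (extChartAt (𝓡 n) x).symm (volume.restrict (extChartAt (𝓡 n) x).target) :=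
  (continuousOn_extChartAt_symm x).aemeasurable (measurableSet_target x)

theorem aemeasurable_ofReal_density (g : RMetric n M) (x : M) :
    AEMeasurable (fun y => ENNReal.ofReal (density g x y))
      (volume.restrict (extChartAt (𝓡 n) x).target) :=
  ((continuousOn_density g x).aemeasurable (measurableSet_target x)).ennreal_ofReal

theorem lintegral_chartVol (g : RMetric n M) (x : M) {f : M → ENNReal} (hf : Measurable f) :
    ∫⁻ p, f p ∂(chartVol g x) = ∫⁻ y in (extChartAt (𝓡 n) x).target,
      ENNReal.ofReal (density g x y) * f ((extChartAt (𝓡 n) x).symm y) := by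
  have h1 := aemeasurable_chart_symm (n := n) x
  rw [chartVol, lintegral_map' hf.aemeasurable (h1.mono_ac (withDensity_absolutelyContinuous _ _))]
  exact lintegral_withDensity_eq_lintegral_mul₀ (aemeasurable_ofReal_density g x)
    (hf.comp_aemeasurable h1)

theorem det_fderiv_eq {ψ : EuclideanSpace ℝ (Fin n) → EuclideanSpace ℝ (Fin n)}
    {z : EuclideanSpace ℝ (Fin n)} (hψ : DifferentiableAt ℝ ψ z) :
    (fderiv ℝ ψ z).det = (jacobianM ψ z).det := by
  rw [ContinuousLinearMap.det, ← LinearMap.det_toMatrix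
    (EuclideanSpace.basisFun (Fin n) ℝ).toBasis]
  congr 1
  ext i j
  rw [LinearMap.toMatrix_apply, jacobianM, Matrix.of_apply, pd_coord hψ]
  simp

theorem injOn_transition (x x' : M) : Set.InjOn (transition n x x') (overlap n x x') := by
  intro z hz w hw h
  have h1 := (extChartAt (𝓡 n) x).injOn hz.2 hw.2 h
  exact (extChartAt (𝓡 n) x').symm.injOn hz.1 hw.1 h1

theorem transition_image (x x' : M) : transition n x x' '' overlap n x x' = overlap n x' x := by
  ext y
  constructor
  · rintro ⟨z, hz, rfl⟩
    refine ⟨(extChartAt (𝓡 n) x).map_source hz.2, ?_⟩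
    rw [Set.mem_preimage, chart_symm_transition hz]
    exact (extChartAt (𝓡 n) x').map_target hz.1
  · intro hy
    have h1 : (extChartAt (𝓡 n) x').symm (transition n x' x y) = (extChartAt (𝓡 n) x).symm y :=
      chart_symm_transition hy
    refine ⟨transition n x' x y, ⟨(extChartAt (𝓡 n) x').map_source hy.2, ?_⟩, ?_⟩
    · rw [Set.mem_preimage, h1]
      exact (extChartAt (𝓡 n) x).map_target hy.1
    · rw [transition, h1]
      exact (extChartAt (𝓡 n) x).right_inv hy.1

theorem indicator_inter_of_mem {α : Type*} {A B : Set α} {f : α → ENNReal} {p : α} (hp : p ∈ A) :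
    (B ∩ A).indicator f p = B.indicator f p := by
  by_cases h : p ∈ B
  · rw [Set.indicator_of_mem (show p ∈ B ∩ A from ⟨h, hp⟩), Set.indicator_of_mem h]
  · rw [Set.indicator_of_notMem fun h' : p ∈ B ∩ A => h h'.1, Set.indicator_of_notMem h]

/-- The measures defined by two charts agree on the overlap. -/
theorem chartVol_inter_source (g : RMetric n M) (x x' : M) {B : Set M} (hB : MeasurableSet B) :
    chartVol g x (B ∩ (extChartAt (𝓡 n) x').source) =
      chartVol g x' (B ∩ (extChartAt (𝓡 n) x).source) := by
  have hset : ∀ a b : M, chartVol g a (B ∩ (extChartAt (𝓡 n) b).source) =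
      ∫⁻ y in overlap n b a, ENNReal.ofReal (density g a y) *
        B.indicator 1 ((extChartAt (𝓡 n) a).symm y) := by
    intro a b
    have hm := hB.inter (measurableSet_source (n := n) b)
    rw [← lintegral_indicator_one hm, lintegral_chartVol g a (measurable_one.indicator hm)]
    have ho : MeasurableSet (overlap n b a) := (isOpen_overlap b a).measurableSet
    rw [← lintegral_indicator (measurableSet_target a), ← lintegral_indicator ho]
    congr 1
    funext y
    by_cases hy : y ∈ (extChartAt (𝓡 n) a).target
    · by_cases hy' : (extChartAt (𝓡 n) a).symm y ∈ (extChartAt (𝓡 n) b).source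
      · have hmem : y ∈ overlap n b a := ⟨hy, hy'⟩
        rw [Set.indicator_of_mem hy, Set.indicator_of_mem hmem, indicator_inter_of_mem hy']
      · rw [Set.indicator_of_mem hy, Set.indicator_of_notMem fun h => hy' h.2,
          Set.indicator_of_notMem fun h : y ∈ overlap n b a => hy' h.2, mul_zero]
    · rw [Set.indicator_of_notMem hy, Set.indicator_of_notMem fun h : y ∈ overlap n b a => hy h.1]
  rw [hset, hset, ← transition_image x x',
    lintegral_image_eq_lintegral_abs_det_fderiv_mul volume (isOpen_overlap x x').measurableSet
      (fun z hz => ((contDiffAt_transition x x' hz).differentiableAt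
        (by simp)).hasFDerivAt.hasFDerivWithinAt) (injOn_transition x x')]
  refine setLIntegral_congr_fun (isOpen_overlap x x').measurableSet fun z hz => ?_
  have hψ := (contDiffAt_transition x x' hz).differentiableAt (by simp)
  have hdens : density g x' z =
      |(fderiv ℝ (transition n x x') z).det| * density g x (transition n x x' z) := by
    rw [det_fderiv_eq hψ, density, density, (isPullback_transition g x x').eq z hz, Matrix.det_mul,
      Matrix.det_mul, Matrix.det_transpose, mul_right_comm, Real.sqrt_mul (mul_self_nonneg _),
      Real.sqrt_mul_self_eq_abs]
  rw [hdens, ENNReal.ofReal_mul (abs_nonneg _), chart_symm_transition hz, mul_assoc]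

theorem restrict_chartVol (g : RMetric n M) (x x' : M) :
    (chartVol g x).restrict (extChartAt (𝓡 n) x').source =
      (chartVol g x').restrict (extChartAt (𝓡 n) x).source := by
  ext B hB
  rw [Measure.restrict_apply hB, Measure.restrict_apply hB, chartVol_inter_source g x x' hB]

/-! ### Gluing with the partition of unity -/

theorem measurable_ofReal_chartPartition (x : M) :
    Measurable fun p => ENNReal.ofReal (chartPartition n M x p) :=
  (chartPartition n M x).contMDiff.continuous.measurable.ennreal_ofReal

theorem vol_eq_sum (g : RMetric n M) : vol g = ∑ x ∈ partitionIndex n M,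
    (chartVol g x).withDensity fun p => ENNReal.ofReal (chartPartition n M x p) := by
  ext B hB
  rw [vol, Measure.sum_apply _ hB, Measure.finsetSum_apply]
  refine tsum_eq_sum fun x hx => ?_
  have h0 : (fun p => ENNReal.ofReal (chartPartition n M x p)) = 0 := by
    funext p
    rw [chartPartition_of_notMem hx, ENNReal.ofReal_zero, Pi.zero_apply]
  rw [h0, withDensity_zero, Measure.coe_zero, Pi.zero_apply]

/-- On the domain of a chart, the Riemannian measure is the measure defined by that chart. -/
theorem restrict_vol (g : RMetric n M) (x : M) :
    (vol g).restrict (extChartAt (𝓡 n) x).source = chartVol g x := by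
  ext B hB
  have hS := measurableSet_source (n := n) x
  rw [Measure.restrict_apply hB, vol_eq_sum, Measure.finsetSum_apply]
  have h1 : ∀ z, ((chartVol g z).withDensity fun p => ENNReal.ofReal (chartPartition n M z p))
      (B ∩ (extChartAt (𝓡 n) x).source) =
      ∫⁻ p in B, ENNReal.ofReal (chartPartition n M z p) ∂(chartVol g x) := by
    intro z
    rw [withDensity_apply _ (hB.inter hS), ← Measure.restrict_restrict hB, restrict_chartVol g z x,
      Measure.restrict_restrict hB, Set.inter_comm, ← Measure.restrict_restrict
      (measurableSet_source z), ← lintegral_indicator (measurableSet_source z)]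
    refine lintegral_congr fun p => ?_
    by_cases hp : p ∈ (extChartAt (𝓡 n) z).source
    · rw [Set.indicator_of_mem hp]
    · rw [Set.indicator_of_notMem hp, chartPartition_eq_zero hp, ENNReal.ofReal_zero]
  simp only [h1]
  rw [← lintegral_finsetSum _ fun z _ => measurable_ofReal_chartPartition z]
  have h2 : ∀ p : M, ∑ z ∈ partitionIndex n M, ENNReal.ofReal (chartPartition n M z p) = 1 := by
    intro p
    rw [← ENNReal.ofReal_sum_of_nonneg fun z _ => (chartPartition n M).nonneg z p,
      sum_chartPartition, ENNReal.ofReal_one]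
  simp only [h2]
  rw [setLIntegral_one]

instance isFiniteMeasure_vol (g : RMetric n M) : IsFiniteMeasure (vol g) := by
  constructor
  rw [vol_eq_sum, Measure.finsetSum_apply]
  refine ENNReal.sum_lt_top.2 fun x _ => ?_
  rw [withDensity_apply _ MeasurableSet.univ, Measure.restrict_univ,
    lintegral_chartVol g x (measurable_ofReal_chartPartition x)]
  set K := extChartAt (𝓡 n) x '' tsupport (chartPartition n M x) with hK
  have hKc : IsCompact K := (isClosed_tsupport _).isCompact.image_of_continuousOn
    ((continuousOn_extChartAt x).mono (chartPartition_tsupport x))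
  have hKT : K ⊆ (extChartAt (𝓡 n) x).target := by
    rintro _ ⟨p, hp, rfl⟩
    exact (extChartAt (𝓡 n) x).map_source (chartPartition_tsupport x hp)
  calc ∫⁻ y in (extChartAt (𝓡 n) x).target, ENNReal.ofReal (density g x y) *
        ENNReal.ofReal (chartPartition n M x ((extChartAt (𝓡 n) x).symm y))
      ≤ ∫⁻ y in (extChartAt (𝓡 n) x).target, K.indicator
          (fun y => ENNReal.ofReal (density g x y)) y := by
        refine setLIntegral_mono_ae' (measurableSet_target x) (Filter.Eventually.of_forall ?_)
        intro y hy
        by_cases h : y ∈ K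
        · rw [Set.indicator_of_mem h]
          refine mul_le_of_le_one_right' ?_
          rw [ENNReal.ofReal_le_one]
          exact (chartPartition n M).le_one x _
        · have h0 : chartPartition n M x ((extChartAt (𝓡 n) x).symm y) = 0 := by
            by_contra h0
            exact h ⟨_, subset_tsupport _ h0, (extChartAt (𝓡 n) x).right_inv hy⟩
          rw [h0, ENNReal.ofReal_zero, mul_zero]
          exact zero_le
    _ = ∫⁻ y in K, ENNReal.ofReal (density g x y) := by
        rw [lintegral_indicator hKc.measurableSet, Measure.restrict_restrict hKc.measurableSet,
          Set.inter_eq_left.2 hKT]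
    _ < ⊤ := by
        have hi : IntegrableOn (density g x) K :=
          ((continuousOn_density g x).mono hKT).integrableOn_compact hKc
        exact hi.lintegral_lt_top

/-- The integral over `M` of a function supported in a chart. -/
theorem integral_vol_eq (g : RMetric n M) (x : M) {f : M → ℝ} (hf : Continuous f)
    (hs : ∀ p ∉ (extChartAt (𝓡 n) x).source, f p = 0) :
    ∫ p, f p ∂(vol g) = ∫ y in (extChartAt (𝓡 n) x).target,
      density g x y * f ((extChartAt (𝓡 n) x).symm y) := by
  rw [← setIntegral_eq_integral_of_forall_compl_eq_zero hs, restrict_vol, chartVol,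
    integral_map ((aemeasurable_chart_symm x).mono_ac (withDensity_absolutelyContinuous _ _))
      hf.aestronglyMeasurable]
  change ∫ y, f ((extChartAt (𝓡 n) x).symm y)
    ∂((volume.restrict (extChartAt (𝓡 n) x).target).withDensity
      fun y => ENNReal.ofReal (density g x y)) = _
  rw [integral_withDensity_eq_integral_toReal_smul₀ (aemeasurable_ofReal_density g x)
    (Filter.Eventually.of_forall fun _ => ENNReal.ofReal_lt_top)]
  refine integral_congr_ae (Filter.Eventually.of_forall fun y => ?_)
  simp only [smul_eq_mul]
  rw [ENNReal.toReal_ofReal (density_nonneg g x y)]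

theorem integrable_of_continuous (g : RMetric n M) {f : M → ℝ} (hf : Continuous f) :
    Integrable f (vol g) :=
  hf.integrable_of_hasCompactSupport (HasCompactSupport.of_compactSpace f)

/-! ### The measure of a conformal metric -/

/-- The volume density of `μ^(4/(n-2)) g` with respect to `g`. -/
def confWeight (μ : PosSmooth n M) (p : M) : ℝ := Real.sqrt (factor μ p ^ n)

theorem confWeight_nonneg (μ : PosSmooth n M) (p : M) : 0 ≤ confWeight μ p := Real.sqrt_nonneg _

theorem continuous_factor (μ : PosSmooth n M) : Continuous (factor μ) :=
  (contMDiff_factor μ).continuous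

theorem continuous_confWeight (μ : PosSmooth n M) : Continuous (confWeight μ) :=
  Real.continuous_sqrt.comp ((continuous_factor μ).pow n)

theorem density_conformal (g : RMetric n M) (μ : PosSmooth n M) (x : M)
    (y : EuclideanSpace ℝ (Fin n)) : density (conformal g μ) x y =
      density g x y * confWeight μ ((extChartAt (𝓡 n) x).symm y) := by
  rw [density, gCoord_conformal, Matrix.det_smul, Fintype.card_fin,
    Real.sqrt_mul (pow_nonneg (factor_pos μ _).le _), mul_comm]
  rfl

theorem chartVol_conformal (g : RMetric n M) (μ : PosSmooth n M) (x : M) :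
    chartVol (conformal g μ) x =
      (chartVol g x).withDensity fun p => ENNReal.ofReal (confWeight μ p) := by
  have hw : Measurable fun p => ENNReal.ofReal (confWeight μ p) :=
    (continuous_confWeight μ).measurable.ennreal_ofReal
  ext B hB
  rw [withDensity_apply _ hB, ← lintegral_indicator hB, ← lintegral_indicator_one hB,
    lintegral_chartVol _ x (measurable_one.indicator hB),
    lintegral_chartVol _ x (hw.indicator hB)]
  refine lintegral_congr fun y => ?_
  rw [density_conformal, ENNReal.ofReal_mul (density_nonneg g x y), mul_assoc]
  congr 1
  by_cases h : (extChartAt (𝓡 n) x).symm y ∈ B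
  · rw [Set.indicator_of_mem h, Set.indicator_of_mem h, Pi.one_apply, mul_one]
  · rw [Set.indicator_of_notMem h, Set.indicator_of_notMem h, mul_zero]

theorem vol_conformal (g : RMetric n M) (μ : PosSmooth n M) :
    vol (conformal g μ) = (vol g).withDensity fun p => ENNReal.ofReal (confWeight μ p) := by
  have hw : Measurable fun p => ENNReal.ofReal (confWeight μ p) :=
    (continuous_confWeight μ).measurable.ennreal_ofReal
  ext B hB
  rw [withDensity_apply _ hB, vol_eq_sum, vol_eq_sum, Measure.finsetSum_apply,
    ← lintegral_indicator hB, lintegral_finsetSum_measure]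
  refine Finset.sum_congr rfl fun x _ => ?_
  have hρ := measurable_ofReal_chartPartition (n := n) x
  rw [chartVol_conformal, ← withDensity_mul _ hw hρ, withDensity_apply _ hB,
    lintegral_indicator hB, restrict_withDensity hB, lintegral_withDensity_eq_lintegral_mul _ hρ hw]
  refine lintegral_congr fun p => ?_
  simp only [Pi.mul_apply]
  rw [mul_comm]

theorem integral_vol_conformal (g : RMetric n M) (μ : PosSmooth n M) (f : M → ℝ) :
    ∫ p, f p ∂(vol (conformal g μ)) = ∫ p, confWeight μ p * f p ∂(vol g) := by
  have hw : Measurable fun p => ENNReal.ofReal (confWeight μ p) :=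
    (continuous_confWeight μ).measurable.ennreal_ofReal
  rw [vol_conformal, integral_withDensity_eq_integral_toReal_smul hw
    (Filter.Eventually.of_forall fun _ => ENNReal.ofReal_lt_top)]
  refine integral_congr_ae (Filter.Eventually.of_forall fun p => ?_)
  simp only [smul_eq_mul]
  rw [ENNReal.toReal_ofReal (confWeight_nonneg μ p)]

/-- The measure of the metric `μ^(4/(n-2)) g` is `μ^(2n/(n-2)) dv_g`. -/
theorem confWeight_mul_sq_inv (hn : 3 ≤ n) (μ : PosSmooth n M) (p : M) :
    confWeight μ p * (posInv μ).1 p ^ 2 = factor μ p := by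
  have hn2 : (n : ℝ) - 2 ≠ 0 := by
    have : (3 : ℝ) ≤ n := by exact_mod_cast hn
    linarith
  have hμ := μ.2 p
  rw [confWeight, Real.sqrt_eq_rpow, posInv_apply, factor, ← Real.rpow_natCast (_ ^ _) n,
    ← Real.rpow_mul hμ.le, ← Real.rpow_mul hμ.le, inv_pow, ← Real.rpow_natCast _ 2,
    ← Real.rpow_neg hμ.le, ← Real.rpow_add hμ]
  congr 1
  push_cast
  field_simp
  ring

end RiemannianMeasure

/-! ### Integration by parts in coordinates -/

section Green

variable {n : ℕ}

theorem integral_pd_eq_zero (i : Fin n) {h : EuclideanSpace ℝ (Fin n) → ℝ} (hh : ContDiff ℝ ∞ h)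
    (hc : HasCompactSupport h) : Integrable (pd i h) ∧ ∫ y, pd i h y = 0 := by
  have hd : Integrable (pd i h) :=
    Continuous.integrable_of_hasCompactSupport
      ((hh.continuous_fderiv (by simp)).clm_apply continuous_const)
      (hc.fderiv_apply (𝕜 := ℝ) (EuclideanSpace.single i 1))
  refine ⟨hd, ?_⟩
  have hi : Integrable h := hh.continuous.integrable_of_hasCompactSupport hc
  have h0 := integral_mul_fderiv_eq_neg_fderiv_mul_of_integrable (μ := volume)
    (f := fun _ : EuclideanSpace ℝ (Fin n) => (1 : ℝ)) (g := h)
    (v := EuclideanSpace.single i (1 : ℝ)) (by simp)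
    (by simp only [one_mul]; exact hd) (by simpa using hi)
    (fun _ _ => differentiableAt_const _) (fun y _ => hh.differentiable (by simp) y)
  simpa [pd] using h0

/-- Green's formula in coordinates, for a function `w` supported in a compact subset of `U`. -/
theorem SmoothMetricOn.integral_green {U K : Set (EuclideanSpace ℝ (Fin n))}
    {G : EuclideanSpace ℝ (Fin n) → Matrix (Fin n) (Fin n) ℝ} (hG : SmoothMetricOn U G)
    (hK : IsCompact K) (hKU : K ⊆ U) {w φ : EuclideanSpace ℝ (Fin n) → ℝ}
    (hw : ∀ y ∈ U, ContDiffAt ℝ ∞ w y) (hφ : ∀ y ∈ U, ContDiffAt ℝ ∞ φ y)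
    (hwK : ∀ y ∉ K, w y = 0) :
    ∫ y in U, Real.sqrt (G y).det * (w y * laplaceCoord G φ y + gradCoord G w φ y) = 0 := by
  set V : Fin n → EuclideanSpace ℝ (Fin n) → ℝ :=
    fun i z => ∑ j, Real.sqrt (G z).det * (G z)⁻¹ i j * pd j φ z with hV
  have hVs : ∀ i, ∀ y ∈ U, ContDiffAt ℝ ∞ (V i) y := fun i y hy =>
    ContDiffAt.sum fun j _ =>
      ((hG.contDiffAt_sqrt_det hy).mul (hG.smoothInv hy i j)).mul (contDiffAt_pd (hφ y hy) j)
  have hzero : ∀ i, ∀ y ∉ K, (fun z => w z * V i z) =ᶠ[𝓝 y] fun _ => 0 := by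
    intro i y hy
    filter_upwards [hK.isClosed.isOpen_compl.mem_nhds hy] with z hz
    rw [hwK z hz, zero_mul]
  have hs : ∀ i, ContDiff ℝ ∞ fun z => w z * V i z := by
    intro i
    rw [contDiff_iff_contDiffAt]
    intro y
    by_cases hy : y ∈ K
    · exact (hw y (hKU hy)).mul (hVs i y (hKU hy))
    · exact contDiffAt_const.congr_of_eventuallyEq (hzero i y hy)
  have hcs : ∀ i, HasCompactSupport fun z => w z * V i z := fun i =>
    HasCompactSupport.intro hK fun y hy => by rw [hwK y hy, zero_mul]
  have hpt : ∀ y ∈ U, Real.sqrt (G y).det * (w y * laplaceCoord G φ y + gradCoord G w φ y) =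
      ∑ i, pd i (fun z => w z * V i z) y := by
    intro y hy
    have h1 : ∀ i, pd i (fun z => w z * V i z) y = pd i w y * V i y + w y * pd i (V i) y :=
      fun i => pd_mul i ((hw y hy).differentiableAt (by simp))
        ((hVs i y hy).differentiableAt (by simp))
    have h2 : Real.sqrt (G y).det * laplaceCoord G φ y = ∑ i, pd i (V i) y := by
      rw [laplaceCoord, ← mul_assoc, mul_inv_cancel₀ (Real.sqrt_pos.2 (hG.det_pos hy)).ne', one_mul]
    have h3 : Real.sqrt (G y).det * gradCoord G w φ y = ∑ i, pd i w y * V i y := by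
      rw [gradCoord, Finset.mul_sum]
      refine Finset.sum_congr rfl fun i _ => ?_
      rw [hV, Finset.mul_sum, Finset.mul_sum]
      exact Finset.sum_congr rfl fun j _ => by ring
    simp only [h1]
    rw [Finset.sum_add_distrib, ← Finset.mul_sum, ← h2, ← h3]
    ring
  rw [setIntegral_congr_fun hG.isOpen.measurableSet hpt,
    setIntegral_eq_integral_of_forall_compl_eq_zero, integral_finsetSum _
      fun i _ => (integral_pd_eq_zero i (hs i) (hcs i)).1]
  · exact Finset.sum_eq_zero fun i _ => (integral_pd_eq_zero i (hs i) (hcs i)).2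
  · intro y hy
    refine Finset.sum_eq_zero fun i _ => ?_
    rw [pd_congr (hzero i y fun h => hy (hKU h)), pd_const]

theorem SmoothMetricOn.laplaceCoord_add {U : Set (EuclideanSpace ℝ (Fin n))}
    {G : EuclideanSpace ℝ (Fin n) → Matrix (Fin n) (Fin n) ℝ} (hG : SmoothMetricOn U G)
    {u v : EuclideanSpace ℝ (Fin n) → ℝ} {y : EuclideanSpace ℝ (Fin n)} (hy : y ∈ U)
    (hu : ContDiffAt ℝ ∞ u y) (hv : ContDiffAt ℝ ∞ v y) :
    laplaceCoord G (fun z => u z + v z) y = laplaceCoord G u y + laplaceCoord G v y := by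
  have hd : ∀ {w : EuclideanSpace ℝ (Fin n) → ℝ}, ContDiffAt ℝ ∞ w y → DifferentiableAt ℝ w y :=
    fun h => h.differentiableAt (by simp)
  have hev : ∀ {w : EuclideanSpace ℝ (Fin n) → ℝ}, ContDiffAt ℝ ∞ w y →
      ∀ᶠ z in 𝓝 y, DifferentiableAt ℝ w z := fun h =>
    ((h.of_le (m := 1) (by simp)).eventually (by simp)).mono fun z hz =>
      hz.differentiableAt (by simp)
  have h2 : ∀ i j, pd i (pd j fun z => u z + v z) y = pd i (pd j u) y + pd i (pd j v) y := by
    intro i j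
    rw [← pd_add i (hd (contDiffAt_pd hu j)) (hd (contDiffAt_pd hv j))]
    refine pd_congr ?_
    filter_upwards [hev hu, hev hv] with z h1 h2 using pd_add j h1 h2
  rw [hG.laplaceCoord_eq hy (hu.add hv), hG.laplaceCoord_eq hy hu, hG.laplaceCoord_eq hy hv,
    ← Finset.sum_add_distrib]
  refine Finset.sum_congr rfl fun i _ => ?_
  rw [← Finset.sum_add_distrib]
  refine Finset.sum_congr rfl fun j _ => ?_
  simp only [hessianM, Matrix.of_apply]
  rw [h2]
  simp only [fun k => pd_add k (hd hu) (hd hv), mul_add, Finset.sum_add_distrib]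
  ring

theorem SmoothMetricOn.laplaceCoord_const_mul {U : Set (EuclideanSpace ℝ (Fin n))}
    {G : EuclideanSpace ℝ (Fin n) → Matrix (Fin n) (Fin n) ℝ} (hG : SmoothMetricOn U G)
    {u : EuclideanSpace ℝ (Fin n) → ℝ} {y : EuclideanSpace ℝ (Fin n)} (hy : y ∈ U) (c : ℝ)
    (hu : ContDiffAt ℝ ∞ u y) :
    laplaceCoord G (fun z => c * u z) y = c * laplaceCoord G u y := by
  have hd : ∀ {w : EuclideanSpace ℝ (Fin n) → ℝ}, ContDiffAt ℝ ∞ w y → DifferentiableAt ℝ w y :=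
    fun h => h.differentiableAt (by simp)
  have h2 : ∀ i j, pd i (pd j fun z => c * u z) y = c * pd i (pd j u) y := by
    intro i j
    rw [← pd_const_mul i c (hd (contDiffAt_pd hu j))]
    refine pd_congr ?_
    filter_upwards [(hu.of_le (m := 1) (by simp)).eventually (by simp)] with z h1 using
      pd_const_mul j c (h1.differentiableAt (by simp))
  rw [hG.laplaceCoord_eq hy (contDiffAt_const.mul hu), hG.laplaceCoord_eq hy hu, Finset.mul_sum]
  refine Finset.sum_congr rfl fun i _ => ?_
  rw [Finset.mul_sum]
  refine Finset.sum_congr rfl fun j _ => ?_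
  simp only [hessianM, Matrix.of_apply]
  rw [h2]
  simp only [fun k => pd_const_mul k c (hd hu), mul_sub, Finset.mul_sum]
  congr 1
  · ring
  · exact Finset.sum_congr rfl fun k _ => by ring

/-! ### Differentials and the Dirichlet form -/

variable {M : Type*} [TopologicalSpace M] [ChartedSpace (EuclideanSpace ℝ (Fin n)) M]
  [IsManifold (𝓡 n) ∞ M]

theorem mdifferentiableAt_smooth (s : C^∞⟮𝓡 n, M; ℝ⟯) (p : M) :
    MDifferentiableAt (𝓡 n) 𝓘(ℝ) s p := s.contMDiff.contMDiffAt.mdifferentiableAt (by simp)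

/-- The differential at `p` as a linear map on smooth functions. -/
def diffLinear (p : M) : C^∞⟮𝓡 n, M; ℝ⟯ →ₗ[ℝ] (TangentSpace (𝓡 n) p →L[ℝ] ℝ) where
  toFun s := diff s p
  map_add' s φ := mfderiv_add (mdifferentiableAt_smooth s p) (mdifferentiableAt_smooth φ p)
  map_smul' c s := const_smul_mfderiv (mdifferentiableAt_smooth s p) c

theorem diff_mul (s φ : C^∞⟮𝓡 n, M; ℝ⟯) (p : M) :
    diffLinear p (s * φ) = s p • diffLinear p φ + φ p • diffLinear p s :=
  ((mdifferentiableAt_smooth s p).hasMFDerivAt.mul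
    (mdifferentiableAt_smooth φ p).hasMFDerivAt).mfderiv

/-- The inner product of covectors at `p` as a bilinear form. -/
def coForm (g : RMetric n M) (p : M) : LinearMap.BilinForm ℝ (TangentSpace (𝓡 n) p →L[ℝ] ℝ) :=
  LinearMap.mk₂ ℝ (coInner g p)
    (fun α α' β => by
      rw [coInner, coInner, coInner, ← Finset.sum_add_distrib]
      refine Finset.sum_congr rfl fun i _ => ?_
      rw [← Finset.sum_add_distrib]
      refine Finset.sum_congr rfl fun j _ => ?_
      change _ * (α _ + α' _) * _ = _
      ring)
    (fun c α β => by
      rw [coInner, coInner, smul_eq_mul, Finset.mul_sum]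
      refine Finset.sum_congr rfl fun i _ => ?_
      rw [Finset.mul_sum]
      refine Finset.sum_congr rfl fun j _ => ?_
      change _ * (c * α _) * _ = _
      ring)
    (fun α β β' => by
      rw [coInner, coInner, coInner, ← Finset.sum_add_distrib]
      refine Finset.sum_congr rfl fun i _ => ?_
      rw [← Finset.sum_add_distrib]
      refine Finset.sum_congr rfl fun j _ => ?_
      change _ * _ * (β _ + β' _) = _
      ring)
    (fun c α β => by
      rw [coInner, coInner, smul_eq_mul, Finset.mul_sum]
      refine Finset.sum_congr rfl fun i _ => ?_
      rw [Finset.mul_sum]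
      refine Finset.sum_congr rfl fun j _ => ?_
      change _ * _ * (c * β _) = _
      ring)

/-- The inner product `⟨ds, dφ⟩` at `p` as a bilinear form on smooth functions. -/
def gradForm (g : RMetric n M) (p : M) : LinearMap.BilinForm ℝ C^∞⟮𝓡 n, M; ℝ⟯ :=
  (coForm g p).compl₁₂ (diffLinear p) (diffLinear p)

theorem gradForm_apply (g : RMetric n M) (p : M) (s φ : C^∞⟮𝓡 n, M; ℝ⟯) :
    gradForm g p s φ = coInner g p (diff s p) (diff φ p) := rfl

theorem continuous_gradForm (g : RMetric n M) (s φ : C^∞⟮𝓡 n, M; ℝ⟯) :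
    Continuous fun p => gradForm g p s φ :=
  (contMDiff_coInner_diff g s.contMDiff φ.contMDiff).continuous

theorem gradForm_eq_zero (g : RMetric n M) {s : C^∞⟮𝓡 n, M; ℝ⟯} {p : M} (hp : p ∉ tsupport s)
    (φ : C^∞⟮𝓡 n, M; ℝ⟯) : gradForm g p s φ = 0 := by
  have h0 : s =ᶠ[𝓝 p] fun _ => (0 : ℝ) := notMem_tsupport_iff_eventuallyEq.1 hp
  have h1 : diffLinear p s = 0 := by
    change mfderiv (𝓡 n) 𝓘(ℝ) s p = 0
    rw [h0.mfderiv_eq, mfderiv_const]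
    rfl
  rw [gradForm, LinearMap.compl₁₂_apply, h1, map_zero, LinearMap.zero_apply]

theorem laplacian_add (g : RMetric n M) (u v : C^∞⟮𝓡 n, M; ℝ⟯) (p : M) :
    laplacian g (u + v : C^∞⟮𝓡 n, M; ℝ⟯) p = laplacian g u p + laplacian g v p := by
  have hp := mem_extChartAt_source (I := 𝓡 n) p
  have hT := mem_extChartAt_target (I := 𝓡 n) p
  rw [laplacian_eq g (u + v).contMDiff hp, laplacian_eq g u.contMDiff hp,
    laplacian_eq g v.contMDiff hp]
  exact (smoothMetricOn_gCoord g p).laplaceCoord_add hT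
    (contDiffAt_comp_chart_symm u.contMDiff p hT) (contDiffAt_comp_chart_symm v.contMDiff p hT)

theorem laplacian_smul (g : RMetric n M) (c : ℝ) (u : C^∞⟮𝓡 n, M; ℝ⟯) (p : M) :
    laplacian g (c • u : C^∞⟮𝓡 n, M; ℝ⟯) p = c * laplacian g u p := by
  have hp := mem_extChartAt_source (I := 𝓡 n) p
  have hT := mem_extChartAt_target (I := 𝓡 n) p
  rw [laplacian_eq g (c • u).contMDiff hp, laplacian_eq g u.contMDiff hp]
  exact (smoothMetricOn_gCoord g p).laplaceCoord_const_mul hT c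
    (contDiffAt_comp_chart_symm u.contMDiff p hT)

/-- The conformal Laplacian as a linear operator on smooth functions. -/
def confLaplacianLinear (g : RMetric n M) : C^∞⟮𝓡 n, M; ℝ⟯ →ₗ[ℝ] C^∞⟮𝓡 n, M; ℝ⟯ where
  toFun s := ⟨confLaplacian g s, contMDiff_confLaplacian g s.contMDiff⟩
  map_add' s φ := by
    ext p
    change -laplacian g (s + φ : C^∞⟮𝓡 n, M; ℝ⟯) p + _ * (s p + φ p) =
      (-laplacian g s p + _) + (-laplacian g φ p + _)
    rw [laplacian_add]
    ring
  map_smul' c s := by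
    ext p
    change -laplacian g (c • s : C^∞⟮𝓡 n, M; ℝ⟯) p + _ * (c * s p) =
      c * (-laplacian g s p + _)
    rw [laplacian_smul]
    ring

/-! ### Green's formula on a closed manifold -/

variable [CompactSpace M] [T2Space M] [MeasurableSpace M] [BorelSpace M]

theorem continuous_laplacian (g : RMetric n M) (φ : C^∞⟮𝓡 n, M; ℝ⟯) :
    Continuous (laplacian g φ) := (contMDiff_laplacian g φ.contMDiff).continuous

/-- Green's formula for a function supported in the domain of a chart. -/
theorem integral_green_chart (g : RMetric n M) (x : M) (s φ : C^∞⟮𝓡 n, M; ℝ⟯)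
    (hs : tsupport s ⊆ (extChartAt (𝓡 n) x).source) :
    ∫ p, (s p * laplacian g φ p + gradForm g p s φ) ∂(vol g) = 0 := by
  classical
  have hcont : Continuous fun p => s p * laplacian g φ p + gradForm g p s φ :=
    (s.contMDiff.continuous.mul (continuous_laplacian g φ)).add (continuous_gradForm g s φ)
  rw [integral_vol_eq g x hcont]
  swap
  · intro p hp
    have hp' : p ∉ tsupport s := fun h => hp (hs h)
    rw [gradForm_eq_zero g hp', image_eq_zero_of_notMem_tsupport hp', zero_mul, add_zero]
  set e := extChartAt (𝓡 n) x with he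
  set w : EuclideanSpace ℝ (Fin n) → ℝ := e.target.indicator fun y => s (e.symm y) with hw
  have hopen : IsOpen e.target := isOpen_extChartAt_target x
  have hws : ∀ y ∈ e.target, w =ᶠ[𝓝 y] fun z => s (e.symm z) := fun y hy =>
    Filter.eventuallyEq_of_mem (hopen.mem_nhds hy) fun z hz => Set.indicator_of_mem hz _
  have hK : IsCompact (e '' tsupport s) :=
    (isClosed_tsupport _).isCompact.image_of_continuousOn
      ((continuousOn_extChartAt x).mono hs)
  have hKT : e '' tsupport s ⊆ e.target := by
    rintro _ ⟨p, hp, rfl⟩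
    exact e.map_source (hs hp)
  have hgreen := (smoothMetricOn_gCoord g x).integral_green hK hKT (w := w)
    (φ := fun y => φ (e.symm y))
    (fun y hy => (contDiffAt_comp_chart_symm s.contMDiff x hy).congr_of_eventuallyEq (hws y hy))
    (fun y hy => contDiffAt_comp_chart_symm φ.contMDiff x hy)
    (fun y hy => by
      by_cases hyT : y ∈ e.target
      · rw [hw, Set.indicator_of_mem hyT]
        by_contra h
        exact hy ⟨e.symm y, subset_tsupport _ h, e.right_inv hyT⟩
      · exact Set.indicator_of_notMem hyT _)
  rw [← hgreen]
  refine setIntegral_congr_fun hopen.measurableSet fun y hy => ?_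
  have hp : e.symm y ∈ (extChartAt (𝓡 n) x).source := e.map_target hy
  rw [gradForm_apply, coInner_diff_eq g s.contMDiff φ.contMDiff hp,
    laplacian_eq g φ.contMDiff hp, ← he, e.right_inv hy,
    gradCoord_congr (hws y hy) (Filter.EventuallyEq.refl _ _), (hws y hy).eq_of_nhds, density]

/-- Green's formula `∫ s Δφ = -∫ ⟨ds, dφ⟩`. -/
theorem integral_green (g : RMetric n M) (s φ : C^∞⟮𝓡 n, M; ℝ⟯) :
    ∫ p, (s p * laplacian g φ p + gradForm g p s φ) ∂(vol g) = 0 := by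
  have hsum : s = ∑ x ∈ partitionIndex n M, chartPartition n M x * s := by
    rw [← Finset.sum_mul]
    ext p
    have h1 : (∑ x ∈ partitionIndex n M, chartPartition n M x : C^∞⟮𝓡 n, M; ℝ⟯) p = 1 := by
      have h2 := map_sum (ContMDiffMap.evalRingHom (I := 𝓡 n) (n := ∞) (I' := 𝓘(ℝ)) p)
        (fun x => chartPartition n M x) (partitionIndex n M)
      exact h2.trans (sum_chartPartition p)
    rw [ContMDiffMap.coe_mul, Pi.mul_apply, h1, one_mul]
  have hpt : ∀ p, s p * laplacian g φ p + gradForm g p s φ =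
      ∑ x ∈ partitionIndex n M, ((chartPartition n M x * s : C^∞⟮𝓡 n, M; ℝ⟯) p *
        laplacian g φ p + gradForm g p (chartPartition n M x * s) φ) := by
    intro p
    have h1 := congrArg (fun r : C^∞⟮𝓡 n, M; ℝ⟯ => gradForm g p r φ) hsum
    simp only [map_sum, LinearMap.sum_apply] at h1
    rw [Finset.sum_add_distrib, ← h1, ← Finset.sum_mul]
    congr 2
    have h2 := map_sum (ContMDiffMap.evalRingHom (I := 𝓡 n) (n := ∞) (I' := 𝓘(ℝ)) p)
      (fun x => chartPartition n M x * s) (partitionIndex n M)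
    exact (congrArg (fun r : C^∞⟮𝓡 n, M; ℝ⟯ => r p) hsum).trans h2
  simp only [hpt]
  rw [integral_finsetSum]
  · refine Finset.sum_eq_zero fun x _ => integral_green_chart g x _ φ ?_
    refine subset_trans ?_ (chartPartition_tsupport x)
    rw [ContMDiffMap.coe_mul]
    exact tsupport_mul_subset_left
  · intro x _
    exact integrable_of_continuous g
      (((chartPartition n M x * s).contMDiff.continuous.mul (continuous_laplacian g φ)).add
        (continuous_gradForm g _ φ))

theorem continuous_scalarCurvature (g : RMetric n M) : Continuous (scalarCurvature g) :=
  (contMDiff_scalarCurvature g).continuous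

/-- The quadratic form of the conformal Laplacian. -/
theorem integral_mul_confLaplacian (g : RMetric n M) (s φ : C^∞⟮𝓡 n, M; ℝ⟯) :
    ∫ p, s p * confLaplacian g φ p ∂(vol g) =
      ∫ p, (gradForm g p s φ + cn n * scalarCurvature g p * (s p * φ p)) ∂(vol g) := by
  have hs := s.contMDiff.continuous
  have hφ := φ.contMDiff.continuous
  have hL : Continuous (confLaplacian g φ) := (contMDiff_confLaplacian g φ.contMDiff).continuous
  have h1 : Integrable (fun p => s p * confLaplacian g φ p) (vol g) :=
    integrable_of_continuous g (hs.mul hL)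
  have h2 : Integrable (fun p => gradForm g p s φ + cn n * scalarCurvature g p * (s p * φ p))
      (vol g) := integrable_of_continuous g ((continuous_gradForm g s φ).add
    ((continuous_const.mul (continuous_scalarCurvature g)).mul (hs.mul hφ)))
  rw [← sub_eq_zero, ← integral_sub h1 h2, ← neg_eq_zero, ← integral_neg, ← integral_green g s φ]
  refine integral_congr_ae (Filter.Eventually.of_forall fun p => ?_)
  simp only [confLaplacian]
  ring

end Green

/-! ### The inner product of covectors -/

section Sobolev

open Filter

variable {n : ℕ} {M : Type*} [TopologicalSpace M] [ChartedSpace (EuclideanSpace ℝ (Fin n)) M]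
  [IsManifold (𝓡 n) ∞ M]

/-- The components of a covector in the standard frame. -/
def frameCoord {p : M} (α : TangentSpace (𝓡 n) p →L[ℝ] ℝ) (i : Fin n) : ℝ :=
  α (EuclideanSpace.single i (1 : ℝ) : EuclideanSpace ℝ (Fin n))

theorem coForm_apply (g : RMetric n M) (p : M) (α β : TangentSpace (𝓡 n) p →L[ℝ] ℝ) :
    coForm g p α β =
      ∑ i, ∑ j, (frameMatrix g p)⁻¹ i j * frameCoord α i * frameCoord β j := rfl

theorem frameMatrix_posDef (g : RMetric n M) (p : M) : (frameMatrix g p).PosDef := by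
  rw [frameMatrix_eq_gCoord]
  exact (smoothMetricOn_gCoord g p).posDef _ (mem_extChartAt_target p)

theorem frameMatrix_transpose (g : RMetric n M) (p : M) :
    (frameMatrix g p).transpose = frameMatrix g p := by
  have := (frameMatrix_posDef g p).isHermitian.eq
  rwa [Matrix.conjTranspose_eq_transpose_of_trivial] at this

theorem coForm_comm (g : RMetric n M) (p : M) (α β : TangentSpace (𝓡 n) p →L[ℝ] ℝ) :
    coForm g p α β = coForm g p β α := by
  have h1 := Matrix.transpose_nonsing_inv (frameMatrix g p)
  rw [frameMatrix_transpose] at h1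
  rw [coForm_apply, coForm_apply, Finset.sum_comm]
  refine Finset.sum_congr rfl fun i _ => Finset.sum_congr rfl fun j _ => ?_
  rw [← congrFun (congrFun h1 j) i, Matrix.transpose_apply]
  ring

theorem coForm_self_nonneg (g : RMetric n M) (p : M) (α : TangentSpace (𝓡 n) p →L[ℝ] ℝ) :
    0 ≤ coForm g p α α := by
  have h := (frameMatrix_posDef g p).inv.posSemidef.dotProduct_mulVec_nonneg (frameCoord α)
  refine h.trans_eq ?_
  rw [coForm_apply]
  simp only [dotProduct, Matrix.mulVec, Finset.mul_sum, star_trivial]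
  exact Finset.sum_congr rfl fun i _ => Finset.sum_congr rfl fun j _ => by ring

theorem coForm_sq_le (g : RMetric n M) (p : M) (α β : TangentSpace (𝓡 n) p →L[ℝ] ℝ) :
    coForm g p α β ^ 2 ≤ coForm g p α α * coForm g p β β := by
  have h := LinearMap.BilinForm.apply_mul_apply_le_of_forall_zero_le (coForm g p)
    (coForm_self_nonneg g p) α β
  rw [coForm_comm g p β α] at h
  nlinarith [h]

/-- A covector is determined by its inner products with the covectors `⟨e_l, ·⟩`. -/
theorem coForm_inner_frame (g : RMetric n M) (p : M) (α : TangentSpace (𝓡 n) p →L[ℝ] ℝ)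
    (l : Fin n) : coForm g p α
      (g.inner p (EuclideanSpace.single l (1 : ℝ) : EuclideanSpace ℝ (Fin n))) =
        frameCoord α l := by
  have hu : IsUnit (frameMatrix g p).det := isUnit_iff_ne_zero.2 (frameMatrix_posDef g p).det_pos.ne'
  have h1 := Matrix.nonsing_inv_mul _ hu
  nth_rewrite 2 [← frameMatrix_transpose] at h1
  have h2 : ∀ i, ∑ j, (frameMatrix g p)⁻¹ i j * frameMatrix g p l j =
      (1 : Matrix (Fin n) (Fin n) ℝ) i l := fun i => by
    rw [← h1, Matrix.mul_apply]
    rfl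
  calc _ = ∑ i, frameCoord α i * ∑ j, (frameMatrix g p)⁻¹ i j * frameMatrix g p l j := by
        rw [coForm_apply]
        refine Finset.sum_congr rfl fun i _ => ?_
        rw [Finset.mul_sum]
        refine Finset.sum_congr rfl fun j _ => ?_
        change _ * frameCoord α i * frameMatrix g p l j = _
        ring
    _ = frameCoord α l := by
        simp only [h2, Matrix.one_apply, mul_ite, mul_one, mul_zero]
        simp

theorem frameCoord_sq_le (g : RMetric n M) (p : M) (l : Fin n) :
    ∃ C, 0 ≤ C ∧ ∀ α : TangentSpace (𝓡 n) p →L[ℝ] ℝ, frameCoord α l ^ 2 ≤ coForm g p α α * C :=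
  ⟨_, coForm_self_nonneg g p _, fun α => by
    rw [← coForm_inner_frame g p α l]
    exact coForm_sq_le g p _ _⟩

theorem exists_frameCoord_eq (p : M) (c : Fin n → ℝ) :
    ∃ α : TangentSpace (𝓡 n) p →L[ℝ] ℝ, ∀ l, frameCoord α l = c l := by
  refine ⟨(∑ i, c i • (EuclideanSpace.proj i : EuclideanSpace ℝ (Fin n) →L[ℝ] ℝ) :
    EuclideanSpace ℝ (Fin n) →L[ℝ] ℝ), fun l => ?_⟩
  change (∑ i, c i • (EuclideanSpace.proj i : EuclideanSpace ℝ (Fin n) →L[ℝ] ℝ) :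
    EuclideanSpace ℝ (Fin n) →L[ℝ] ℝ) (EuclideanSpace.single l (1 : ℝ)) = c l
  simp

/-- The covectors at a point are complete for sequences with weighted summable increments. -/
theorem exists_limit_covector (g : RMetric n M) (p : M) (α : ℕ → TangentSpace (𝓡 n) p →L[ℝ] ℝ)
    (h : Summable fun k => 2 ^ k * coForm g p (α (k + 1) - α k) (α (k + 1) - α k)) :
    ∃ β : TangentSpace (𝓡 n) p →L[ℝ] ℝ, ∀ l,
      Tendsto (fun k => frameCoord (α k) l) atTop (𝓝 (frameCoord β l)) := by
  have hlim : ∀ l, ∃ c, Tendsto (fun k => frameCoord (α k) l) atTop (𝓝 c) := by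
    intro l
    obtain ⟨C, hC, hle⟩ := frameCoord_sq_le g p l
    refine cauchySeq_tendsto_of_complete (cauchySeq_of_summable_dist ?_)
    refine Summable.of_nonneg_of_le (fun _ => dist_nonneg) (fun k => ?_)
      ((h.mul_right C).add summable_geometric_two)
    have h1 := hle (α (k + 1) - α k)
    have h2 : frameCoord (α (k + 1) - α k) l = frameCoord (α (k + 1)) l - frameCoord (α k) l := rfl
    rw [dist_comm, Real.dist_eq, ← h2]
    set x := frameCoord (α (k + 1) - α k) l
    set q := coForm g p (α (k + 1) - α k) (α (k + 1) - α k)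
    have hp : (0 : ℝ) < 2 ^ k := by positivity
    have h3 : (1 / 2 : ℝ) ^ k * 2 ^ k = 1 := by rw [← mul_pow]; norm_num
    have h4 : (0 : ℝ) ≤ (1 / 2) ^ k := by positivity
    -- The arithmetic-geometric mean inequality `|x| ≤ 2^k x² + 2^(-k)`.
    have h5 : |x| ≤ 2 ^ k * x ^ 2 + (1 / 2) ^ k := by
      have h6 : 0 ≤ 2 ^ k * (|x| - (1 / 2) ^ k) ^ 2 := by positivity
      have h7 : 2 ^ k * (|x| - (1 / 2 : ℝ) ^ k) ^ 2 =
          2 ^ k * x ^ 2 - 2 * |x| * ((1 / 2) ^ k * 2 ^ k) + (1 / 2) ^ k * ((1 / 2) ^ k * 2 ^ k) := by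
        rw [← sq_abs x]
        ring
      rw [h7, h3] at h6
      linarith [abs_nonneg x]
    calc |x| ≤ 2 ^ k * x ^ 2 + (1 / 2) ^ k := h5
      _ ≤ 2 ^ k * (q * C) + (1 / 2) ^ k := by gcongr
      _ = 2 ^ k * q * C + (1 / 2) ^ k := by ring
  choose c hc using hlim
  obtain ⟨β, hβ⟩ := exists_frameCoord_eq p c
  exact ⟨β, fun l => by rw [hβ]; exact hc l⟩

theorem tendsto_coForm (g : RMetric n M) (p : M) {α α' : ℕ → TangentSpace (𝓡 n) p →L[ℝ] ℝ}
    {β β' : TangentSpace (𝓡 n) p →L[ℝ] ℝ}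
    (h : ∀ l, Tendsto (fun k => frameCoord (α k) l) atTop (𝓝 (frameCoord β l)))
    (h' : ∀ l, Tendsto (fun k => frameCoord (α' k) l) atTop (𝓝 (frameCoord β' l))) :
    Tendsto (fun k => coForm g p (α k) (α' k)) atTop (𝓝 (coForm g p β β')) := by
  simp only [coForm_apply]
  exact tendsto_finsetSum _ fun i _ => tendsto_finsetSum _ fun j _ =>
    ((h i).const_mul _).mul (h' j)

theorem gradForm_self_nonneg (g : RMetric n M) (p : M) (s : C^∞⟮𝓡 n, M; ℝ⟯) :
    0 ≤ gradForm g p s s := coForm_self_nonneg g p _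

theorem gradForm_comm (g : RMetric n M) (p : M) (s φ : C^∞⟮𝓡 n, M; ℝ⟯) :
    gradForm g p s φ = gradForm g p φ s := coForm_comm g p _ _

/-! ### Weak differentials and Dirichlet-Cauchy sequences -/

variable [CompactSpace M] [T2Space M] [MeasurableSpace M] [BorelSpace M]

/-- The Dirichlet energy `∫ |ds|²`. -/
def dirichlet (g : RMetric n M) (s : C^∞⟮𝓡 n, M; ℝ⟯) : ℝ := ∫ p, gradForm g p s s ∂(vol g)

theorem lintegral_gradForm (g : RMetric n M) (s : C^∞⟮𝓡 n, M; ℝ⟯) :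
    ∫⁻ p, ENNReal.ofReal (gradForm g p s s) ∂(vol g) = ENNReal.ofReal (dirichlet g s) :=
  (ofReal_integral_eq_lintegral_ofReal
    (integrable_of_continuous g (continuous_gradForm g s s))
    (Eventually.of_forall fun p => gradForm_self_nonneg g p s)).symm

theorem dirichlet_nonneg (g : RMetric n M) (s : C^∞⟮𝓡 n, M; ℝ⟯) : 0 ≤ dirichlet g s :=
  integral_nonneg fun p => gradForm_self_nonneg g p s

/-- The triangle inequality in `L²` for the differentials of two smooth functions and a covector
field `η`. The functions `|η - ds|²` need not be measurable, so they are compared with the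
squares of the components of `η - ds` in the direction of `d(s - φ)`. -/
theorem dirichlet_sub_le (g : RMetric n M) {η : ∀ x : M, TangentSpace (𝓡 n) x →L[ℝ] ℝ}
    (hη : ∀ φ : C^∞⟮𝓡 n, M; ℝ⟯, AEMeasurable (fun x => coForm g x (η x) (diffLinear x φ)) (vol g))
    (s φ : C^∞⟮𝓡 n, M; ℝ⟯) :
    ENNReal.ofReal (dirichlet g (s - φ)) ≤
      2 * (∫⁻ x, ENNReal.ofReal
        (coForm g x (η x - diffLinear x s) (η x - diffLinear x s)) ∂(vol g)) +
      2 * ∫⁻ x, ENNReal.ofReal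
        (coForm g x (η x - diffLinear x φ) (η x - diffLinear x φ)) ∂(vol g) := by
  set ψ := s - φ with hψ
  set q : C^∞⟮𝓡 n, M; ℝ⟯ → M → ℝ := fun r x =>
    coForm g x (η x - diffLinear x r) (diffLinear x ψ) ^ 2 / gradForm g x ψ ψ with hq
  have hqm : ∀ r, AEMeasurable (q r) (vol g) := by
    intro r
    have h1 : AEMeasurable (fun x => coForm g x (η x - diffLinear x r) (diffLinear x ψ))
        (vol g) := by
      have h2 := (hη ψ).sub (continuous_gradForm g r ψ).measurable.aemeasurable
      refine h2.congr (Eventually.of_forall fun x => ?_)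
      change _ = coForm g x (η x - diffLinear x r) (diffLinear x ψ)
      rw [map_sub, LinearMap.sub_apply]
      rfl
    exact (h1.pow_const 2).div (continuous_gradForm g ψ ψ).measurable.aemeasurable
  have hqle : ∀ r x, q r x ≤ coForm g x (η x - diffLinear x r) (η x - diffLinear x r) := by
    intro r x
    exact div_le_of_le_mul₀ (gradForm_self_nonneg g x ψ) (coForm_self_nonneg g x _)
      (coForm_sq_le g x _ _)
  have hpt : ∀ x, gradForm g x ψ ψ ≤ 2 * q s x + 2 * q φ x := by
    intro x
    have h0 := gradForm_self_nonneg g x ψ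
    rcases h0.eq_or_lt with h | h
    · have h1 : ∀ r, 0 ≤ q r x := fun r => div_nonneg (sq_nonneg _) h0
      rw [← h]
      linarith [h1 s, h1 φ]
    · have h1 : gradForm g x ψ ψ = coForm g x (η x - diffLinear x φ) (diffLinear x ψ) -
          coForm g x (η x - diffLinear x s) (diffLinear x ψ) := by
        rw [← LinearMap.sub_apply, ← map_sub, sub_sub_sub_cancel_left, ← map_sub]
        rfl
      rw [hq]
      simp only
      rw [← mul_div_assoc, ← mul_div_assoc, ← add_div, le_div_iff₀ h]
      nlinarith [sq_nonneg (coForm g x (η x - diffLinear x φ) (diffLinear x ψ) +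
          coForm g x (η x - diffLinear x s) (diffLinear x ψ)), h1]
  calc ENNReal.ofReal (dirichlet g ψ) = ∫⁻ x, ENNReal.ofReal (gradForm g x ψ ψ) ∂(vol g) :=
        (lintegral_gradForm g ψ).symm
    _ ≤ ∫⁻ x, (2 * ENNReal.ofReal (q s x) + 2 * ENNReal.ofReal (q φ x)) ∂(vol g) := by
        refine lintegral_mono fun x => ?_
        have h2 : ∀ r, 0 ≤ q r x := fun r =>
          div_nonneg (sq_nonneg _) (gradForm_self_nonneg g x ψ)
        have h3 : ∀ r, 2 * ENNReal.ofReal (q r x) = ENNReal.ofReal (2 * q r x) := fun r => by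
          rw [ENNReal.ofReal_mul zero_le_two, ENNReal.ofReal_ofNat]
        rw [h3, h3, ← ENNReal.ofReal_add (by linarith [h2 s]) (by linarith [h2 φ])]
        exact ENNReal.ofReal_le_ofReal (hpt x)
    _ = 2 * (∫⁻ x, ENNReal.ofReal (q s x) ∂(vol g)) +
          2 * ∫⁻ x, ENNReal.ofReal (q φ x) ∂(vol g) := by
        rw [lintegral_add_left' ((hqm s).ennreal_ofReal.const_mul 2),
          lintegral_const_mul'' _ (hqm s).ennreal_ofReal,
          lintegral_const_mul'' _ (hqm φ).ennreal_ofReal]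
    _ ≤ _ := by
        gcongr
        · exact hqle s _
        · exact hqle φ _

/-- A Dirichlet-Cauchy sequence of smooth functions has a limit covector field. -/
theorem exists_limit_diff (g : RMetric n M) {s : ℕ → C^∞⟮𝓡 n, M; ℝ⟯}
    (hs : Tendsto (fun p : ℕ × ℕ => dirichlet g (s p.1 - s p.2)) atTop (𝓝 0)) :
    ∃ η : ∀ x : M, TangentSpace (𝓡 n) x →L[ℝ] ℝ,
      (∀ φ : C^∞⟮𝓡 n, M; ℝ⟯,
        AEMeasurable (fun x => coForm g x (η x) (diffLinear x φ)) (vol g)) ∧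
      Tendsto (fun k => ∫⁻ x, ENNReal.ofReal
        (coForm g x (η x - diffLinear x (s k)) (η x - diffLinear x (s k))) ∂(vol g))
        atTop (𝓝 0) := by
  have hN : ∀ ε > 0, ∃ N, ∀ i ≥ N, ∀ j ≥ N, dirichlet g (s i - s j) < ε := by
    intro ε hε
    obtain ⟨⟨a, b⟩, hab⟩ := eventually_atTop.1 (hs.eventually (gt_mem_nhds hε))
    exact ⟨max a b, fun i hi j hj => hab (i, j)
      ⟨(le_max_left _ _).trans hi, (le_max_right _ _).trans hj⟩⟩
  have hchoose : ∀ k : ℕ, ∃ N, ∀ i ≥ N, ∀ j ≥ N, dirichlet g (s i - s j) < (1 / 4) ^ k :=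
    fun k => hN _ (by positivity)
  choose N hNk using hchoose
  -- A subsequence along which the energies of the increments decay geometrically.
  set m : ℕ → ℕ := fun k => (∑ i ∈ Finset.range (k + 1), N i) + k with hm
  have hmN : ∀ k, N k ≤ m k := fun k =>
    (Finset.single_le_sum (f := N) (fun _ _ => Nat.zero_le _)
      (Finset.mem_range.2 (Nat.lt_succ_self k))).trans (Nat.le_add_right _ _)
  have hmono : ∀ k, m k ≤ m (k + 1) := fun k => by
    rw [hm]
    simp only [Finset.sum_range_succ _ (k + 1)]
    omega
  have hmtop : Tendsto m atTop atTop :=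
    tendsto_atTop_mono (fun k => Nat.le_add_left _ _) tendsto_id
  set d : ℕ → C^∞⟮𝓡 n, M; ℝ⟯ := fun k => s (m (k + 1)) - s (m k) with hd
  have hdle : ∀ k, dirichlet g (d k) ≤ (1 / 4) ^ k := fun k =>
    (hNk k _ ((hmN k).trans (hmono k)) _ (hmN k)).le
  have hcd : ∀ k, Continuous fun x => (2 : ℝ) ^ k * gradForm g x (d k) (d k) := fun k =>
    continuous_const.mul (continuous_gradForm g _ _)
  have hsum : ∀ᵐ x ∂(vol g), Summable fun k => 2 ^ k * gradForm g x (d k) (d k) := by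
    have h1 : ∫⁻ x, ∑' k, ENNReal.ofReal (2 ^ k * gradForm g x (d k) (d k)) ∂(vol g) ≠ ⊤ := by
      rw [lintegral_tsum fun k => (hcd k).measurable.ennreal_ofReal.aemeasurable]
      have h2 : ∀ k, ∫⁻ x, ENNReal.ofReal (2 ^ k * gradForm g x (d k) (d k)) ∂(vol g) ≤
          ENNReal.ofReal ((1 / 2) ^ k) := by
        intro k
        simp only [ENNReal.ofReal_mul (show (0 : ℝ) ≤ 2 ^ k by positivity)]
        rw [lintegral_const_mul' _ _ ENNReal.ofReal_ne_top, lintegral_gradForm,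
          ← ENNReal.ofReal_mul (by positivity)]
        refine ENNReal.ofReal_le_ofReal ((mul_le_mul_of_nonneg_left (hdle k)
          (by positivity)).trans_eq ?_)
        rw [← mul_pow]
        norm_num
      refine ne_top_of_le_ne_top ?_ (ENNReal.tsum_le_tsum h2)
      rw [← ENNReal.ofReal_tsum_of_nonneg (fun k => by positivity) summable_geometric_two]
      exact ENNReal.ofReal_ne_top
    have h3 := ae_lt_top' (AEMeasurable.tsum fun k =>
      (hcd k).measurable.ennreal_ofReal.aemeasurable) h1
    filter_upwards [h3] with x hx
    have h4 := ENNReal.summable_toReal hx.ne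
    refine h4.congr fun k => ?_
    rw [ENNReal.toReal_ofReal]
    exact mul_nonneg (by positivity) (gradForm_self_nonneg g x _)
  classical
  set P : ∀ x : M, (TangentSpace (𝓡 n) x →L[ℝ] ℝ) → Prop := fun x β => ∀ l,
    Tendsto (fun k => frameCoord (diffLinear x (s (m k))) l) atTop (𝓝 (frameCoord β l)) with hP
  set η : ∀ x : M, TangentSpace (𝓡 n) x →L[ℝ] ℝ := fun x =>
    if h : ∃ β, P x β then h.choose else 0 with hη
  have hlim : ∀ᵐ x ∂(vol g), P x (η x) := by
    filter_upwards [hsum] with x hx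
    have h1 : ∃ β, P x β := by
      refine exists_limit_covector g x (fun k => diffLinear x (s (m k))) (hx.congr fun k => ?_)
      rw [gradForm, LinearMap.compl₁₂_apply, hd]
      simp only [map_sub]
    rw [hη]
    simp only
    rw [dif_pos h1]
    exact h1.choose_spec
  refine ⟨η, fun φ => ?_, ?_⟩
  · refine aemeasurable_of_tendsto_metrizable_ae atTop
      (f := fun k x => gradForm g x (s (m k)) φ)
      (fun k => (continuous_gradForm g _ _).measurable.aemeasurable) ?_
    filter_upwards [hlim] with x hx
    exact tendsto_coForm g x hx fun l => tendsto_const_nhds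
  · rw [ENNReal.tendsto_atTop_zero]
    intro ε hε
    obtain ⟨δ, hδ, hδε⟩ : ∃ δ : ℝ, 0 < δ ∧ ENNReal.ofReal δ ≤ ε := by
      rcases eq_or_ne ε ⊤ with rfl | h
      · exact ⟨1, one_pos, le_top⟩
      · exact ⟨ε.toReal, ENNReal.toReal_pos hε.ne' h, ENNReal.ofReal_toReal h |>.le⟩
    obtain ⟨K, hK⟩ := hN δ hδ
    refine ⟨K, fun k hk => le_trans ?_ hδε⟩
    have h1 : ∀ᵐ x ∂(vol g), Tendsto
        (fun i => ENNReal.ofReal (gradForm g x (s (m i) - s k) (s (m i) - s k))) atTop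
        (𝓝 (ENNReal.ofReal
          (coForm g x (η x - diffLinear x (s k)) (η x - diffLinear x (s k))))) := by
      filter_upwards [hlim] with x hx
      refine (ENNReal.continuous_ofReal.tendsto _).comp ?_
      have h2 : ∀ l, Tendsto (fun i => frameCoord (diffLinear x (s (m i) - s k)) l) atTop
          (𝓝 (frameCoord (η x - diffLinear x (s k)) l)) := by
        intro l
        have h3 := (hx l).sub (tendsto_const_nhds (x := frameCoord (diffLinear x (s k)) l))
        simp only [map_sub]
        exact h3
      exact tendsto_coForm g x h2 h2
    calc ∫⁻ x, ENNReal.ofReal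
          (coForm g x (η x - diffLinear x (s k)) (η x - diffLinear x (s k))) ∂(vol g)
        = ∫⁻ x, liminf (fun i => ENNReal.ofReal
            (gradForm g x (s (m i) - s k) (s (m i) - s k))) atTop ∂(vol g) := by
          refine lintegral_congr_ae ?_
          filter_upwards [h1] with x hx using hx.liminf_eq.symm
      _ ≤ liminf (fun i => ∫⁻ x, ENNReal.ofReal
            (gradForm g x (s (m i) - s k) (s (m i) - s k)) ∂(vol g)) atTop :=
          lintegral_liminf_le fun i => (continuous_gradForm g _ _).measurable.ennreal_ofReal
      _ ≤ ENNReal.ofReal δ := by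
          refine liminf_le_of_frequently_le' (Eventually.frequently ?_)
          filter_upwards [hmtop.eventually_ge_atTop K] with i hi
          rw [lintegral_gradForm]
          exact ENNReal.ofReal_le_ofReal (hK _ hi _ hk).le

/-- Functions with a weak differential are the limits in `L²` of Dirichlet-Cauchy sequences of
smooth functions. -/
theorem exists_hasWeakDiff_iff (g : RMetric n M) {u : M → ℝ} (hu : AEMeasurable u (vol g)) :
    (∃ η, HasWeakDiff g u η) ↔ ∃ s : ℕ → C^∞⟮𝓡 n, M; ℝ⟯,
      Tendsto (fun k => ∫⁻ x, ENNReal.ofReal ((u x - s k x) ^ 2) ∂(vol g)) atTop (𝓝 0) ∧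
      Tendsto (fun p : ℕ × ℕ => dirichlet g (s p.1 - s p.2)) atTop (𝓝 0) := by
  constructor
  · rintro ⟨η, -, hη, s, hs⟩
    have h2 := tendsto_of_tendsto_of_tendsto_of_le_of_le tendsto_const_nhds hs
      (fun _ => zero_le) (fun _ => le_add_self)
    refine ⟨s, tendsto_of_tendsto_of_tendsto_of_le_of_le tendsto_const_nhds hs
      (fun _ => zero_le) (fun _ => le_self_add), ?_⟩
    have h3 : Tendsto (fun p : ℕ × ℕ => ENNReal.ofReal (dirichlet g (s p.1 - s p.2))) atTop
        (𝓝 0) := by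
      have h4 := ((ENNReal.Tendsto.const_mul (a := 2) h2 (Or.inr (by simp))).comp
        (tendsto_fst (f := atTop) (g := (atTop : Filter ℕ)))).add
        ((ENNReal.Tendsto.const_mul (a := 2) h2 (Or.inr (by simp))).comp
        (tendsto_snd (f := (atTop : Filter ℕ)) (g := atTop)))
      rw [prod_atTop_atTop_eq, mul_zero, add_zero] at h4
      exact tendsto_of_tendsto_of_tendsto_of_le_of_le tendsto_const_nhds h4
        (fun _ => zero_le) fun p => dirichlet_sub_le g hη (s p.1) (s p.2)
    have h5 := (ENNReal.tendsto_toReal ENNReal.zero_ne_top).comp h3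
    refine h5.congr fun p => ?_
    exact ENNReal.toReal_ofReal (dirichlet_nonneg g _)
  · rintro ⟨s, h1, h2⟩
    obtain ⟨η, hη, hlim⟩ := exists_limit_diff g h2
    refine ⟨η, hu, hη, s, ?_⟩
    have h3 := h1.add hlim
    rw [add_zero] at h3
    exact h3

end Sobolev

/-! ### The first eigenvalue as an infimum of Rayleigh quotients -/

section FirstEigenvalue

open Filter

variable {n : ℕ} {M : Type*} [TopologicalSpace M] [ChartedSpace (EuclideanSpace ℝ (Fin n)) M]
  [IsManifold (𝓡 n) ∞ M] [CompactSpace M] [T2Space M] [MeasurableSpace M] [BorelSpace M]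

/-- The class in `L²(M, g)` of a smooth function. -/
def smoothToLp (g : RMetric n M) : C^∞⟮𝓡 n, M; ℝ⟯ →ₗ[ℝ] Lp ℝ 2 (vol g) :=
  (ContinuousMap.toLp (E := ℝ) 2 (vol g) ℝ).toLinearMap ∘ₗ
    { toFun := fun s => (⟨s, s.contMDiff.continuous⟩ : C(M, ℝ))
      map_add' := fun _ _ => rfl
      map_smul' := fun _ _ => rfl }

/-- The conformal Laplacian on smooth functions, with values in `L²(M, g)`. -/
def confLaplacianToLp (g : RMetric n M) : C^∞⟮𝓡 n, M; ℝ⟯ →ₗ[ℝ] Lp ℝ 2 (vol g) :=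
  smoothToLp g ∘ₗ confLaplacianLinear g

theorem coeFn_smoothToLp (g : RMetric n M) (s : C^∞⟮𝓡 n, M; ℝ⟯) :
    smoothToLp g s =ᵐ[vol g] s :=
  ContinuousMap.coeFn_toLp (𝕜 := ℝ) (vol g) (⟨s, s.contMDiff.continuous⟩ : C(M, ℝ))

theorem inner_smoothToLp (g : RMetric n M) (u : Lp ℝ 2 (vol g)) (s : C^∞⟮𝓡 n, M; ℝ⟯) :
    inner ℝ u (smoothToLp g s) = ∫ x, u x * s x ∂(vol g) := by
  rw [L2.inner_def]
  refine integral_congr_ae ?_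
  filter_upwards [coeFn_smoothToLp g s] with x hx
  rw [hx]
  simp [mul_comm]

theorem inner_confLaplacianToLp (g : RMetric n M) (u : Lp ℝ 2 (vol g)) (s : C^∞⟮𝓡 n, M; ℝ⟯) :
    inner ℝ u (confLaplacianToLp g s) = ∫ x, u x * confLaplacian g s x ∂(vol g) :=
  inner_smoothToLp g u (confLaplacianLinear g s)

theorem inner_smoothToLp_confLaplacianToLp (g : RMetric n M) (s φ : C^∞⟮𝓡 n, M; ℝ⟯) :
    inner ℝ (smoothToLp g s) (confLaplacianToLp g φ) =
      ∫ x, s x * confLaplacian g φ x ∂(vol g) := by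
  rw [inner_confLaplacianToLp]
  refine integral_congr_ae ?_
  filter_upwards [coeFn_smoothToLp g s] with x hx
  rw [hx]

theorem norm_smoothToLp_sq (g : RMetric n M) (s : C^∞⟮𝓡 n, M; ℝ⟯) :
    ‖smoothToLp g s‖ ^ 2 = ∫ x, s x ^ 2 ∂(vol g) := by
  rw [← real_inner_self_eq_norm_sq, inner_smoothToLp]
  refine integral_congr_ae ?_
  filter_upwards [coeFn_smoothToLp g s] with x hx
  rw [hx, sq]

theorem lintegral_sub_sq (g : RMetric n M) (u : Lp ℝ 2 (vol g)) (s : C^∞⟮𝓡 n, M; ℝ⟯) :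
    ∫⁻ x, ENNReal.ofReal ((u x - s x) ^ 2) ∂(vol g) =
      ENNReal.ofReal (‖u - smoothToLp g s‖ ^ 2) := by
  have h1 := L2.integrable_inner (𝕜 := ℝ) (u - smoothToLp g s) (u - smoothToLp g s)
  rw [← real_inner_self_eq_norm_sq, L2.inner_def,
    ofReal_integral_eq_lintegral_ofReal h1 (Eventually.of_forall fun x => real_inner_self_nonneg)]
  refine lintegral_congr_ae ?_
  filter_upwards [Lp.coeFn_sub u (smoothToLp g s), coeFn_smoothToLp g s] with x h2 h3
  rw [h2, Pi.sub_apply, h3, real_inner_self_eq_norm_sq, Real.norm_eq_abs, sq_abs]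

theorem tendsto_smoothToLp_iff (g : RMetric n M) (u : Lp ℝ 2 (vol g))
    (s : ℕ → C^∞⟮𝓡 n, M; ℝ⟯) :
    Tendsto (fun k => ∫⁻ x, ENNReal.ofReal ((u x - s k x) ^ 2) ∂(vol g)) atTop (𝓝 0) ↔
      Tendsto (fun k => smoothToLp g (s k)) atTop (𝓝 u) := by
  simp only [lintegral_sub_sq]
  rw [tendsto_iff_norm_sub_tendsto_zero]
  simp only [fun k => norm_sub_rev (smoothToLp g (s k)) u]
  constructor
  · intro h
    have h1 := (Real.continuous_sqrt.tendsto _).comp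
      ((ENNReal.tendsto_toReal ENNReal.zero_ne_top).comp h)
    rw [ENNReal.toReal_zero, Real.sqrt_zero] at h1
    refine h1.congr fun k => ?_
    simp only [Function.comp_apply]
    rw [ENNReal.toReal_ofReal (sq_nonneg _), Real.sqrt_sq (norm_nonneg _)]
  · intro h
    have h1 := (ENNReal.continuous_ofReal.tendsto _).comp (h.pow 2)
    rw [zero_pow two_ne_zero, ENNReal.ofReal_zero] at h1
    exact h1

/-- The zeroth order term of the conformal Laplacian is bounded on a closed manifold. -/
theorem exists_bound_potential (g : RMetric n M) : ∃ B, ∀ s : C^∞⟮𝓡 n, M; ℝ⟯,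
    |∫ x, s x * confLaplacian g s x ∂(vol g) - dirichlet g s| ≤ B * ‖smoothToLp g s‖ ^ 2 := by
  obtain ⟨B, hB⟩ := isCompact_univ.exists_bound_of_continuousOn
    ((continuous_const.mul (continuous_scalarCurvature g)).continuousOn
      (s := Set.univ) : ContinuousOn (fun x => cn n * scalarCurvature g x) Set.univ)
  refine ⟨B, fun s => ?_⟩
  have hs := s.contMDiff.continuous
  have h1 := integrable_of_continuous g (continuous_gradForm g s s)
  have h2 : Integrable (fun p => cn n * scalarCurvature g p * (s p * s p)) (vol g) :=
    integrable_of_continuous g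
      ((continuous_const.mul (continuous_scalarCurvature g)).mul (hs.mul hs))
  rw [integral_mul_confLaplacian, integral_add h1 h2, dirichlet, add_sub_cancel_left,
    norm_smoothToLp_sq, ← integral_const_mul]
  refine norm_integral_le_of_norm_le (f := fun p => cn n * scalarCurvature g p * (s p * s p))
    ((integrable_of_continuous g (hs.pow 2)).const_mul B) (Eventually.of_forall fun x => ?_)
  have h3 := hB x (Set.mem_univ x)
  rw [norm_mul, ← sq, Real.norm_of_nonneg (sq_nonneg (s x))]
  exact mul_le_mul_of_nonneg_right h3 (sq_nonneg _)

/-- The form domain of `L_g` on `C^∞(M)` is `W^{1,2}(M, g)`: as the potential is bounded, Cauchy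
sequences for the form which converge in `L²` are the Dirichlet-Cauchy sequences. -/
theorem formDomain_iff (g : RMetric n M) (u : Lp ℝ 2 (vol g)) :
    FormOperator.FormDomain (smoothToLp g) (confLaplacianToLp g) u ↔
      ∃ η, HasWeakDiff g u η := by
  rw [exists_hasWeakDiff_iff g (Lp.aestronglyMeasurable u).aemeasurable]
  obtain ⟨B, hB⟩ := exists_bound_potential g
  refine exists_congr fun s => ?_
  rw [tendsto_smoothToLp_iff]
  refine and_congr_right fun hs => ?_
  have h0 : Tendsto (fun p : ℕ × ℕ => B * ‖smoothToLp g (s p.1 - s p.2)‖ ^ 2) atTop (𝓝 0) := by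
    have h1 := (hs.comp (tendsto_fst (f := atTop) (g := (atTop : Filter ℕ)))).sub
      (hs.comp (tendsto_snd (f := (atTop : Filter ℕ)) (g := atTop)))
    rw [prod_atTop_atTop_eq, sub_self] at h1
    have h2 := (h1.norm.pow 2).const_mul B
    rw [norm_zero, zero_pow two_ne_zero, mul_zero] at h2
    refine h2.congr fun p => ?_
    rw [map_sub]
    rfl
  have h1 : Tendsto (fun p : ℕ × ℕ =>
      FormOperator.shiftedForm (smoothToLp g) (confLaplacianToLp g) 0 (s p.1 - s p.2)
        (s p.1 - s p.2) - dirichlet g (s p.1 - s p.2)) atTop (𝓝 0) := by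
    refine squeeze_zero_norm (fun p => ?_) h0
    rw [FormOperator.shiftedForm_self, zero_mul, sub_zero, inner_smoothToLp_confLaplacianToLp]
    exact hB _
  constructor
  · intro h
    have h2 := h.sub h1
    rw [sub_zero] at h2
    exact h2.congr fun p => sub_sub_cancel _ _
  · intro h
    have h2 := h1.add h
    rw [add_zero] at h2
    exact h2.congr fun p => sub_add_cancel _ _

/-- The self-adjoint realization of `L_g` is the Friedrichs extension of `L_g` on `C^∞(M)`. -/
theorem inGraph_iff (g : RMetric n M) (u f : Lp ℝ 2 (vol g)) :
    FormOperator.InGraph (smoothToLp g) (confLaplacianToLp g) u f ↔ IsConfLaplacian g u f := by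
  rw [FormOperator.InGraph, IsConfLaplacian, formDomain_iff]
  refine and_congr_right fun _ => forall_congr' fun φ => ?_
  rw [inner_confLaplacianToLp, inner_smoothToLp]

theorem spec_eq (g : RMetric n M) :
    spec g = FormOperator.spectrum (smoothToLp g) (confLaplacianToLp g) := by
  simp only [spec, FormOperator.spectrum, inGraph_iff]

theorem integral_pos_of_pos [Nonempty M] (g : RMetric n M) {f : M → ℝ} (hf : Continuous f)
    (hpos : ∀ x, 0 < f x) : 0 < ∫ x, f x ∂(vol g) := by
  rw [integral_pos_iff_support_of_nonneg (fun x => (hpos x).le) (integrable_of_continuous g hf)]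
  have hs : Function.support f = Set.univ := Set.eq_univ_of_forall fun x => (hpos x).ne'
  rw [hs]
  obtain ⟨x⟩ := ‹Nonempty M›
  refine lt_of_lt_of_le ?_ (measure_mono (Set.subset_univ (extChartAt (𝓡 n) x).source))
  rw [← Measure.restrict_apply_univ, restrict_vol, ← setLIntegral_one, Measure.restrict_univ,
    lintegral_chartVol g x measurable_const]
  have hm := aemeasurable_ofReal_density g x
  rw [pos_iff_ne_zero, Ne]
  simp only [mul_one]
  rw [lintegral_eq_zero_iff' hm]
  intro h0
  have hvol : volume (extChartAt (𝓡 n) x).target ≠ 0 :=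
    ((isOpen_extChartAt_target x).measure_pos _ ⟨_, mem_extChartAt_target x⟩).ne'
  refine hvol ?_
  rw [Filter.EventuallyEq, ae_restrict_iff' (measurableSet_target x)] at h0
  refine measure_mono_null (fun y hy => ?_) h0
  intro h
  have h1 := h hy
  simp only [Pi.zero_apply, ENNReal.ofReal_eq_zero] at h1
  exact absurd (Real.sqrt_pos.2 ((smoothMetricOn_gCoord g x).det_pos hy)) (not_lt.2 h1)

/-- The first eigenvalue is the infimum of the Rayleigh quotients of smooth functions. -/
theorem lambda1_eq [Nonempty M] (g : RMetric n M) :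
    lambda1 g = sInf {q | ∃ s : C^∞⟮𝓡 n, M; ℝ⟯, smoothToLp g s ≠ 0 ∧
      q = (∫ x, s x * confLaplacian g s x ∂(vol g)) / ∫ x, s x ^ 2 ∂(vol g)} := by
  obtain ⟨B, hB⟩ := exists_bound_potential g
  have h := FormOperator.sInf_spectrum (ι := smoothToLp g) (A := confLaplacianToLp g)
    (fun s φ => by
      rw [inner_smoothToLp_confLaplacianToLp, inner_smoothToLp_confLaplacianToLp,
        integral_mul_confLaplacian, integral_mul_confLaplacian]
      refine integral_congr_ae (Eventually.of_forall fun x => ?_)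
      simp only
      rw [gradForm_comm, mul_comm (s x)])
    (C := -B) (fun s => by
      rw [inner_smoothToLp_confLaplacianToLp]
      have h1 := (abs_le.1 (hB s)).1
      linarith [dirichlet_nonneg g s])
    ⟨1, fun h => by
      have h1 := norm_smoothToLp_sq g 1
      rw [h, norm_zero, zero_pow two_ne_zero] at h1
      have h2 := integral_pos_of_pos g (f := fun x => (1 : C^∞⟮𝓡 n, M; ℝ⟯) x ^ 2)
        ((1 : C^∞⟮𝓡 n, M; ℝ⟯).contMDiff.continuous.pow 2) fun x => by
          rw [ContMDiffMap.coe_one]; simp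
      exact h2.ne h1⟩
  rw [lambda1, spec_eq, h]
  simp only [inner_smoothToLp_confLaplacianToLp, norm_smoothToLp_sq]

theorem smoothToLp_ne_zero_iff (g : RMetric n M) (s : C^∞⟮𝓡 n, M; ℝ⟯) :
    smoothToLp g s ≠ 0 ↔ 0 < ∫ x, s x ^ 2 ∂(vol g) := by
  rw [← norm_smoothToLp_sq, ← norm_pos_iff]
  exact ⟨fun h => by positivity, fun h =>
    (norm_nonneg _).lt_of_ne' fun h0 => by simp [h0] at h⟩

theorem lambda1_le [Nonempty M] (g : RMetric n M) {s : C^∞⟮𝓡 n, M; ℝ⟯}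
    (hs : 0 < ∫ x, s x ^ 2 ∂(vol g)) :
    lambda1 g ≤ (∫ x, s x * confLaplacian g s x ∂(vol g)) / ∫ x, s x ^ 2 ∂(vol g) := by
  obtain ⟨B, hB⟩ := exists_bound_potential g
  rw [lambda1_eq]
  refine csInf_le ⟨-B, ?_⟩ ⟨s, (smoothToLp_ne_zero_iff g s).2 hs, rfl⟩
  rintro _ ⟨φ, hφ, rfl⟩
  rw [smoothToLp_ne_zero_iff] at hφ
  rw [le_div_iff₀ hφ, ← norm_smoothToLp_sq]
  linarith [(abs_le.1 (hB φ)).1, dirichlet_nonneg g φ]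

theorem le_lambda1 [Nonempty M] (g : RMetric n M) {q : ℝ}
    (hq : ∀ s : C^∞⟮𝓡 n, M; ℝ⟯,
      q * ∫ x, s x ^ 2 ∂(vol g) ≤ ∫ x, s x * confLaplacian g s x ∂(vol g)) :
    q ≤ lambda1 g := by
  rw [lambda1_eq]
  refine le_csInf ⟨_, 1, (smoothToLp_ne_zero_iff g 1).2 ?_, rfl⟩ ?_
  · exact integral_pos_of_pos g (f := fun x => (1 : C^∞⟮𝓡 n, M; ℝ⟯) x ^ 2)
      ((1 : C^∞⟮𝓡 n, M; ℝ⟯).contMDiff.continuous.pow 2) fun x => by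
        rw [ContMDiffMap.coe_one]; simp
  · rintro _ ⟨s, hs, rfl⟩
    rw [smoothToLp_ne_zero_iff] at hs
    exact (le_div_iff₀ hs).2 (hq s)

/-! ### Positive eigenfunctions -/

theorem gradForm_mul (g : RMetric n M) (p : M) (a b φ : C^∞⟮𝓡 n, M; ℝ⟯) :
    gradForm g p (a * b) φ = a p * gradForm g p b φ + b p * gradForm g p a φ := by
  simp only [gradForm, LinearMap.compl₁₂_apply, diff_mul, map_add, map_smul, LinearMap.add_apply,
    LinearMap.smul_apply, smul_eq_mul]

/-- Jacobi's identity `|d(νw)|² = ν² |dw|² + ⟨d(w² ν), dν⟩`. -/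
theorem gradForm_jacobi (g : RMetric n M) (p : M) (ν w : C^∞⟮𝓡 n, M; ℝ⟯) :
    gradForm g p (ν * w) (ν * w) =
      ν p ^ 2 * gradForm g p w w + gradForm g p (w * w * ν) ν := by
  rw [gradForm_mul, gradForm_comm g p w (ν * w), gradForm_comm g p ν (ν * w), gradForm_mul,
    gradForm_mul, gradForm_mul, gradForm_mul, ContMDiffMap.coe_mul, Pi.mul_apply,
    gradForm_comm g p ν w]
  ring

/-- An eigenvalue with a positive eigenfunction `ν` is a lower bound of the spectrum: write the
test function as `s = ν w` and use Jacobi's identity. -/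
theorem le_lambda1_of_eigenfunction [Nonempty M] (g : RMetric n M) (ν : PosSmooth n M) {q : ℝ}
    (hν : ∀ p, confLaplacian g ν.1 p = q * ν.1 p) : q ≤ lambda1 g := by
  refine le_lambda1 g fun s => ?_
  set w : C^∞⟮𝓡 n, M; ℝ⟯ := s * (posInv ν).1 with hw
  have hs : s = ν.1 * w := by
    ext p
    rw [hw, ContMDiffMap.coe_mul, ContMDiffMap.coe_mul, Pi.mul_apply, Pi.mul_apply, posInv_apply]
    field_simp [(ν.2 p).ne']
  have hψ : ∀ p, (w * w * ν.1 : C^∞⟮𝓡 n, M; ℝ⟯) p * ν.1 p = s p ^ 2 := by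
    intro p
    have h0 : s p = ν.1 p * w p := congrArg (fun r : C^∞⟮𝓡 n, M; ℝ⟯ => r p) hs
    rw [h0, ContMDiffMap.coe_mul, ContMDiffMap.coe_mul]
    simp only [Pi.mul_apply]
    ring
  have h1 : q * ∫ x, s x ^ 2 ∂(vol g) =
      ∫ x, (w * w * ν.1 : C^∞⟮𝓡 n, M; ℝ⟯) x * confLaplacian g ν.1 x ∂(vol g) := by
    rw [← integral_const_mul]
    refine integral_congr_ae (Eventually.of_forall fun p => ?_)
    simp only
    rw [hν, ← hψ]
    ring
  rw [h1, integral_mul_confLaplacian, integral_mul_confLaplacian]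
  have hc : ∀ a b : C^∞⟮𝓡 n, M; ℝ⟯, Integrable
      (fun p => gradForm g p a b + cn n * scalarCurvature g p * (a p * b p)) (vol g) := fun a b =>
    integrable_of_continuous g ((continuous_gradForm g a b).add
      ((continuous_const.mul (continuous_scalarCurvature g)).mul
        (a.contMDiff.continuous.mul b.contMDiff.continuous)))
  refine integral_mono (hc _ _) (hc _ _) fun p => ?_
  have h2 := gradForm_jacobi g p ν.1 w
  rw [← hs] at h2
  simp only
  rw [h2, hψ, ← sq]
  have h3 : 0 ≤ ν.1 p ^ 2 * gradForm g p w w :=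
    mul_nonneg (sq_nonneg _) (gradForm_self_nonneg g p w)
  linarith

/-! ### The maximizing conformal metric -/

/-- On the empty manifold the infimum in the Yamabe invariant is taken over the empty set and has
the junk value `0`; positivity of the invariant excludes this case. -/
theorem yamabe_of_isEmpty [IsEmpty M] (g : RMetric n M) : yamabe g = 0 := by
  rw [yamabe]
  convert Real.sInf_empty
  refine Set.eq_empty_of_forall_notMem ?_
  rintro q ⟨u, η, -, hu, -⟩
  exact hu (Eventually.of_forall fun x => isEmptyElim x)

/-- The upper bound for `F_g^1`, from the test function `1 / μ`. -/
theorem F1_le (hn : 3 ≤ n) [Nonempty M] (g : RMetric n M) (μ : PosSmooth n M) :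
    F1 g μ ≤ cn n * ∫ y, scalarCurvature g y ∂(vol g) := by
  have hfac : 0 < ∫ x, factor μ x ∂(vol g) :=
    integral_pos_of_pos g (continuous_factor μ) (factor_pos μ)
  have h1 : ∫ x, (posInv μ).1 x ^ 2 ∂(vol (conformal g μ)) = ∫ x, factor μ x ∂(vol g) := by
    rw [integral_vol_conformal]
    simp only [confWeight_mul_sq_inv hn]
  have h2 : ∫ x, (posInv μ).1 x * confLaplacian (conformal g μ) (posInv μ).1 x
      ∂(vol (conformal g μ)) = cn n * ∫ y, scalarCurvature g y ∂(vol g) := by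
    rw [integral_vol_conformal, ← integral_const_mul]
    refine integral_congr_ae (Eventually.of_forall fun p => ?_)
    simp only
    rw [confLaplacian_conformal_inv hn]
    have h3 := confWeight_mul_sq_inv hn μ p
    have h4 := (factor_pos μ p).ne'
    calc confWeight μ p * ((posInv μ).1 p *
          (cn n * scalarCurvature g p * ((factor μ p)⁻¹ * (posInv μ).1 p)))
        = (confWeight μ p * (posInv μ).1 p ^ 2) * (factor μ p)⁻¹ *
            (cn n * scalarCurvature g p) := by ring
      _ = cn n * scalarCurvature g p := by rw [h3, mul_inv_cancel₀ h4, one_mul]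
  have h3 := lambda1_le (conformal g μ) (s := (posInv μ).1) (by rw [h1]; exact hfac)
  rw [h1, h2] at h3
  rw [F1]
  exact (le_div_iff₀ hfac).1 h3

/-- The function `μ` with `μ^(4/(n-2)) = R_g / I`. -/
def curvatureFactor (g : RMetric n M) (hR : ∀ x, 0 < scalarCurvature g x) (I : ℝ) (hI : 0 < I) :
    PosSmooth n M :=
  ⟨⟨fun x => (scalarCurvature g x / I) ^ (((n : ℝ) - 2) / 4), fun x => by
    have h : ContDiffAt ℝ ∞ (fun t : ℝ => (t / I) ^ (((n : ℝ) - 2) / 4)) (scalarCurvature g x) :=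
      (contDiffAt_id.div_const I).rpow_const_of_ne (div_pos (hR x) hI).ne'
    exact h.contMDiffAt.comp x (contMDiff_scalarCurvature g x)⟩,
    fun x => Real.rpow_pos_of_pos (div_pos (hR x) hI) _⟩

theorem factor_curvatureFactor (hn : 3 ≤ n) (g : RMetric n M)
    (hR : ∀ x, 0 < scalarCurvature g x) {I : ℝ} (hI : 0 < I) (x : M) :
    factor (curvatureFactor g hR I hI) x = scalarCurvature g x / I := by
  have hn2 : (n : ℝ) - 2 ≠ 0 := by
    have : (3 : ℝ) ≤ n := by exact_mod_cast hn
    linarith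
  change ((scalarCurvature g x / I) ^ (((n : ℝ) - 2) / 4)) ^ (4 / ((n : ℝ) - 2)) = _
  rw [← Real.rpow_mul (div_pos (hR x) hI).le]
  have : ((n : ℝ) - 2) / 4 * (4 / ((n : ℝ) - 2)) = 1 := by field_simp
  rw [this, Real.rpow_one]

end FirstEigenvalue

end ConfLap

theorem theorem1p3 {n : ℕ} (hn : 3 ≤ n) {M : Type*} [TopologicalSpace M]
    [ChartedSpace (EuclideanSpace ℝ (Fin n)) M] [IsManifold (𝓡 n) ∞ M]
    [CompactSpace M] [T2Space M] [MeasurableSpace M] [BorelSpace M]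
    (g : RMetric n M) (hY : 0 < ConfLap.yamabe g) (hR : ∀ x, 0 < ConfLap.scalarCurvature g x) :
    ∃ μmax : PosSmooth n M,
      (∀ (x : M) (v w : TangentSpace (𝓡 n) x),
        (ConfLap.conformal g μmax).inner x v w =
          (ConfLap.scalarCurvature g x /
            ∫ y, ConfLap.scalarCurvature g y ∂(ConfLap.vol g)) * g.inner x v w) ∧
      IsGreatest (Set.range (ConfLap.F1 g)) (ConfLap.F1 g μmax) ∧
      ConfLap.F1 g μmax = ConfLap.Lambda1 g ∧
      ConfLap.Lambda1 g =
        ConfLap.cn n * ∫ y, ConfLap.scalarCurvature g y ∂(ConfLap.vol g) := by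
  have hM : Nonempty M := by
    by_contra h
    rw [not_nonempty_iff] at h
    exact hY.ne' (ConfLap.yamabe_of_isEmpty g)
  set I := ∫ y, ConfLap.scalarCurvature g y ∂(ConfLap.vol g) with hIdef
  have hI : 0 < I := ConfLap.integral_pos_of_pos g (ConfLap.continuous_scalarCurvature g) hR
  set μ := ConfLap.curvatureFactor g hR I hI with hμ
  have hfac : ∀ x, ConfLap.factor μ x = ConfLap.scalarCurvature g x / I :=
    ConfLap.factor_curvatureFactor hn g hR hI
  have hone : ∫ x, ConfLap.factor μ x ∂(ConfLap.vol g) = 1 := by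
    simp only [hfac]
    rw [integral_div, ← hIdef, div_self hI.ne']
  -- In the metric `(R_g / I) g`, the function `1 / μ` is a positive eigenfunction for `c_n I`.
  have hlower : ConfLap.cn n * I ≤ ConfLap.F1 g μ := by
    rw [ConfLap.F1, hone, mul_one]
    refine ConfLap.le_lambda1_of_eigenfunction _ (ConfLap.posInv μ) fun p => ?_
    rw [ConfLap.confLaplacian_conformal_inv hn, hfac]
    have h1 := (hR p).ne'
    field_simp
  have hupper : ∀ μ', ConfLap.F1 g μ' ≤ ConfLap.cn n * I := ConfLap.F1_le hn g
  have hgreat : IsGreatest (Set.range (ConfLap.F1 g)) (ConfLap.F1 g μ) := by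
    refine ⟨⟨μ, rfl⟩, ?_⟩
    rintro _ ⟨μ', rfl⟩
    exact (hupper μ').trans hlower
  have hsup : ConfLap.F1 g μ = ConfLap.Lambda1 g := hgreat.csSup_eq.symm
  refine ⟨μ, fun x v w => ?_, hgreat, hsup, ?_⟩
  · rw [← hfac]
    rfl
  · rw [← hsup]
    exact le_antisymm (hupper μ) hlower

end
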